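/- **Theorem 5.5 (spectrum of $\gamma_1\gamma_2$).** Identify $\mathbb R^2$ with $\mathbb C$. Let $\Omega_j=B_{r_j}(x_j)$, $j\in\{1,2\}$, be two open disks with $\Omega_1\cap\Omega_2\neq\emptyset$, neither of which is contained in the other. Let $a$ be one of the two points of $\partial\Omega_1\cap\partial\Omega_2$, let $\theta\in(0,\pi)$ be the angle at $a$ between the segments from $a$ to $x_1$ and to $x_2$, and let $\sigma\in(0,\pi)$ be the angle at $x_1$ between the segments from $x_1$ to $a$ and to $x_2$; thus $\sigma$ is half the aperture angle of the interior arc $\Gamma_1^{\rm int}=\partial\Omega_1\cap\Omega_2$. The spaces $L^2(\partial\Omega_j)$ of complex-valued functions are taken with respect to the one-dimensional Hausdorff measure $\mathscr H^1$. For $\{i,j\}=\{1,2\}$, let $\gamma_j$ be the harmonic Dirichlet-to-Dirichlet map: for $g\in L^2(\partial\Omega_i)$, $\gamma_j g$ is the restriction to $\Gamma_j^{\rm int}=\partial\Omega_j\cap\Omega_i$, extended by zero to the rest of $\partial\Omega_j$, of the Poisson integral $$\mathrm P_i[g](x)=\frac1{2\pi}\int_{\partial\Omega_i}\frac{r_i^2-|x-x_i|^2}{r_i|x-y|^2}\,g(y)\,d\mathscr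 H^1(y),\qquad x\in\Omega_i .$$ Let $\mathcal S^*=\{z\in\mathbb C:|\operatorname{Im}z|<1/2\}$ and $\widehat{\mathscr P}_{\pi-\theta}(z)=\sinh(\theta z)/\sinh(\pi z)$, with $\widehat{\mathscr P}_{\pi-\theta}(0)=\theta/\pi$. Then $\gamma_j:L^2(\partial\Omega_i)\to L^2(\partial\Omega_j)$ is a bounded linear operator, and the operator $\gamma_1\gamma_2$ on $L^2(\partial\Omega_1)$ satisfies: 1. its spectrum is $\sigma(\gamma_1\gamma_2)=\mathrm{cl}\,\bigl\{\overline{\widehat{\mathscr P}_{\pi-\theta}(z)^2}: z\in\mathcal S^*\bigr\}$; 2. its spectral radius is $\rho(\gamma_1\gamma_2)=\sup\{|\lambda|:\lambda\in\sigma(\gamma_1\gamma_2)\}=\frac{1-\cos\theta}{2}$; 3. for every $z_0\in\mathcal S^*$, the number $\overline{\widehat{\mathscr P}_{\pi-\theta}(z_0)^2}$ is an eigenvalue of $\gamma_1\gamma_2$; an eigenfunction is the (nonzero) function in $L^2(\partial\Omega_1)$ that vanishes outside $\Gamma_1^{\rm int}$ and is given on $\Gamma_1^{\rm int}$ by $$f(\phi)=\left(\frac{1-\cos(\phi+\sigma)}{\cos\phi-\cos\sigma}\right)^{\imath\overline{z_0}},\qquad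 \phi\in(-\sigma,\sigma),$$ where $\phi$ is the angular coordinate with $x=x_1+r_1e^{\imath\phi}\frac{x_2-x_1}{|x_2-x_1|}$ (the base of the power is a positive real number). -/

import Mathlib

open MeasureTheory Metric Complex ComplexConjugate

noncomputable section

/-- The one-dimensional Hausdorff measure on the circle `∂B_r(x)`; the plane is identified
with `ℂ`. -/
def circleMeasure (x : ℂ) (r : ℝ) : Measure ℂ :=
  (Measure.hausdorffMeasure 1).restrict (sphere x r)

/-- The complex Hilbert space `L²(∂B_r(x))` with respect to the Hausdorff measure. -/
abbrev CircleL2 (x : ℂ) (r : ℝ) : Type :=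
  Lp ℂ 2 (circleMeasure x r)

/-- The Poisson integral on the disk `B_r(x)`, evaluated at the point `p`. -/
def poissonIntegral (x : ℂ) (r : ℝ) (g : ℂ → ℂ) (p : ℂ) : ℂ :=
  (1 / (2 * Real.pi) : ℝ) *
    ∫ y, (((r ^ 2 - ‖p - x‖ ^ 2) / (r * ‖p - y‖ ^ 2) : ℝ) : ℂ) * g y ∂(circleMeasure x r)

/-- The interior boundary `∂B_r(x) ∩ B_r'(x')` of the disk `B_r(x)` with respect to a
second disk `B_r'(x')`. -/
def interiorArc (x : ℂ) (r : ℝ) (x' : ℂ) (r' : ℝ) : Set ℂ :=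
  sphere x r ∩ ball x' r'

/-- `γ` is the harmonic Dirichlet-to-Dirichlet map `L²(∂B_r'(x')) → L²(∂B_r(x))`: it sends `g`
to the restriction of the Poisson integral of `g` on `B_r'(x')` to the interior boundary of
`B_r(x)`, extended by zero to the rest of `∂B_r(x)`. This determines `γ` uniquely. -/
def IsDtD (x : ℂ) (r : ℝ) (x' : ℂ) (r' : ℝ) (γ : CircleL2 x' r' →L[ℂ] CircleL2 x r) : Prop :=
  ∀ g : CircleL2 x' r',
    (γ g : ℂ → ℂ) =ᵐ[circleMeasure x r]
      (interiorArc x r x' r').indicator (poissonIntegral x' r' g)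

/-- The dual strip `ℝ × (-1/2, 1/2)` in the complex plane. -/
def dualStrip : Set ℂ := {z | |z.im| < 1 / 2}

/-- The Fourier transform `z ↦ sinh ((π - θ) z) / sinh (π z)` of the Poisson kernel of the strip,
with its removable singularity at `0` filled in. -/
def poissonHat (θ : ℝ) (z : ℂ) : ℂ :=
  if z = 0 then ((Real.pi - θ) / Real.pi : ℝ)
  else Complex.sinh ((Real.pi - θ : ℝ) * z) / Complex.sinh (Real.pi * z)

/-- The angular coordinate `φ ∈ (-π, π]` of a point `p` as seen from `x`, measured from the
direction of `x'`: for `p` on the circle of radius `r` around `x` one has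
`p = x + r * exp (i φ) * (x' - x) / |x' - x|`. -/
def arcAngle (x x' p : ℂ) : ℝ := Complex.arg ((p - x) / (x' - x))

/-- The function `((1 - cos (φ + σ)) / (cos φ - cos σ)) ^ (i * conj z₀)` of the angle `φ` on the
interior boundary of `B_r(x)`, extended by zero. The base of the power is a positive real number
on the interior boundary when `σ` is half the aperture angle of this arc. -/
def arcEigenfunction (x : ℂ) (r : ℝ) (x' : ℂ) (r' : ℝ) (σ : ℝ) (z₀ : ℂ) : ℂ → ℂ :=
  (interiorArc x r x' r').indicator fun p =>
    (((1 - Real.cos (arcAngle x x' p + σ)) /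
      (Real.cos (arcAngle x x' p) - Real.cos σ) : ℝ) : ℂ) ^ (Complex.I * conj z₀)

end

/-! The two circles meet in two points. In bipolar coordinates with these poles (`t` is the
logarithm of the ratio of the distances to them, `β` an angle), the two circles without the poles
split into four arcs, each a line `β = const`, and each disk becomes a strip of width π. The Poisson
integral of a disk, evaluated on an arc inside it, becomes a sum of two convolutions in `t`, one for
each complementary boundary arc, with the kernels `stripKernel` (`poissonKernel_mul_bipolarSpeed`,
`poissonIntegral_bipolarArc`). Arc length has a density comparable to `exp (-|t|)`, so restricting
to an arc and multiplying by `exp (-|t| / 2)` identifies L² of the arc with L² of the line, up to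
equivalence of norms.

The output of each Dirichlet-to-Dirichlet map lives on an interior arc. Hence γ₁γ₂ = E ∘ B, where E
extends functions from the first interior arc, and B ∘ E = C², where C is the weighted convolution
with the kernel of height π - θ. Products in opposite order have the same spectrum up to zero
(`spectrum_comp_subset`), and zero belongs to the asserted set because `poissonHat` decays along the
real axis.

Upper bound for the spectrum of C: together with the weighted translations U_s, which have norm at
most `exp (|s| / 2)`, C lies in a commutative Banach algebra, and C² is the average of U_s C against
the kernel. A character χ with χ(C) ≠ 0 sends U_s to `exp (c * s)` with |Re c| ≤ 1/2, so χ(C) is the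
Laplace transform of the kernel at c (`spectrum_subset_of_integral`). Cauchy's theorem on a
rectangle evaluates this transform as `poissonHat` (`integral_stripKernel_add`).

Lower bound: for |Re c| < 1/2 the weighted exponentials are square-integrable eigenvectors of C.
Transported to the arc they are the asserted eigenfunctions, because the base of the power equals
`exp t` there (`arcAngle_ratio_eq_exp`). The spectral radius follows since the kernel is positive
and even: |`poissonHat`| is maximal on the closed strip at i/2. -/

/-! ### Banach algebras: the spectrum of an average over a one-parameter group. -/

/-- A continuous one-parameter multiplicative family of complex numbers is an exponential. -/
theorem exists_eq_exp_of_continuous_of_map_add {ψ : ℝ → ℂ} (hc : Continuous ψ) (h0 : ψ 0 = 1)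
    (hadd : ∀ s t, ψ (s + t) = ψ s * ψ t) : ∃ c : ℂ, ∀ s : ℝ, ψ s = Complex.exp (c * s) := by
  have hG : ∀ x : ℝ, HasDerivAt (fun x => ∫ t in (0 : ℝ)..x, ψ t) (ψ x) x := fun x =>
    intervalIntegral.integral_hasDerivAt_right (hc.intervalIntegrable _ _)
      (hc.stronglyMeasurableAtFilter _ _) hc.continuousAt
  -- Integrating the functional equation over [0, δ] and dividing by this integral writes `ψ`
  -- through its own primitive, so continuity upgrades to differentiability.
  obtain ⟨δ, hδ⟩ : ∃ δ : ℝ, (∫ t in (0 : ℝ)..δ, ψ t) ≠ 0 := by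
    have := (hG 0).eventually_ne (c := (0 : ℂ)) (by simp [h0])
    exact this.exists
  have key : ∀ s, ψ s = ((∫ t in (0 : ℝ)..(s + δ), ψ t) - ∫ t in (0 : ℝ)..s, ψ t) /
      ∫ t in (0 : ℝ)..δ, ψ t := by
    intro s
    rw [eq_div_iff hδ, intervalIntegral.integral_interval_sub_left (hc.intervalIntegrable _ _)
      (hc.intervalIntegrable _ _), ← intervalIntegral.integral_const_mul]
    simp_rw [← hadd]
    rw [intervalIntegral.integral_comp_add_left]
    simp
  have hd : ∀ s, DifferentiableAt ℝ ψ s := by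
    intro s
    have : ψ = fun s => ((∫ t in (0 : ℝ)..(s + δ), ψ t) - ∫ t in (0 : ℝ)..s, ψ t) /
      ∫ t in (0 : ℝ)..δ, ψ t := funext key
    rw [this]
    exact (((hG (s + δ)).comp_add_const s δ).differentiableAt.sub
      (hG s).differentiableAt).div_const _
  set c := deriv ψ 0 with hcdef
  have hder : ∀ s, HasDerivAt ψ (c * ψ s) s := by
    intro s
    have h1 : HasDerivAt (fun t => ψ s * ψ (t - s)) (ψ s * c) s := by
      have h2 : HasDerivAt ψ c (s - s) := by
        rw [sub_self]
        exact (hd 0).hasDerivAt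
      exact (h2.comp_sub_const s s).const_mul _
    have h3 : (fun t => ψ s * ψ (t - s)) = ψ := by
      funext t
      rw [← hadd]
      congr 1
      ring
    rw [h3] at h1
    rwa [mul_comm]
  refine ⟨c, fun s => ?_⟩
  have hexp : ∀ s : ℝ, HasDerivAt (fun s : ℝ => Complex.exp (-(c * s)))
      (Complex.exp (-(c * s)) * (-(c * 1))) s := fun s =>
    (((hasDerivAt_id s).ofReal_comp.const_mul c).neg).cexp
  have hconst : ∀ s, HasDerivAt (fun s : ℝ => ψ s * Complex.exp (-(c * s))) 0 s := by
    intro s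
    have h := (hder s).mul (hexp s)
    have h' : c * ψ s * Complex.exp (-(c * s)) +
        ψ s * (Complex.exp (-(c * s)) * (-(c * 1))) = 0 := by ring
    rw [h'] at h
    exact h
  have := is_const_of_deriv_eq_zero (fun s => (hconst s).differentiableAt)
    (fun s => (hconst s).deriv) s 0
  simp only [h0, Complex.ofReal_zero, mul_zero, neg_zero, Complex.exp_zero, mul_one] at this
  rw [Complex.exp_neg] at this
  field_simp [Complex.exp_ne_zero] at this
  exact this

/-- The exponent of a complex exponential that grows at most like `exp (|s| / 2)`. -/
theorem abs_re_le_half_of_norm_exp_le {c : ℂ}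
    (h : ∀ s : ℝ, ‖Complex.exp (c * s)‖ ≤ Real.exp (|s| / 2)) : |c.re| ≤ 1 / 2 := by
  have h1 := h 1
  have h2 := h (-1)
  simp only [Complex.norm_exp, Real.exp_le_exp] at h1 h2
  simp at h1 h2
  rw [abs_le]
  constructor <;> linarith

/-- Continuity is assumed only for the products `U s * C`: translations themselves are not norm
continuous, but they become so after multiplication by a convolution. -/
theorem integrable_smul_mul {B : Type*} [NormedRing B] [NormedAlgebra ℂ B] {C : B} {U : ℝ → B}
    {P : ℝ → ℝ} (hnorm : ∀ s, ‖U s‖ ≤ Real.exp (|s| / 2)) (hcont : Continuous fun s => U s * C)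
    (hP : Integrable fun s => P s * Real.exp (|s| / 2)) (hPm : AEStronglyMeasurable P) :
    Integrable fun s => P s • (U s * C) := by
  refine (hP.norm.mul_const ‖C‖).mono' (hPm.smul hcont.aestronglyMeasurable)
    (Filter.Eventually.of_forall fun s => ?_)
  rw [norm_smul, norm_mul (P s), Real.norm_of_nonneg (Real.exp_pos _).le, mul_assoc]
  gcongr
  exact (norm_mul_le _ _).trans (by gcongr; exact hnorm s)

/-- The spectrum of an element of a commutative Banach algebra that is averaged against a
one-parameter group of moderate growth. -/
theorem spectrum_subset_of_integral_commutative {B : Type*} [NormedCommRing B] [NormOneClass B]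
    [NormedAlgebra ℂ B] [CompleteSpace B] {C : B} {U : ℝ → B} {P : ℝ → ℝ}
    (h0 : U 0 = 1) (hadd : ∀ s t, U (s + t) = U s * U t)
    (hnorm : ∀ s, ‖U s‖ ≤ Real.exp (|s| / 2)) (hcont : Continuous fun s => U s * C)
    (hP : Integrable fun s => P s * Real.exp (|s| / 2)) (hPm : AEStronglyMeasurable P)
    (hC : C * C = ∫ s, P s • (U s * C)) :
    spectrum ℂ C ⊆ insert 0 {w | ∃ c : ℂ, |c.re| ≤ 1 / 2 ∧
      w = ∫ s, (P s : ℂ) * Complex.exp (c * s)} := by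
  have hint : Integrable fun s => P s • (U s * C) :=
    integrable_smul_mul hnorm hcont hP hPm
  intro w hw
  obtain ⟨χ, rfl⟩ := WeakDual.CharacterSpace.mem_spectrum_iff_exists.1 hw
  by_cases hχ : χ C = 0
  · left
    exact hχ
  right
  have hχc : Continuous χ := map_continuous χ
  -- `U` need not be continuous; dividing by the nonzero number `χ C` transfers continuity from `U s
  -- * C`.
  have hψ : Continuous fun s => χ (U s) := by
    have : (fun s => χ (U s)) = fun s => χ (U s * C) / χ C := by
      funext s
      rw [map_mul]
      field_simp
    rw [this]
    exact (hχc.comp hcont).div_const _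
  obtain ⟨c, hc⟩ := exists_eq_exp_of_continuous_of_map_add hψ (by rw [h0, map_one])
    (fun s t => by rw [hadd, map_mul])
  refine ⟨c, abs_re_le_half_of_norm_exp_le fun s => ?_, ?_⟩
  · rw [← hc]
    exact (AlgHom.norm_apply_le_self χ (U s)).trans (hnorm s)
  · have h1 : χ (C * C) = ∫ s, χ (P s • (U s * C)) := by
      rw [hC]
      exact ((WeakDual.CharacterSpace.toCLM χ).integral_comp_comm hint).symm
    have h2 : ∀ s, χ (P s • (U s * C)) = ((P s : ℂ) * Complex.exp (c * s)) * χ C := by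
      intro s
      have : P s • (U s * C) = (P s : ℂ) • (U s * C) := by simp
      rw [this, map_smul, map_mul, hc, smul_eq_mul, mul_assoc]
    simp_rw [h2] at h1
    -- Both sides now carry the factor `χ C`, which cancels.
    rw [integral_mul_const, map_mul] at h1
    exact mul_right_cancel₀ hχ h1

/-- The spectrum of an element of a Banach algebra that is averaged against a commuting
one-parameter group of moderate growth. -/
theorem spectrum_subset_of_integral {A : Type*} [NormedRing A] [NormOneClass A]
    [NormedAlgebra ℂ A] [CompleteSpace A] {C : A} {U : ℝ → A} {P : ℝ → ℝ}
    (h0 : U 0 = 1) (hadd : ∀ s t, U (s + t) = U s * U t) (hcomm : ∀ s, U s * C = C * U s)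
    (hnorm : ∀ s, ‖U s‖ ≤ Real.exp (|s| / 2)) (hcont : Continuous fun s => U s * C)
    (hP : Integrable fun s => P s * Real.exp (|s| / 2)) (hPm : AEStronglyMeasurable P)
    (hC : C * C = ∫ s, P s • (U s * C)) :
    spectrum ℂ C ⊆ insert 0 {w | ∃ c : ℂ, |c.re| ≤ 1 / 2 ∧
      w = ∫ s, (P s : ℂ) * Complex.exp (c * s)} := by
  -- The closed algebra generated by `C` and the group is commutative, and passing to a subalgebra
  -- can only enlarge the spectrum, so the commutative case suffices.
  set S : Set A := insert C (Set.range U)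
  have hUU : ∀ s t, U s * U t = U t * U s := fun s t => by rw [← hadd, add_comm, hadd]
  have hS : ∀ a ∈ S, ∀ b ∈ S, a * b = b * a := by
    rintro a (rfl | ⟨s, rfl⟩) b (rfl | ⟨t, rfl⟩)
    · rfl
    · exact (hcomm t).symm
    · exact hcomm s
    · exact hUU s t
  have := Algebra.isMulCommutative_adjoin ℂ hS
  set B : Subalgebra ℂ A := (Algebra.adjoin ℂ S).topologicalClosure with hB
  have hmul : ∀ x y : B, x * y = y * x :=
    (Subalgebra.commRingTopologicalClosure (Algebra.adjoin ℂ S)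
      (fun x y => mul_comm' x y)).mul_comm
  let _ : NormedCommRing B := { (inferInstance : NormedRing B) with mul_comm := hmul }
  have hcl : IsClosed (B : Set A) := Subalgebra.isClosed_topologicalClosure _
  have : CompleteSpace B := hcl.completeSpace_coe
  have : NormOneClass B := ⟨norm_one (α := A)⟩
  have hSB : ∀ a ∈ S, a ∈ B := fun a ha =>
    Subalgebra.le_topologicalClosure _ (Algebra.subset_adjoin ha)
  let C' : B := ⟨C, hSB _ (Set.mem_insert _ _)⟩
  let U' : ℝ → B := fun s => ⟨U s, hSB _ (Set.mem_insert_of_mem _ ⟨s, rfl⟩)⟩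
  have hcont' : Continuous fun s => U' s * C' := by
    rw [continuous_induced_rng]
    exact hcont
  have hint' : Integrable fun s => P s • (U' s * C') :=
    integrable_smul_mul (U := U') hnorm hcont' hP hPm
  have := spectrum_subset_of_integral_commutative (C := C') (U := U') (P := P)
    (Subtype.ext h0) (fun s t => Subtype.ext (hadd s t)) hnorm hcont' hP hPm (by
      apply Subtype.ext
      let val : B →L[ℝ] A := ⟨B.val.toLinearMap.restrictScalars ℝ, continuous_subtype_val⟩
      exact hC.trans (val.integral_comp_comm hint'))
  exact (AlgHom.spectrum_apply_subset B.val C').trans this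

/-! ### Bounded operators between L² spaces: weighted compositions and kernels. -/

/-- The Hilbert space of square-integrable complex functions on the line. -/
abbrev LineL2 : Type := Lp ℂ 2 (volume : Measure ℝ)

theorem eLpNorm_two_sq {α : Type*} [MeasurableSpace α] (μ : Measure α) (f : α → ℂ) :
    eLpNorm f 2 μ ^ 2 = ∫⁻ x, ‖f x‖ₑ ^ 2 ∂μ := by
  have := eLpNorm_nnreal_pow_eq_lintegral (f := f) (μ := μ) (p := 2) (by norm_num)
  simp only [NNReal.coe_ofNat, ENNReal.rpow_ofNat] at this
  exact this

theorem eLpNorm_two_le_of_lintegral_le {α β : Type*} [MeasurableSpace α] [MeasurableSpace β]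
    {μ : Measure α} {ν : Measure β} {f : α → ℂ} {g : β → ℂ} {K : ℝ}
    (h : ∫⁻ y, ‖g y‖ₑ ^ 2 ∂ν ≤ ENNReal.ofReal K ^ 2 * ∫⁻ x, ‖f x‖ₑ ^ 2 ∂μ) :
    eLpNorm g 2 ν ≤ ENNReal.ofReal K * eLpNorm f 2 μ := by
  rw [← ENNReal.pow_le_pow_left_iff (two_ne_zero), mul_pow, eLpNorm_two_sq, eLpNorm_two_sq]
  exact h

/-- A bounded operator between `L²` spaces from a linear operation on functions. -/
theorem exists_continuousLinearMap_Lp_two {α β : Type*} [MeasurableSpace α] [MeasurableSpace β]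
    {μ : Measure α} {ν : Measure β} (T : (α → ℂ) → (β → ℂ)) {K : ℝ} (hK : 0 ≤ K)
    (hcongr : ∀ f g : α → ℂ, f =ᵐ[μ] g → T f =ᵐ[ν] T g)
    (hadd : ∀ f g : Lp ℂ 2 μ, T (f + g) =ᵐ[ν] T f + T g)
    (hsmul : ∀ (c : ℂ) (f : Lp ℂ 2 μ), T (c • ⇑f) =ᵐ[ν] c • T f)
    (hmeas : ∀ f : Lp ℂ 2 μ, AEStronglyMeasurable (T f) ν)
    (hbd : ∀ f : Lp ℂ 2 μ,
      ∫⁻ y, ‖T f y‖ₑ ^ 2 ∂ν ≤ ENNReal.ofReal K ^ 2 * ∫⁻ x, ‖f x‖ₑ ^ 2 ∂μ) :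
    ∃ L : Lp ℂ 2 μ →L[ℂ] Lp ℂ 2 ν, (∀ f, L f =ᵐ[ν] T f) ∧ ‖L‖ ≤ K := by
  have hle : ∀ f : Lp ℂ 2 μ, eLpNorm (T f) 2 ν ≤ ENNReal.ofReal K * eLpNorm f 2 μ :=
    fun f => eLpNorm_two_le_of_lintegral_le (hbd f)
  have hmem : ∀ f : Lp ℂ 2 μ, MemLp (T f) 2 ν := fun f =>
    ⟨hmeas f, (hle f).trans_lt (ENNReal.mul_lt_top ENNReal.ofReal_lt_top (Lp.eLpNorm_lt_top f))⟩
  let L₀ : Lp ℂ 2 μ →ₗ[ℂ] Lp ℂ 2 ν :=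
    { toFun := fun f => (hmem f).toLp _
      map_add' := by
        intro f g
        apply Lp.ext
        filter_upwards [(hmem (f + g)).coeFn_toLp, (hmem f).coeFn_toLp, (hmem g).coeFn_toLp,
          Lp.coeFn_add ((hmem f).toLp _) ((hmem g).toLp _), hcongr _ _ (Lp.coeFn_add f g),
          hadd f g] with y h1 h2 h3 h4 h5 h6
        rw [h1, h4, h5, h6, Pi.add_apply, Pi.add_apply, h2, h3]
      map_smul' := by
        intro c f
        apply Lp.ext
        filter_upwards [(hmem (c • f)).coeFn_toLp, (hmem f).coeFn_toLp,
          Lp.coeFn_smul c ((hmem f).toLp _), hcongr _ _ (Lp.coeFn_smul c f),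
          hsmul c f] with y h1 h2 h3 h4 h5
        rw [h1, RingHom.id_apply, h3, h4, h5, Pi.smul_apply, Pi.smul_apply, h2] }
  have hnorm : ∀ f, ‖L₀ f‖ ≤ K * ‖f‖ := by
    intro f
    change ‖(hmem f).toLp _‖ ≤ _
    rw [Lp.norm_toLp, Lp.norm_def]
    refine ENNReal.toReal_le_of_le_ofReal (by positivity) ((hle f).trans ?_)
    rw [ENNReal.ofReal_mul hK, ENNReal.ofReal_toReal (Lp.eLpNorm_ne_top f)]
  exact ⟨L₀.mkContinuous K hnorm, fun f => (hmem f).coeFn_toLp,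
    L₀.mkContinuous_norm_le hK hnorm⟩

/-- Weighted composition operators between `L²` spaces. -/
theorem exists_weightedComp {α β : Type*} [MeasurableSpace α] [MeasurableSpace β]
    {μ : Measure α} {ν : Measure β} {φ : β → α} {w : β → ℝ} (hφ : Measurable φ)
    (hw : Measurable w) {K : ℝ} (hK : 0 ≤ K)
    (h : ((ν.withDensity fun y => ‖w y‖ₑ ^ 2).map φ) ≤ (ENNReal.ofReal K ^ 2) • μ) :
    ∃ L : Lp ℂ 2 μ →L[ℂ] Lp ℂ 2 ν,
      (∀ f, L f =ᵐ[ν] fun y => (w y : ℂ) * f (φ y)) ∧ ‖L‖ ≤ K := by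
  have hac : (ν.withDensity fun y => ‖w y‖ₑ ^ 2).map φ ≪ μ :=
    (Measure.absolutelyContinuous_of_le h).trans Measure.smul_absolutelyContinuous
  have hwm : Measurable fun y => ‖w y‖ₑ ^ 2 := by fun_prop
  refine exists_continuousLinearMap_Lp_two (fun f y => (w y : ℂ) * f (φ y)) hK ?_ ?_ ?_ ?_ ?_
  · intro f g hfg
    have h1 := ae_of_ae_map hφ.aemeasurable (hac.ae_eq hfg)
    rw [ae_withDensity_iff hwm] at h1
    filter_upwards [h1] with y hy
    -- Where the weight vanishes the measure with density gives no information, but there both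
    -- products are zero.
    by_cases hwy : w y = 0
    · simp [hwy]
    · rw [hy (by simpa using hwy)]
  · intro f g
    exact Filter.Eventually.of_forall fun y => by simp [mul_add]
  · intro c f
    exact Filter.Eventually.of_forall fun y => by simp [mul_left_comm]
  · intro f
    exact (Complex.measurable_ofReal.comp hw).aestronglyMeasurable.mul
      ((Lp.stronglyMeasurable f).measurable.comp hφ).aestronglyMeasurable
  · intro f
    have hfm : Measurable fun x => ‖f x‖ₑ ^ 2 :=
      ((Lp.stronglyMeasurable f).measurable.enorm).pow_const 2
    calc ∫⁻ y, ‖(w y : ℂ) * f (φ y)‖ₑ ^ 2 ∂ν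
        = ∫⁻ y, ‖w y‖ₑ ^ 2 * ‖f (φ y)‖ₑ ^ 2 ∂ν := by
          refine lintegral_congr fun y => ?_
          rw [enorm_mul, mul_pow]
          congr 2
          rw [← ofReal_norm, ← ofReal_norm, Complex.norm_real]
      _ = ∫⁻ x, ‖f x‖ₑ ^ 2 ∂((ν.withDensity fun y => ‖w y‖ₑ ^ 2).map φ) := by
          rw [lintegral_map hfm hφ]
          exact (lintegral_withDensity_eq_lintegral_mul _ hwm (hfm.comp hφ)).symm
      _ ≤ ∫⁻ x, ‖f x‖ₑ ^ 2 ∂((ENNReal.ofReal K ^ 2) • μ) := lintegral_mono' h le_rfl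
      _ = _ := by rw [lintegral_smul_measure, smul_eq_mul]

/-- Cauchy–Schwarz applied to the splitting a·b = √a · (√a b). -/
theorem sq_lintegral_mul_le {α : Type*} [MeasurableSpace α] {μ : Measure α} {a b : α → ENNReal}
    (ha : Measurable a) (hb : Measurable b) :
    (∫⁻ x, a x * b x ∂μ) ^ 2 ≤ (∫⁻ x, a x ∂μ) * ∫⁻ x, a x * b x ^ 2 ∂μ := by
  have h2 : (2 : ℝ).HolderConjugate 2 := by constructor <;> norm_num
  have hsq : ∀ c : ENNReal, (c ^ (1 / 2 : ℝ)) ^ (2 : ℝ) = c := fun c => by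
    rw [← ENNReal.rpow_mul]; norm_num
  have hsq' : ∀ c : ENNReal, (c ^ (2 : ℝ)) = c ^ 2 := fun c => by
    rw [← ENNReal.rpow_natCast]; norm_num
  have hh : ∀ c : ENNReal, c ^ (1 / 2 : ℝ) * c ^ (1 / 2 : ℝ) = c := fun c => by
    rw [← sq, ← hsq', hsq]
  have := ENNReal.lintegral_mul_le_Lp_mul_Lq μ h2 (f := fun x => a x ^ (1 / 2 : ℝ))
    (g := fun x => a x ^ (1 / 2 : ℝ) * b x) (ha.pow_const _).aemeasurable
    ((ha.pow_const _).mul hb).aemeasurable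
  simp only [Pi.mul_apply, ← mul_assoc, hh, hsq,
    ENNReal.mul_rpow_of_nonneg _ _ (zero_le_two (α := ℝ)), hsq'] at this
  calc (∫⁻ x, a x * b x ∂μ) ^ 2 ≤ ((∫⁻ x, a x ∂μ) ^ (1 / 2 : ℝ) *
        (∫⁻ x, a x * b x ^ 2 ∂μ) ^ (1 / 2 : ℝ)) ^ 2 := by gcongr
    _ = _ := by rw [mul_pow, ← hsq', ← hsq', hsq, hsq]

/-- The Schur-type bound behind Young's inequality. -/
theorem lintegral_sq_lintegral_sub_le {k : ℝ → ENNReal} (hk : Measurable k) {b : ℝ → ENNReal}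
    (hb : Measurable b) :
    ∫⁻ t, (∫⁻ s, k (t - s) * b s) ^ 2 ≤ (∫⁻ u, k u) ^ 2 * ∫⁻ s, b s ^ 2 := by
  calc ∫⁻ t, (∫⁻ s, k (t - s) * b s) ^ 2
      ≤ ∫⁻ t, (∫⁻ u, k u) * ∫⁻ s, k (t - s) * b s ^ 2 := by
        refine lintegral_mono fun t => ?_
        have := sq_lintegral_mul_le (μ := volume) (a := fun s => k (t - s)) (b := b)
          (by fun_prop) hb
        rwa [lintegral_sub_left_eq_self k t] at this
    _ = (∫⁻ u, k u) * ∫⁻ t, ∫⁻ s, k (t - s) * b s ^ 2 := by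
        rw [lintegral_const_mul _ (by fun_prop)]
    _ = (∫⁻ u, k u) * ∫⁻ s, ∫⁻ t, k (t - s) * b s ^ 2 := by
        rw [lintegral_lintegral_swap (by fun_prop)]
    _ = (∫⁻ u, k u) * ∫⁻ s, (∫⁻ u, k u) * b s ^ 2 := by
        congr 1
        refine lintegral_congr fun s => ?_
        rw [lintegral_mul_const _ (by fun_prop), lintegral_sub_right_eq_self k s]
    _ = _ := by rw [lintegral_const_mul _ (by fun_prop), sq, mul_assoc]

section Kernel

variable {κ : ℝ → ℝ → ℂ} {k : ℝ → ℝ}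

theorem enorm_kernel_mul_le (hκk : ∀ t s, ‖κ t s‖ ≤ k (t - s)) (f : ℝ → ℂ) (t s : ℝ) :
    ‖κ t s * f s‖ₑ ≤ ENNReal.ofReal (k (t - s)) * ‖f s‖ₑ := by
  rw [enorm_mul, ← ofReal_norm (κ t s)]
  gcongr
  exact hκk t s

/-- Kernels dominated by an integrable convolution kernel act on every square-integrable
function almost everywhere. -/
theorem ae_integrable_kernel (hκ : Measurable (Function.uncurry κ)) (hkm : Measurable k)
    (hk : Integrable k) (hκk : ∀ t s, ‖κ t s‖ ≤ k (t - s)) (f : LineL2) :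
    ∀ᵐ t : ℝ, Integrable fun s => κ t s * f s := by
  have hfm : Measurable (f : ℝ → ℂ) := (Lp.stronglyMeasurable f).measurable
  have hf2 : ∫⁻ s, ‖f s‖ₑ ^ 2 ≠ ⊤ := by
    rw [← eLpNorm_two_sq]
    exact ENNReal.pow_ne_top (Lp.eLpNorm_ne_top f)
  have hfin : ∫⁻ t, (∫⁻ s, ENNReal.ofReal (k (t - s)) * ‖f s‖ₑ) ^ 2 ≠ ⊤ := by
    refine ne_top_of_le_ne_top ?_ (lintegral_sq_lintegral_sub_le
      (k := fun u => ENNReal.ofReal (k u)) (by fun_prop) (b := fun s => ‖f s‖ₑ) (by fun_prop))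
    refine ENNReal.mul_ne_top (ENNReal.pow_ne_top ?_) hf2
    exact hk.lintegral_lt_top.ne
  have hae := ae_lt_top (by fun_prop) hfin
  filter_upwards [hae] with t ht
  refine ⟨?_, ?_⟩
  · exact ((hκ.comp measurable_prodMk_left).mul hfm).aestronglyMeasurable
  · refine lt_of_le_of_lt (lintegral_mono fun s => enorm_kernel_mul_le hκk f t s) ?_
    by_contra hcon
    rw [not_lt, top_le_iff] at hcon
    rw [hcon] at ht
    simp at ht

/-- Kernels dominated by an integrable convolution kernel define bounded operators. -/
theorem exists_kernelOperator (hκ : Measurable (Function.uncurry κ)) (hkm : Measurable k)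
    (hk : Integrable k) (hκk : ∀ t s, ‖κ t s‖ ≤ k (t - s)) :
    ∃ L : LineL2 →L[ℂ] LineL2,
      (∀ f : LineL2, L f =ᵐ[volume] fun t => ∫ s, κ t s * f s) ∧ ‖L‖ ≤ ∫ u, k u := by
  have hk0 : ∀ u, 0 ≤ k u := fun u => by
    have := hκk u 0
    rw [sub_zero] at this
    exact (norm_nonneg _).trans this
  refine exists_continuousLinearMap_Lp_two (fun f t => ∫ s, κ t s * f s)
    (integral_nonneg hk0) ?_ ?_ ?_ ?_ ?_
  · intro f g hfg
    refine Filter.Eventually.of_forall fun t => integral_congr_ae ?_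
    filter_upwards [hfg] with s hs
    rw [hs]
  · intro f g
    filter_upwards [ae_integrable_kernel hκ hkm hk hκk f,
      ae_integrable_kernel hκ hkm hk hκk g] with t h1 h2
    simp only [Pi.add_apply, mul_add]
    exact integral_add h1 h2
  · intro c f
    refine Filter.Eventually.of_forall fun t => ?_
    simp only [Pi.smul_apply, smul_eq_mul]
    rw [← integral_const_mul]
    congr 1
    funext s
    ring
  · intro f
    have : StronglyMeasurable (Function.uncurry fun t s => κ t s * f s) :=
      (hκ.mul ((Lp.stronglyMeasurable f).measurable.comp measurable_snd)).stronglyMeasurable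
    exact this.integral_prod_right.aestronglyMeasurable
  · intro f
    have hfm : Measurable (f : ℝ → ℂ) := (Lp.stronglyMeasurable f).measurable
    calc ∫⁻ t, ‖∫ s, κ t s * f s‖ₑ ^ 2
        ≤ ∫⁻ t, (∫⁻ s, ENNReal.ofReal (k (t - s)) * ‖f s‖ₑ) ^ 2 := by
          refine lintegral_mono fun t => ?_
          gcongr
          exact (enorm_integral_le_lintegral_enorm _).trans
            (lintegral_mono fun s => enorm_kernel_mul_le hκk f t s)
      _ ≤ (∫⁻ u, ENNReal.ofReal (k u)) ^ 2 * ∫⁻ s, ‖f s‖ₑ ^ 2 :=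
          lintegral_sq_lintegral_sub_le (k := fun u => ENNReal.ofReal (k u)) (by fun_prop)
            (b := fun s => ‖f s‖ₑ) (by fun_prop)
      _ = _ := by
          rw [ofReal_integral_eq_lintegral_ofReal hk (Filter.Eventually.of_forall hk0)]

end Kernel

/-! ### Weighted convolutions and translations on the line. -/

/-- `C` is the convolution with `p` on the line, conjugated by the weight `exp (-|t| / 2)`. -/
def IsWeightedConv (p : ℝ → ℝ) (C : LineL2 →L[ℂ] LineL2) : Prop :=
  ∀ F : LineL2, C F =ᵐ[volume] fun t =>
    ∫ s, ((Real.exp (-|t| / 2) * p (t - s) * Real.exp (|s| / 2) : ℝ) : ℂ) * F s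

/-- `U` is the translation by `s`, conjugated by the weight `exp (-|t| / 2)`. -/
def IsWeightedTranslation (s : ℝ) (U : LineL2 →L[ℂ] LineL2) : Prop :=
  ∀ F : LineL2, U F =ᵐ[volume] fun t => ((Real.exp ((|t - s| - |t|) / 2) : ℝ) : ℂ) * F (t - s)

section WeightedConv

variable {p q : ℝ → ℝ}

theorem measurable_weightedConv_kernel (hp : Continuous p) :
    Measurable (Function.uncurry fun t s : ℝ =>
      ((Real.exp (-|t| / 2) * p (t - s) * Real.exp (|s| / 2) : ℝ) : ℂ)) := by
  apply Continuous.measurable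
  simp only [Function.uncurry_def]
  fun_prop

/-- Since |s| - |t| ≤ |t - s|, the weights cost at most the factor `exp (|t - s| / 2)`, so the
conjugated kernel is still dominated by a convolution kernel. -/
theorem norm_weightedConv_kernel_le (p : ℝ → ℝ) (t s : ℝ) :
    ‖((Real.exp (-|t| / 2) * p (t - s) * Real.exp (|s| / 2) : ℝ) : ℂ)‖ ≤
      |p (t - s)| * Real.exp (|t - s| / 2) := by
  rw [Complex.norm_real, Real.norm_eq_abs, abs_mul, abs_mul, Real.abs_exp, Real.abs_exp,
    mul_comm (Real.exp _), mul_assoc, ← Real.exp_add]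
  gcongr
  have := abs_sub_abs_le_abs_sub s t
  rw [abs_sub_comm s t] at this
  linarith

theorem integrable_abs_mul_exp (hpi : Integrable fun u => p u * Real.exp (|u| / 2)) :
    Integrable fun u => |p u| * Real.exp (|u| / 2) := by
  refine hpi.abs.congr (Filter.Eventually.of_forall fun u => ?_)
  simp [abs_mul]

theorem ae_integrable_weightedConv (hp : Continuous p)
    (hpi : Integrable fun u => p u * Real.exp (|u| / 2)) (F : LineL2) :
    ∀ᵐ t : ℝ, Integrable fun s =>
      ((Real.exp (-|t| / 2) * p (t - s) * Real.exp (|s| / 2) : ℝ) : ℂ) * F s :=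
  ae_integrable_kernel (κ := fun t s : ℝ =>
      ((Real.exp (-|t| / 2) * p (t - s) * Real.exp (|s| / 2) : ℝ) : ℂ))
    (measurable_weightedConv_kernel hp) (by fun_prop) (integrable_abs_mul_exp hpi)
    (norm_weightedConv_kernel_le p) F

theorem IsWeightedConv.ext {C D : LineL2 →L[ℂ] LineL2} (hC : IsWeightedConv p C)
    (hD : IsWeightedConv p D) : C = D :=
  ContinuousLinearMap.ext fun F => Lp.ext ((hC F).trans (hD F).symm)

theorem exists_isWeightedConv_norm_le (hp : Continuous p)
    (hpi : Integrable fun u => p u * Real.exp (|u| / 2)) :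
    ∃ C, IsWeightedConv p C ∧ ‖C‖ ≤ ∫ u, |p u| * Real.exp (|u| / 2) :=
  exists_kernelOperator (κ := fun t s : ℝ =>
      ((Real.exp (-|t| / 2) * p (t - s) * Real.exp (|s| / 2) : ℝ) : ℂ))
    (measurable_weightedConv_kernel hp) (by fun_prop) (integrable_abs_mul_exp hpi)
    (norm_weightedConv_kernel_le p)

theorem IsWeightedConv.norm_le {C : LineL2 →L[ℂ] LineL2} (hC : IsWeightedConv p C)
    (hp : Continuous p) (hpi : Integrable fun u => p u * Real.exp (|u| / 2)) :
    ‖C‖ ≤ ∫ u, |p u| * Real.exp (|u| / 2) := by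
  obtain ⟨D, hD, hle⟩ := exists_isWeightedConv_norm_le hp hpi
  rwa [hC.ext hD]

theorem IsWeightedConv.sub {C D : LineL2 →L[ℂ] LineL2} (hC : IsWeightedConv p C)
    (hD : IsWeightedConv q D) (hp : Continuous p)
    (hpi : Integrable fun u => p u * Real.exp (|u| / 2)) (hq : Continuous q)
    (hqi : Integrable fun u => q u * Real.exp (|u| / 2)) :
    IsWeightedConv (fun u => p u - q u) (C - D) := by
  intro F
  filter_upwards [hC F, hD F, Lp.coeFn_sub (C F) (D F), ae_integrable_weightedConv hp hpi F,
    ae_integrable_weightedConv hq hqi F] with t h1 h2 h3 h4 h5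
  rw [sub_apply, h3, Pi.sub_apply, h1, h2, ← integral_sub h4 h5]
  congr 1
  funext s
  push_cast
  ring

/-- Weighted translations exist and have moderate growth. -/
theorem exists_isWeightedTranslation (s : ℝ) :
    ∃ U, IsWeightedTranslation s U ∧ ‖U‖ ≤ Real.exp (|s| / 2) := by
  refine exists_weightedComp (φ := fun t => t - s)
    (w := fun t => Real.exp ((|t - s| - |t|) / 2)) (by fun_prop) (by fun_prop)
    (Real.exp_pos _).le ?_
  have h1 : (volume.withDensity fun t => ‖Real.exp ((|t - s| - |t|) / 2)‖ₑ ^ 2) ≤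
      (ENNReal.ofReal (Real.exp (|s| / 2)) ^ 2) • (volume : Measure ℝ) := by
    rw [← withDensity_const]
    refine withDensity_mono (Filter.Eventually.of_forall fun t => ?_)
    dsimp only
    rw [Real.enorm_eq_ofReal (Real.exp_pos _).le]
    gcongr
    have := abs_sub_abs_le_abs_sub (t - s) t
    rw [show t - s - t = -s by ring, abs_neg] at this
    exact this
  refine (Measure.map_mono h1 (by fun_prop)).trans ?_
  rw [Measure.map_smul, (measurePreserving_sub_right volume s).map_eq]

theorem ae_comp_sub_right {P : ℝ → Prop} (h : ∀ᵐ t : ℝ, P t) (s : ℝ) : ∀ᵐ t : ℝ, P (t - s) :=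
  (measurePreserving_sub_right volume s).quasiMeasurePreserving.ae h

theorem IsWeightedTranslation.ext {s : ℝ} {U V : LineL2 →L[ℂ] LineL2}
    (hU : IsWeightedTranslation s U) (hV : IsWeightedTranslation s V) : U = V :=
  ContinuousLinearMap.ext fun F => Lp.ext ((hU F).trans (hV F).symm)

theorem isWeightedTranslation_one : IsWeightedTranslation 0 1 := by
  intro F
  refine Filter.Eventually.of_forall fun t => ?_
  simp

theorem IsWeightedTranslation.mul {s t : ℝ} {U V : LineL2 →L[ℂ] LineL2}
    (hU : IsWeightedTranslation s U) (hV : IsWeightedTranslation t V) :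
    IsWeightedTranslation (s + t) (U * V) := by
  intro F
  filter_upwards [hU (V F), ae_comp_sub_right (hV F) s] with x h1 h2
  rw [mul_apply_eq_comp, h1, h2, ← mul_assoc, ← Complex.ofReal_mul, ← Real.exp_add,
    sub_sub]
  congr 4
  ring

theorem IsWeightedTranslation.mul_conv {s : ℝ} {U C : LineL2 →L[ℂ] LineL2}
    (hU : IsWeightedTranslation s U) (hC : IsWeightedConv p C) :
    IsWeightedConv (fun u => p (u - s)) (U * C) := by
  intro F
  filter_upwards [hU (C F), ae_comp_sub_right (hC F) s] with t h1 h2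
  rw [mul_apply_eq_comp, h1, h2, ← integral_const_mul]
  congr 1
  funext r
  rw [← mul_assoc, ← Complex.ofReal_mul, ← mul_assoc, ← mul_assoc, ← Real.exp_add]
  congr 4
  · congr 1
    ring
  · congr 1
    ring

/-- The shifted kernel is the same as in `IsWeightedTranslation.mul_conv`; as the kernel determines
the operator, translations commute with convolutions. -/
theorem IsWeightedConv.mul_translation {s : ℝ} {U C : LineL2 →L[ℂ] LineL2}
    (hC : IsWeightedConv p C) (hU : IsWeightedTranslation s U) :
    IsWeightedConv (fun u => p (u - s)) (C * U) := by
  intro F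
  filter_upwards [hC (U F)] with t h1
  rw [mul_apply_eq_comp, h1]
  rw [← integral_sub_right_eq_self (fun r =>
    ((Real.exp (-|t| / 2) * p (t - r - s) * Real.exp (|r| / 2) : ℝ) : ℂ) * F r) s]
  refine integral_congr_ae ?_
  filter_upwards [hU F] with r hr
  rw [hr, ← mul_assoc, ← Complex.ofReal_mul, mul_assoc (_ * _), ← Real.exp_add]
  congr 3
  · congr 2
    ring
  · congr 1
    ring

/-- Convolution as an average of translations, tested against square-integrable functions. -/
theorem IsWeightedConv.apply_eq_integral {C : LineL2 →L[ℂ] LineL2} (hC : IsWeightedConv p C)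
    (hp : Continuous p) (hpi : Integrable fun u => p u * Real.exp (|u| / 2))
    {U : ℝ → LineL2 →L[ℂ] LineL2} (hU : ∀ s, IsWeightedTranslation s (U s)) {h : LineL2}
    (hint : Integrable fun s => p s • U s h) :
    C h = ∫ s, p s • U s h := by
  -- The identity is checked weakly, against an arbitrary `G`, which reduces it to Fubini for the
  -- scalar function `Φ`.
  refine ext_inner_left ℂ fun G => ?_
  rw [← integral_inner hint, L2.inner_def]
  have hGm : Measurable (G : ℝ → ℂ) := (Lp.stronglyMeasurable G).measurable
  have hhm : Measurable (h : ℝ → ℂ) := (Lp.stronglyMeasurable h).measurable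
  have hG2 : Integrable fun t => ‖G t‖ ^ 2 := (Lp.memLp G).integrable_norm_pow (by norm_num)
  have hh2 : Integrable fun t => ‖h t‖ ^ 2 := (Lp.memLp h).integrable_norm_pow (by norm_num)
  have hpa := integrable_abs_mul_exp hpi
  let Φ : ℝ → ℝ → ℂ := fun t s =>
    inner ℂ (G t) ((p s : ℂ) * (((Real.exp ((|t - s| - |t|) / 2) : ℝ) : ℂ) * h (t - s)))
  have hΦ : Integrable (Function.uncurry Φ) (volume.prod volume) := by
    have h1 : Integrable (fun z : ℝ × ℝ => ‖G z.1‖ ^ 2 * (|p z.2| * Real.exp (|z.2| / 2)))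
        (volume.prod volume) := hG2.mul_prod hpa
    have h2 : Integrable (fun z : ℝ × ℝ =>
        (|p z.2| * Real.exp (|z.2| / 2)) * ‖h (z.1 - z.2)‖ ^ 2) (volume.prod volume) :=
      hpa.convolution_integrand (ContinuousLinearMap.mul ℝ ℝ) hh2
    refine (h1.add h2).mono' ?_ (Filter.Eventually.of_forall fun z => ?_)
    · apply Measurable.aestronglyMeasurable
      refine Measurable.inner (hGm.comp measurable_fst) ?_
      fun_prop
    · obtain ⟨t, s⟩ := z
      simp only [Function.uncurry_apply_pair, Φ, Pi.add_apply]
      have e1 : Real.exp ((|t - s| - |t|) / 2) ≤ Real.exp (|s| / 2) := by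
        gcongr
        have := abs_sub_abs_le_abs_sub (t - s) t
        rwa [show t - s - t = -s by ring, abs_neg] at this
      -- Separating the product into squares gives a majorant made of a tensor product and a
      -- convolution integrand, both integrable.
      have e2 : ‖G t‖ * ‖h (t - s)‖ ≤ ‖G t‖ ^ 2 + ‖h (t - s)‖ ^ 2 := by
        nlinarith [sq_nonneg (‖G t‖ - ‖h (t - s)‖), sq_nonneg ‖G t‖, sq_nonneg ‖h (t - s)‖]
      calc _ ≤ ‖G t‖ * (|p s| * (Real.exp ((|t - s| - |t|) / 2) * ‖h (t - s)‖)) := by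
            refine (norm_inner_le_norm _ _).trans (le_of_eq ?_)
            rw [norm_mul, norm_mul, Complex.norm_real, Complex.norm_real, Real.norm_eq_abs,
              Real.norm_eq_abs, Real.abs_exp]
        _ = |p s| * Real.exp ((|t - s| - |t|) / 2) * (‖G t‖ * ‖h (t - s)‖) := by ring
        _ ≤ |p s| * Real.exp (|s| / 2) * (‖G t‖ ^ 2 + ‖h (t - s)‖ ^ 2) := by gcongr
        _ = _ := by ring
  have hleft : ∀ᵐ t : ℝ, inner ℂ (G t) (C h t) = ∫ s, Φ t s := by
    filter_upwards [hC h, hΦ.prod_right_ae] with t ht hti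
    rw [ht, ← integral_sub_left_eq_self (fun s => Φ t s) volume t]
    have : ∀ s, Φ t (t - s) = inner ℂ (G t)
        (((Real.exp (-|t| / 2) * p (t - s) * Real.exp (|s| / 2) : ℝ) : ℂ) * h s) := by
      intro s
      simp only [Φ, sub_sub_cancel]
      rw [← mul_assoc, ← Complex.ofReal_mul]
      congr 3
      rw [mul_comm (Real.exp _) (p _), mul_assoc, ← Real.exp_add]
      congr 2
      ring
    simp_rw [this]
    -- For `G t ≠ 0`, integrability of the kernel times `h` is recovered from that of the slice of
    -- `Φ` by dividing by the conjugate of `G t`.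
    by_cases hG0 : G t = 0
    · simp [hG0]
    · refine (integral_inner (𝕜 := ℂ) ?_ _).symm
      have h3 : Integrable fun s => Φ t (t - s) := hti.comp_sub_left t
      simp_rw [this, RCLike.inner_apply'] at h3
      have hne : conj (G t) ≠ 0 := by simpa using hG0
      exact (integrable_const_mul_iff (IsUnit.mk0 _ hne) _).1 h3
  rw [integral_congr_ae hleft, integral_integral_swap hΦ]
  refine integral_congr_ae (Filter.Eventually.of_forall fun s => ?_)
  dsimp only
  rw [L2.inner_def]
  refine integral_congr_ae ?_
  filter_upwards [hU s h, Lp.coeFn_smul (p s) (U s h)] with t h1 h2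
  rw [h2, Pi.smul_apply, h1, Complex.real_smul]

theorem integrable_exp_neg_abs_mul {b : ℝ} (hb : 0 < b) :
    Integrable fun u : ℝ => Real.exp (-(b * |u|)) := by
  have h1 : IntegrableOn (fun u : ℝ => Real.exp (-(b * |u|))) (Set.Ioi 0) :=
    (exp_neg_integrableOn_Ioi 0 hb).congr_fun (fun u hu => by
      dsimp only
      rw [abs_of_pos hu, neg_mul]) measurableSet_Ioi
  have h2 : IntegrableOn (fun u : ℝ => Real.exp (-(b * |u|))) (Set.Iic 0) :=
    (integrableOn_exp_mul_Iic hb 0).congr_fun (fun u hu => by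
      dsimp only
      rw [abs_of_nonpos hu, mul_neg, neg_neg]) measurableSet_Iic
  rw [← integrableOn_univ, ← Set.Iic_union_Ioi (a := (0 : ℝ))]
  exact h2.union h1

theorem integrable_mul_of_le_exp_neg_abs {K : ℝ} (hp : Continuous p)
    (hK : ∀ u, |p u| ≤ K * Real.exp (-|u|)) :
    Integrable fun u => p u * Real.exp (|u| / 2) := by
  refine ((integrable_exp_neg_abs_mul (b := 1 / 2) (by norm_num)).const_mul K).mono'
    (by fun_prop) (Filter.Eventually.of_forall fun u => ?_)
  rw [norm_mul, Real.norm_eq_abs, Real.norm_eq_abs, Real.abs_exp]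
  calc _ ≤ K * Real.exp (-|u|) * Real.exp (|u| / 2) := by gcongr; exact hK u
    _ = _ := by
      rw [mul_assoc, ← Real.exp_add]
      congr 2
      ring

/-- A difference of two such products is the weighted convolution with a difference of shifted
kernels; its norm is bounded by a weighted L¹ norm, which tends to zero by dominated convergence. -/
theorem continuous_translation_mul_conv {C : LineL2 →L[ℂ] LineL2} (hC : IsWeightedConv p C)
    (hp : Continuous p) {K : ℝ} (hK : ∀ u, |p u| ≤ K * Real.exp (-|u|))
    {U : ℝ → LineL2 →L[ℂ] LineL2} (hU : ∀ s, IsWeightedTranslation s (U s)) :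
    Continuous fun s => U s * C := by
  have hK0 : 0 ≤ K := by
    have := (abs_nonneg _).trans (hK 0)
    simpa using this
  have hshift : ∀ s u, |p (u - s)| ≤ K * Real.exp |s| * Real.exp (-|u|) := by
    intro s u
    refine (hK _).trans ?_
    rw [mul_assoc, ← Real.exp_add]
    gcongr
    have := abs_sub_abs_le_abs_sub u s
    linarith
  have hint : ∀ s, Integrable fun u => p (u - s) * Real.exp (|u| / 2) := fun s =>
    integrable_mul_of_le_exp_neg_abs (by fun_prop) (hshift s)
  rw [continuous_iff_continuousAt]
  intro s₀
  rw [ContinuousAt, tendsto_iff_norm_sub_tendsto_zero]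
  have hle : ∀ s, ‖U s * C - U s₀ * C‖ ≤
      ∫ u, |p (u - s) - p (u - s₀)| * Real.exp (|u| / 2) := fun s => by
    refine (((hU s).mul_conv hC).sub ((hU s₀).mul_conv hC) (by fun_prop) (hint s) (by fun_prop)
      (hint s₀)).norm_le (by fun_prop) ?_
    refine ((hint s).sub (hint s₀)).congr (Filter.Eventually.of_forall fun u => ?_)
    simp [sub_mul]
  refine squeeze_zero (fun _ => norm_nonneg _) hle ?_
  have hlim : Filter.Tendsto
      (fun s => ∫ u, |p (u - s) - p (u - s₀)| * Real.exp (|u| / 2)) (nhds s₀)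
      (nhds (∫ u : ℝ, (0 : ℝ))) := by
    refine tendsto_integral_filter_of_dominated_convergence
      -- The majorant serves all `s` within distance 1 of `s₀`; decay `exp (-|u|)` against the
      -- weight `exp (|u| / 2)` leaves `exp (-|u| / 2)`.
      (fun u => (K * Real.exp (|s₀| + 1) + K * Real.exp (|s₀| + 1)) *
        Real.exp (-(1 / 2 * |u|))) ?_ ?_ ?_ ?_
    · exact Filter.Eventually.of_forall fun s => by fun_prop
    · filter_upwards [Metric.ball_mem_nhds s₀ one_pos] with s hs
      refine Filter.Eventually.of_forall fun u => ?_
      rw [norm_mul, Real.norm_eq_abs, abs_abs, Real.norm_eq_abs, Real.abs_exp]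
      have hs1 : |s| ≤ |s₀| + 1 := by
        rw [mem_ball, Real.dist_eq] at hs
        have := abs_sub_abs_le_abs_sub s s₀
        linarith
      have e1 : |p (u - s)| ≤ K * Real.exp (|s₀| + 1) * Real.exp (-|u|) :=
        (hshift s u).trans (by gcongr)
      have e2 : |p (u - s₀)| ≤ K * Real.exp (|s₀| + 1) * Real.exp (-|u|) :=
        (hshift s₀ u).trans (by gcongr; linarith)
      calc _ ≤ (K * Real.exp (|s₀| + 1) * Real.exp (-|u|) +
            K * Real.exp (|s₀| + 1) * Real.exp (-|u|)) * Real.exp (|u| / 2) := by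
            gcongr
            exact (abs_sub _ _).trans (add_le_add e1 e2)
        _ = (K * Real.exp (|s₀| + 1) + K * Real.exp (|s₀| + 1)) *
            (Real.exp (-|u|) * Real.exp (|u| / 2)) := by ring
        _ = _ := by
            rw [← Real.exp_add]
            congr 2
            ring
    · exact (integrable_exp_neg_abs_mul (by norm_num)).const_mul _
    · refine Filter.Eventually.of_forall fun u => ?_
      have : Continuous fun s => |p (u - s) - p (u - s₀)| * Real.exp (|u| / 2) := by fun_prop
      have := this.tendsto s₀
      simpa using this
  simpa using hlim

/-- The spectrum of a weighted convolution operator lies in the range of the Laplace transform of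
its kernel over the closed dual strip, together with zero. -/
theorem IsWeightedConv.spectrum_subset {C : LineL2 →L[ℂ] LineL2} (hC : IsWeightedConv p C)
    (hp : Continuous p) {K : ℝ} (hK : ∀ u, |p u| ≤ K * Real.exp (-|u|)) :
    spectrum ℂ C ⊆ insert 0 {w | ∃ c : ℂ, |c.re| ≤ 1 / 2 ∧
      w = ∫ s, (p s : ℂ) * Complex.exp (c * s)} := by
  have hpi := integrable_mul_of_le_exp_neg_abs hp hK
  -- The operator algebra has ‖1‖ = 1 only over a nontrivial space; in the other case the spectrum
  -- is empty.
  rcases subsingleton_or_nontrivial LineL2 with hsub | hnt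
  · rw [spectrum.of_subsingleton]
    exact Set.empty_subset _
  choose U hU hUn using exists_isWeightedTranslation
  have hcont := continuous_translation_mul_conv hC hp hK hU
  refine spectrum_subset_of_integral (U := U) (P := p)
    ((hU 0).ext isWeightedTranslation_one)
    (fun s t => (hU (s + t)).ext ((hU s).mul (hU t)))
    (fun s => ((hU s).mul_conv hC).ext (hC.mul_translation (hU s))) hUn hcont hpi
    hp.aestronglyMeasurable ?_
  have hint : Integrable fun s => p s • (U s * C) :=
    integrable_smul_mul hUn hcont hpi hp.aestronglyMeasurable
  ext1 F
  have h := (ContinuousLinearMap.apply ℂ LineL2 F).integral_comp_comm hint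
  refine Eq.trans ?_ h
  refine hC.apply_eq_integral hp hpi hU (h := C F) ?_
  exact (ContinuousLinearMap.apply ℂ LineL2 F).integrable_comp hint

end WeightedConv

/-! ### The Poisson kernel of the strip: decay, mass and complex zeros of the denominator. -/

/-- The Poisson kernel of the strip of width `π` at height `h`. -/
noncomputable def stripKernel (h t : ℝ) : ℝ :=
  Real.sin h / (2 * Real.pi * (Real.cosh t - Real.cos h))

theorem abs_cos_lt_one_of_sin_ne_zero {β : ℝ} (hβ : Real.sin β ≠ 0) : |Real.cos β| < 1 := by
  rw [← sq_lt_one_iff_abs_lt_one]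
  nlinarith [Real.sin_sq_add_cos_sq β, pow_pos (sq_pos_of_ne_zero hβ) 1]

theorem mul_cosh_le_cosh_sub_cos (β t : ℝ) :
    (1 - |Real.cos β|) * Real.cosh t ≤ Real.cosh t - Real.cos β := by
  have := Real.one_le_cosh t
  nlinarith [le_abs_self (Real.cos β), abs_nonneg (Real.cos β)]

theorem cosh_sub_cos_pos {β : ℝ} (hβ : Real.sin β ≠ 0) (t : ℝ) :
    0 < Real.cosh t - Real.cos β := by
  have := abs_cos_lt_one_of_sin_ne_zero hβ
  have := mul_cosh_le_cosh_sub_cos β t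
  have h2 : 0 < (1 - |Real.cos β|) * Real.cosh t := mul_pos (by linarith) (Real.cosh_pos t)
  linarith

theorem exp_abs_le_two_mul_cosh (t : ℝ) : Real.exp |t| ≤ 2 * Real.cosh t := by
  rw [← Real.cosh_abs, Real.cosh_eq]
  linarith [Real.exp_pos (-|t|)]

theorem cosh_le_exp_abs (t : ℝ) : Real.cosh t ≤ Real.exp |t| := by
  rw [← Real.cosh_abs, Real.cosh_eq]
  have : Real.exp (-|t|) ≤ Real.exp |t| := Real.exp_le_exp.2 (by linarith [abs_nonneg t])
  linarith

section StripKernel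

variable {h : ℝ}

theorem stripKernel_pos (hh : 0 < h) (hh' : h < Real.pi) (t : ℝ) : 0 < stripKernel h t := by
  have hs := Real.sin_pos_of_pos_of_lt_pi hh hh'
  have := cosh_sub_cos_pos hs.ne' t
  have := Real.pi_pos
  unfold stripKernel
  positivity

theorem continuous_stripKernel (hh : 0 < h) (hh' : h < Real.pi) : Continuous (stripKernel h) := by
  have hs := Real.sin_pos_of_pos_of_lt_pi hh hh'
  unfold stripKernel
  refine continuous_const.div (by fun_prop) fun t => ?_
  have := cosh_sub_cos_pos hs.ne' t
  have := Real.pi_pos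
  positivity

theorem stripKernel_neg (h t : ℝ) : stripKernel h (-t) = stripKernel h t := by
  simp [stripKernel]

/-- The decay rate 1 exceeds the growth rate 1/2 of the weighted translations; this margin makes all
transforms on the closed dual strip converge. -/
theorem abs_stripKernel_le (hh : 0 < h) (hh' : h < Real.pi) (t : ℝ) :
    |stripKernel h t| ≤ 1 / (Real.pi * (1 - |Real.cos h|)) * Real.exp (-|t|) := by
  have hs := Real.sin_pos_of_pos_of_lt_pi hh hh'
  have h1 := abs_cos_lt_one_of_sin_ne_zero hs.ne'
  have h2 := mul_cosh_le_cosh_sub_cos h t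
  have h3 := exp_abs_le_two_mul_cosh t
  have hpi := Real.pi_pos
  have h4 : 0 < 1 - |Real.cos h| := by linarith
  rw [abs_of_pos (stripKernel_pos hh hh' t), stripKernel, Real.exp_neg, ← one_div,
    div_mul_div_comm, one_mul]
  refine div_le_div₀ zero_le_one (Real.sin_le_one h) (by positivity) ?_
  calc Real.pi * (1 - |Real.cos h|) * Real.exp |t|
      ≤ Real.pi * (1 - |Real.cos h|) * (2 * Real.cosh t) := by gcongr
    _ = 2 * Real.pi * ((1 - |Real.cos h|) * Real.cosh t) := by ring
    _ ≤ _ := by gcongr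

theorem integrable_stripKernel_mul_exp (hh : 0 < h) (hh' : h < Real.pi) {c : ℂ}
    (hc : |c.re| < 1) : Integrable fun t : ℝ => (stripKernel h t : ℂ) * Complex.exp (c * t) := by
  refine ((integrable_exp_neg_abs_mul (b := 1 - |c.re|) (by linarith)).const_mul
    (1 / (Real.pi * (1 - |Real.cos h|)))).mono' ?_ (Filter.Eventually.of_forall fun t => ?_)
  · have := continuous_stripKernel hh hh'
    exact Continuous.aestronglyMeasurable (by fun_prop)
  · rw [norm_mul, Complex.norm_real, Complex.norm_exp, Real.norm_eq_abs]
    have e : (c * t).re ≤ |c.re| * |t| := by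
      rw [Complex.re_mul_ofReal, ← abs_mul]
      exact le_abs_self _
    calc _ ≤ 1 / (Real.pi * (1 - |Real.cos h|)) * Real.exp (-|t|) * Real.exp (|c.re| * |t|) := by
          exact mul_le_mul (abs_stripKernel_le hh hh' t) (Real.exp_le_exp.2 e)
            (Real.exp_pos _).le ((abs_nonneg _).trans (abs_stripKernel_le hh hh' t))
      _ = _ := by
          rw [mul_assoc, ← Real.exp_add]
          congr 2
          ring

theorem integral_stripKernel (hh : 0 < h) (hh' : h < Real.pi) :
    ∫ t, stripKernel h t = (Real.pi - h) / Real.pi := by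
  have hs := Real.sin_pos_of_pos_of_lt_pi hh hh'
  have hpi := Real.pi_pos
  have hint : Integrable fun t => stripKernel h t := by
    have := (integrable_stripKernel_mul_exp hh hh' (c := 0) (by simp)).re
    simpa using this
  -- An explicit primitive: the substitution x = exp t makes the kernel a rational function whose
  -- primitive is an arctangent.
  have hd : ∀ t, HasDerivAt
      (fun t => 1 / Real.pi * Real.arctan ((Real.exp t - Real.cos h) / Real.sin h))
      (stripKernel h t) t := by
    intro t
    have h1 := (((Real.hasDerivAt_exp t).sub_const (Real.cos h)).div_const
      (Real.sin h)).arctan.const_mul (1 / Real.pi)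
    refine h1.congr_deriv ?_
    have hp := cosh_sub_cos_pos hs.ne' t
    have h2 : Real.sin h ^ 2 + (Real.exp t - Real.cos h) ^ 2 =
        2 * Real.exp t * (Real.cosh t - Real.cos h) := by
      have e : Real.exp t * Real.exp (-t) = 1 := by rw [← Real.exp_add]; simp
      rw [Real.cosh_eq]
      linear_combination Real.sin_sq_add_cos_sq h - e
    have h3 : 1 + ((Real.exp t - Real.cos h) / Real.sin h) ^ 2 =
        2 * Real.exp t * (Real.cosh t - Real.cos h) / Real.sin h ^ 2 := by
      rw [← h2]
      field_simp
    rw [h3, stripKernel]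
    have := Real.exp_pos t
    field_simp
  have htop : Filter.Tendsto
      (fun t => 1 / Real.pi * Real.arctan ((Real.exp t - Real.cos h) / Real.sin h)) Filter.atTop
      (nhds (1 / Real.pi * (Real.pi / 2))) := by
    refine (Filter.Tendsto.comp (Real.tendsto_arctan_atTop.mono_right nhdsWithin_le_nhds)
      ?_).const_mul _
    exact (Filter.tendsto_atTop_add_const_right _ _ Real.tendsto_exp_atTop).atTop_div_const hs
  have hbot : Filter.Tendsto
      (fun t => 1 / Real.pi * Real.arctan ((Real.exp t - Real.cos h) / Real.sin h)) Filter.atBot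
      (nhds (1 / Real.pi * Real.arctan ((0 - Real.cos h) / Real.sin h))) := by
    refine ((Real.continuous_arctan.tendsto _).comp ?_).const_mul _
    exact (Real.tendsto_exp_atBot.sub_const _).div_const _
  rw [integral_of_hasDerivAt_of_tendsto hd hint hbot htop]
  have : Real.arctan ((0 - Real.cos h) / Real.sin h) = h - Real.pi / 2 := by
    rw [← Real.arctan_tan (x := h - Real.pi / 2) (by linarith) (by linarith),
      Real.tan_eq_sin_div_cos, Real.sin_sub_pi_div_two, Real.cos_sub_pi_div_two, zero_sub]
  rw [this]
  field_simp
  ring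

/-- Comparing imaginary parts forces Re w = 0 or sin (Im w) = 0. The first leaves only `h * I` by
injectivity of the cosine; the second contradicts |cos h| < 1 ≤ cosh. -/
theorem cosh_ne_cos_of_mem_strip (hh : 0 < h) (hh' : h < Real.pi) {w : ℂ} (h0 : 0 ≤ w.im)
    (h1 : w.im ≤ Real.pi) (hw : w ≠ h * I) : Complex.cosh w ≠ Real.cos h := by
  intro heq
  have hs := Real.sin_pos_of_pos_of_lt_pi hh hh'
  have hc := abs_lt.1 (abs_cos_lt_one_of_sin_ne_zero hs.ne')
  rw [← Complex.re_add_im w, Complex.cosh_add, Complex.cosh_mul_I, Complex.sinh_mul_I,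
    ← Complex.ofReal_cosh, ← Complex.ofReal_sinh, ← Complex.ofReal_cos, ← Complex.ofReal_sin] at heq
  have hre := congrArg Complex.re heq
  have him := congrArg Complex.im heq
  simp [-Complex.ofReal_cos, -Complex.ofReal_sin, -Complex.ofReal_cosh, -Complex.ofReal_sinh] at hre him
  have hone := Real.one_le_cosh w.re
  rcases him with hx | hy
  · rw [hx, Real.cosh_zero, one_mul] at hre
    have := Real.injOn_cos ⟨h0, h1⟩ ⟨hh.le, hh'.le⟩ hre
    apply hw
    apply Complex.ext <;> simp [hx, this]
  · have : Real.cos w.im = 1 ∨ Real.cos w.im = -1 := by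
      rw [← sq_eq_one_iff, Real.cos_sq', hy]
      norm_num
    rcases this with h2 | h2 <;> rw [h2] at hre <;> linarith

/-- Rests on |cosh (x + iy)|² = sinh² x + cos² y, so the denominator grows exponentially uniformly
in y. -/
theorem le_norm_cosh_sub_cos (h x y : ℝ) :
    Real.sinh x - 1 ≤ ‖Complex.cosh (x + y * I) - Real.cos h‖ := by
  have h1 : Real.sinh x ≤ ‖Complex.cosh (x + y * I)‖ := by
    rw [Complex.cosh_add, Complex.cosh_mul_I, Complex.sinh_mul_I,
    ← Complex.ofReal_cosh, ← Complex.ofReal_sinh, ← Complex.ofReal_cos, ← Complex.ofReal_sin]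
    apply Real.le_sqrt_of_sq_le
    rw [Complex.normSq_apply]
    simp [-Complex.ofReal_cos, -Complex.ofReal_sin, -Complex.ofReal_cosh, -Complex.ofReal_sinh]
    nlinarith [Real.sin_sq_add_cos_sq y, Real.cosh_sq x, sq_nonneg (Real.cos y),
      sq_nonneg (Real.sinh x)]
  have h2 : ‖((Real.cos h : ℝ) : ℂ)‖ ≤ 1 := by
    rw [Complex.norm_real]
    exact Real.abs_cos_le_one h
  have := norm_sub_norm_le (Complex.cosh (x + y * I)) (Real.cos h : ℝ)
  linarith

end StripKernel

/-! ### The Laplace transform of the strip kernel by Cauchy's theorem. -/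

section StripKernelTransform

variable {h : ℝ}

/-- The holomorphic function on the closed strip obtained from the exponential with exponent `c`
by subtracting its value at `h * I` and multiplying with the complexified Poisson kernel. -/
noncomputable def stripKernelRemainder (h : ℝ) (c w : ℂ) : ℂ :=
  dslope (fun z => Complex.exp (c * z)) (h * I) w / dslope Complex.cosh (h * I) w

theorem stripKernelRemainder_of_ne {c w : ℂ} (hw : w ≠ h * I) :
    stripKernelRemainder h c w =
      (Complex.exp (c * w) - Complex.exp (c * (h * I))) / (Complex.cosh w - Real.cos h) := by
  rw [stripKernelRemainder, dslope_of_ne _ hw, dslope_of_ne _ hw, slope_def_field, slope_def_field,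
    Complex.cosh_mul_I, Complex.ofReal_cos]
  have : w - h * I ≠ 0 := sub_ne_zero.2 hw
  exact div_div_div_cancel_right₀ this _ _

/-- The numerator and the denominator both vanish at `h * I`, where the zero of the denominator is
simple because its derivative is i sin h ≠ 0. Dividing both by `w - h * I` removes the singularity.
-/
theorem differentiableAt_stripKernelRemainder (hh : 0 < h) (hh' : h < Real.pi) (c : ℂ) {w : ℂ}
    (h0 : 0 ≤ w.im) (h1 : w.im ≤ Real.pi) :
    DifferentiableAt ℂ (stripKernelRemainder h c) w := by
  have key : ∀ f : ℂ → ℂ, Differentiable ℂ f → DifferentiableAt ℂ (dslope f (h * I)) w :=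
    fun f hf => ((Complex.differentiableOn_dslope Filter.univ_mem).2 hf.differentiableOn)
      |>.differentiableAt Filter.univ_mem
  refine (key _ (by fun_prop)).div (key _ Complex.differentiable_cosh) ?_
  by_cases hw : w = h * I
  · rw [hw, dslope_same, Complex.deriv_cosh, Complex.sinh_mul_I, ← Complex.ofReal_sin]
    have hs := Real.sin_pos_of_pos_of_lt_pi hh hh'
    simp [-Complex.ofReal_sin, hs.ne']
  · rw [dslope_of_ne _ hw, slope_def_field, Complex.cosh_mul_I, ← Complex.ofReal_cos]
    exact div_ne_zero (sub_ne_zero.2 (cosh_ne_cos_of_mem_strip hh hh' h0 h1 hw))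
      (sub_ne_zero.2 hw)

theorem exists_tendsto_zero_norm_stripKernelRemainder_le (h : ℝ) {c : ℂ} (hc : |c.re| < 1) :
    ∃ B : ℝ → ℝ, Filter.Tendsto B Filter.atTop (nhds 0) ∧ ∀ᶠ R : ℝ in Filter.atTop,
      ∀ y ∈ Set.Icc 0 Real.pi, ‖stripKernelRemainder h c (R + y * I)‖ ≤ B R ∧
        ‖stripKernelRemainder h c (-R + y * I)‖ ≤ B R := by
  set D := Real.exp (|c.im| * Real.pi) + ‖Complex.exp (c * (h * I))‖
  refine ⟨fun R => 4 * D * (Real.exp (-((1 - |c.re|) * R)) + Real.exp (-R)), ?_, ?_⟩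
  · have h1 : Filter.Tendsto (fun R : ℝ => Real.exp (-((1 - |c.re|) * R))) Filter.atTop (nhds 0) :=
      Real.tendsto_exp_neg_atTop_nhds_zero.comp
        (Filter.tendsto_id.const_mul_atTop (by linarith : 0 < 1 - |c.re|))
    simpa using (h1.add Real.tendsto_exp_neg_atTop_nhds_zero).const_mul (4 * D)
  · have hev : ∀ᶠ R : ℝ in Filter.atTop, 8 ≤ Real.exp R := Real.tendsto_exp_atTop.eventually_ge_atTop 8
    -- The bound `8 ≤ exp R` absorbs the constants in `sinh R - 1 ≥ exp R / 4`.
    filter_upwards [hev, Filter.eventually_gt_atTop 0] with R hR hR0 y hy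
    have hsinh : Real.exp R / 4 ≤ Real.sinh R - 1 := by
      rw [Real.sinh_eq]
      have : Real.exp (-R) ≤ 1 := Real.exp_le_one_iff.2 (by linarith)
      linarith
    have key : ∀ x : ℝ, |x| = R → Real.exp R / 4 ≤ ‖Complex.cosh (x + y * I) - Real.cos h‖ →
        ‖stripKernelRemainder h c (x + y * I)‖ ≤
          4 * D * (Real.exp (-((1 - |c.re|) * R)) + Real.exp (-R)) := by
      intro x hx hden
      rw [stripKernelRemainder_of_ne (by
        intro heq
        have := congrArg Complex.re heq
        simp at this
        rw [this, abs_zero] at hx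
        exact hR0.ne hx)]
      rw [norm_div]
      have hnum : ‖Complex.exp (c * (x + y * I)) - Complex.exp (c * (h * I))‖ ≤
          D * (Real.exp (|c.re| * R) + 1) := by
        refine (norm_sub_le _ _).trans ?_
        have e1 : ‖Complex.exp (c * (x + y * I))‖ ≤
            Real.exp (|c.im| * Real.pi) * Real.exp (|c.re| * R) := by
          rw [Complex.norm_exp, ← Real.exp_add]
          gcongr
          simp
          have a1 : c.re * x ≤ |c.re| * R := by
            rw [← hx, ← abs_mul]; exact le_abs_self _
          have a2 : -(c.im * y) ≤ |c.im| * Real.pi := by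
            calc -(c.im * y) ≤ |c.im * y| := neg_le_abs _
              _ = |c.im| * y := by rw [abs_mul, abs_of_nonneg hy.1]
              _ ≤ _ := by gcongr; exact hy.2
          linarith
        have e2 := Real.exp_pos (|c.im| * Real.pi)
        have e3 := norm_nonneg (Complex.exp (c * (h * I)))
        have e4 := Real.exp_pos (|c.re| * R)
        nlinarith [mul_nonneg e3 e4.le]
      have hD : 0 ≤ D := by positivity
      calc _ ≤ D * (Real.exp (|c.re| * R) + 1) / (Real.exp R / 4) := by gcongr
        _ = 4 * D * (Real.exp (|c.re| * R) * (Real.exp R)⁻¹ + (Real.exp R)⁻¹) := by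
            field_simp
        _ = _ := by
            rw [← Real.exp_neg, ← Real.exp_add]
            congr 4
            ring
    constructor
    · exact key R (abs_of_pos hR0) (hsinh.trans (le_norm_cosh_sub_cos h R y))
    · have := key (-R) (by rw [abs_neg, abs_of_pos hR0])
      push_cast at this
      refine this (hsinh.trans ?_)
      have e : Complex.cosh (-R + y * I) = Complex.cosh (R + (-y : ℝ) * I) := by
        rw [← Complex.cosh_neg]
        congr 1
        push_cast
        ring
      rw [e]
      simpa using le_norm_cosh_sub_cos h R (-y)

theorem stripKernelRemainder_bottom (hh : 0 < h) (c : ℂ) (t : ℝ) :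
    stripKernelRemainder h c (t + (0 : ℝ) * I) * (Real.sin h / (2 * Real.pi) : ℝ) =
      (stripKernel h t : ℂ) * Complex.exp (c * t) -
        Complex.exp (c * (h * I)) * (stripKernel h t : ℂ) := by
  rw [stripKernelRemainder_of_ne (by
    intro heq
    have := congrArg Complex.im heq
    simp at this
    exact hh.ne this)]
  have : stripKernel h t =
      (Real.cosh t - Real.cos h)⁻¹ * (Real.sin h / (2 * Real.pi)) := by
    rw [stripKernel]; field_simp
  rw [this]
  push_cast
  rw [zero_mul, add_zero]
  ring

/-- Moving up by π changes the sign of cosh, which replaces the kernel of height h by the one of the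
complementary height. -/
theorem stripKernelRemainder_top (hh' : h < Real.pi) (c : ℂ) (t : ℝ) :
    stripKernelRemainder h c (t + Real.pi * I) * (Real.sin h / (2 * Real.pi) : ℝ) =
      Complex.exp (c * (h * I)) * (stripKernel (Real.pi - h) t : ℂ) -
        Complex.exp (c * (Real.pi * I)) *
          ((stripKernel (Real.pi - h) t : ℂ) * Complex.exp (c * t)) := by
  rw [stripKernelRemainder_of_ne (by
    intro heq
    have := congrArg Complex.im heq
    simp at this
    exact hh'.ne this.symm)]
  have h1 : stripKernel (Real.pi - h) t =
      (Real.cosh t + Real.cos h)⁻¹ * (Real.sin h / (2 * Real.pi)) := by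
    rw [stripKernel, Real.sin_pi_sub, Real.cos_pi_sub, sub_neg_eq_add]; field_simp
  have h2 : Complex.cosh (t + Real.pi * I) - Real.cos h = -(Complex.cosh t + Real.cos h) := by
    rw [Complex.cosh_add, Complex.cosh_mul_I, Complex.sinh_mul_I]
    simp
    ring
  rw [h1, h2, mul_add, Complex.exp_add]
  push_cast
  rw [div_neg]
  ring

/-- The Poisson formula of the strip of width `π` for exponentials. -/
theorem integral_stripKernel_add (hh : 0 < h) (hh' : h < Real.pi) {c : ℂ} (hc : |c.re| < 1) :
    (∫ t : ℝ, (stripKernel h t : ℂ) * Complex.exp (c * t)) +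
      Complex.exp (c * (Real.pi * I)) *
        ∫ t : ℝ, (stripKernel (Real.pi - h) t : ℂ) * Complex.exp (c * t) =
      Complex.exp (c * (h * I)) := by
  have hpi := Real.pi_pos
  obtain ⟨B, hB, hle⟩ := exists_tendsto_zero_norm_stripKernelRemainder_le h hc
  set q : ℂ := ((Real.sin h / (2 * Real.pi) : ℝ) : ℂ) with hq
  set b : ℝ → ℂ := fun t => (stripKernel h t : ℂ) * Complex.exp (c * t) -
        Complex.exp (c * (h * I)) * (stripKernel h t : ℂ) with hb
  set d : ℝ → ℂ := fun t => Complex.exp (c * (h * I)) * (stripKernel (Real.pi - h) t : ℂ) -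
        Complex.exp (c * (Real.pi * I)) *
          ((stripKernel (Real.pi - h) t : ℂ) * Complex.exp (c * t)) with hd
  set V : ℝ → ℂ := fun R => ∫ y in (0 : ℝ)..Real.pi, stripKernelRemainder h c (R + y * I) with hV
  -- Cauchy's theorem on the rectangle [-R, R] × [0, π]. The factor `q` normalizes the kernel, and
  -- the vertical sides `V` vanish in the limit.
  have hrect : ∀ R : ℝ, (∫ t in (-R)..R, b t) - (∫ t in (-R)..R, d t) =
      -(q * (I * V R)) + q * (I * V (-R)) := by
    intro R
    have h1 := integral_boundary_rect_eq_zero_of_differentiableOn (stripKernelRemainder h c)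
      (-R : ℝ) (R + Real.pi * I) (fun w hw => by
        have him := hw.2
        simp [Set.uIcc_of_le hpi.le] at him
        exact (differentiableAt_stripKernelRemainder hh hh' c him.1 him.2).differentiableWithinAt)
    simp only [Complex.ofReal_re, Complex.ofReal_im, Complex.add_re, Complex.add_im,
      Complex.mul_re, Complex.mul_im, Complex.I_re, Complex.I_im, mul_zero, mul_one, sub_zero,
      zero_add, add_zero, smul_eq_mul] at h1
    have h2 := congrArg (fun z => z * q) h1
    simp only [zero_mul, sub_mul, add_mul, ← intervalIntegral.integral_mul_const] at h2
    have e1 := fun t => stripKernelRemainder_bottom (h := h) hh c t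
    have e2 := fun t => stripKernelRemainder_top (h := h) hh' c t
    rw [← hq] at e1 e2
    simp_rw [e1, e2] at h2
    change (∫ t in (-R)..R, b t) - (∫ t in (-R)..R, d t) + _ - _ = 0 at h2
    rw [hV]
    dsimp only
    linear_combination h2
  have hVlim : Filter.Tendsto V Filter.atTop (nhds 0) ∧
      Filter.Tendsto (fun R => V (-R)) Filter.atTop (nhds 0) := by
    have hB' : Filter.Tendsto (fun R => B R * |Real.pi - 0|) Filter.atTop (nhds 0) := by
      simpa using hB.mul_const |Real.pi - 0|
    constructor <;> refine squeeze_zero_norm' ?_ hB'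
    · filter_upwards [hle] with R hR
      refine intervalIntegral.norm_integral_le_of_norm_le_const fun y hy => ?_
      rw [Set.uIoc_of_le hpi.le] at hy
      exact (hR y ⟨hy.1.le, hy.2⟩).1
    · filter_upwards [hle] with R hR
      refine intervalIntegral.norm_integral_le_of_norm_le_const fun y hy => ?_
      rw [Set.uIoc_of_le hpi.le] at hy
      push_cast
      exact (hR y ⟨hy.1.le, hy.2⟩).2
  have hk : 0 < Real.pi - h := by linarith
  have hk' : Real.pi - h < Real.pi := by linarith
  have i1 := integrable_stripKernel_mul_exp hh hh' hc
  have i2 := integrable_stripKernel_mul_exp hk hk' hc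
  have i3 : Integrable fun t => (stripKernel h t : ℂ) := by
    simpa using integrable_stripKernel_mul_exp hh hh' (c := 0) (by simp)
  have i4 : Integrable fun t => (stripKernel (Real.pi - h) t : ℂ) := by
    simpa using integrable_stripKernel_mul_exp hk hk' (c := 0) (by simp)
  have ib : Integrable b := i1.sub (i3.const_mul _)
  have id : Integrable d := (i4.const_mul _).sub (i2.const_mul _)
  have t1 := (intervalIntegral_tendsto_integral ib Filter.tendsto_neg_atTop_atBot
    Filter.tendsto_id).sub (intervalIntegral_tendsto_integral id Filter.tendsto_neg_atTop_atBot
    Filter.tendsto_id)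
  have t2 : Filter.Tendsto (fun R => -(q * (I * V R)) + q * (I * V (-R))) Filter.atTop
      (nhds (-(q * (I * 0)) + q * (I * 0))) :=
    ((hVlim.1.const_mul I).const_mul q).neg.add ((hVlim.2.const_mul I).const_mul q)
  simp only [id_eq] at t1
  simp_rw [hrect] at t1
  have hfin := tendsto_nhds_unique t1 t2
  have j1 : ∫ t, (stripKernel h t : ℂ) = ((Real.pi - h) / Real.pi : ℝ) := by
    rw [← integral_stripKernel hh hh']
    exact integral_ofReal
  have j2 : ∫ t, (stripKernel (Real.pi - h) t : ℂ) =
      ((Real.pi - (Real.pi - h)) / Real.pi : ℝ) := by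
    rw [← integral_stripKernel hk hk']
    exact integral_ofReal
  rw [hb, hd, integral_sub i1 (i3.const_mul _), integral_sub (i4.const_mul _) (i2.const_mul _),
    integral_const_mul, integral_const_mul, integral_const_mul, j1, j2] at hfin
  have hpc : (Real.pi : ℂ) ≠ 0 := by exact_mod_cast hpi.ne'
  push_cast at hfin
  -- The masses of the two complementary kernels add up to one, so the subtracted value at `h * I`
  -- reappears with coefficient one.
  have e : ((Real.pi : ℂ) - h) / Real.pi + (Real.pi - (Real.pi - h)) / Real.pi = 1 := by
    field_simp
    ring
  linear_combination hfin + Complex.exp (c * (h * I)) * e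

theorem integral_stripKernel_neg (h : ℝ) (c : ℂ) :
    ∫ t : ℝ, (stripKernel h t : ℂ) * Complex.exp (-c * t) =
      ∫ t : ℝ, (stripKernel h t : ℂ) * Complex.exp (c * t) := by
  rw [← integral_neg_eq_self]
  simp [stripKernel_neg]

theorem sin_pi_mul_ne_zero_of_abs_re_lt_one {c : ℂ} (hc : |c.re| < 1) (hc0 : c ≠ 0) :
    Complex.sin (Real.pi * c) ≠ 0 := by
  rw [Ne, Complex.sin_eq_zero_iff]
  rintro ⟨k, hk⟩
  have hpc : (Real.pi : ℂ) ≠ 0 := by exact_mod_cast Real.pi_pos.ne'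
  rw [mul_comm] at hk
  have hk' := mul_right_cancel₀ hpc hk
  rw [hk'] at hc hc0
  simp at hc hc0
  have : |k| < 1 := by exact_mod_cast hc
  exact hc0 (Int.abs_lt_one_iff.1 this)

/-- The two-sided Laplace transform of the Poisson kernel of the strip. -/
theorem integral_stripKernel_mul_exp (hh : 0 < h) (hh' : h < Real.pi) {c : ℂ} (hc : |c.re| < 1)
    (hc0 : c ≠ 0) :
    ∫ t : ℝ, (stripKernel h t : ℂ) * Complex.exp (c * t) =
      Complex.sin ((Real.pi - h : ℝ) * c) / Complex.sin (Real.pi * c) := by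
  have h1 := integral_stripKernel_add hh hh' hc
  have h2 := integral_stripKernel_add hh hh' (c := -c) (by simpa using hc)
  rw [integral_stripKernel_neg, integral_stripKernel_neg] at h2
  rw [eq_div_iff (sin_pi_mul_ne_zero_of_abs_re_lt_one hc hc0)]
  have e1 : Complex.exp (-c * (Real.pi * I)) * Complex.exp (c * (Real.pi * I)) = 1 := by
    rw [← Complex.exp_add, neg_mul, neg_add_cancel, Complex.exp_zero]
  have e2 : Complex.exp (-((Real.pi - h : ℝ) * c) * I) =
      Complex.exp (-c * (Real.pi * I)) * Complex.exp (c * (h * I)) := by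
    rw [← Complex.exp_add]; congr 1; push_cast; ring
  have e3 : Complex.exp (((Real.pi - h : ℝ) * c) * I) =
      Complex.exp (c * (Real.pi * I)) * Complex.exp (-c * (h * I)) := by
    rw [← Complex.exp_add]; congr 1; push_cast; ring
  have e4 : Complex.exp (-(Real.pi * c) * I) = Complex.exp (-c * (Real.pi * I)) := by
    congr 1; ring
  have e5 : Complex.exp (Real.pi * c * I) = Complex.exp (c * (Real.pi * I)) := by
    congr 1; ring
  rw [Complex.sin, Complex.sin, e2, e3, e4, e5]
  -- The relations at `c` and `-c` form a linear system for the two transforms; this combination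
  -- eliminates the one of the complementary height.
  linear_combination (I / 2) * (Complex.exp (-c * (Real.pi * I)) * h1 -
    Complex.exp (c * (Real.pi * I)) * h2)

end StripKernelTransform

/-! ### Properties of the Fourier transform on the dual strip. -/

section PoissonHat

variable {h : ℝ}

theorem poissonHat_eq_integral (hh : 0 < h) (hh' : h < Real.pi) {z : ℂ} (hz : |z.im| < 1) :
    poissonHat h z = ∫ t : ℝ, (stripKernel h t : ℂ) * Complex.exp (I * z * t) := by
  rw [poissonHat]
  split_ifs with h0
  · have : ∫ t, (stripKernel h t : ℂ) = ((Real.pi - h) / Real.pi : ℝ) := by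
      rw [← integral_stripKernel hh hh']
      exact integral_ofReal
    simp [h0, this]
  · rw [integral_stripKernel_mul_exp hh hh' (by simpa using hz) (mul_ne_zero I_ne_zero h0),
      mul_comm I z, ← mul_assoc, ← mul_assoc, Complex.sin_mul_I, Complex.sin_mul_I,
      mul_div_mul_right _ _ I_ne_zero]

theorem poissonHat_conj (h : ℝ) (z : ℂ) : poissonHat h (conj z) = conj (poissonHat h z) := by
  rw [poissonHat, poissonHat]
  by_cases h0 : z = 0
  · simp [h0]
  · rw [if_neg h0, if_neg (by simpa using h0), map_div₀, ← Complex.sinh_conj,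
      ← Complex.sinh_conj]
    simp

theorem sinh_pi_mul_ne_zero {z : ℂ} (hz : |z.im| < 1) (hz0 : z ≠ 0) :
    Complex.sinh (Real.pi * z) ≠ 0 := by
  have := sin_pi_mul_ne_zero_of_abs_re_lt_one (c := z * I) (by simpa using hz)
    (mul_ne_zero hz0 I_ne_zero)
  rw [← mul_assoc, Complex.sin_mul_I] at this
  exact left_ne_zero_of_mul this

theorem continuousAt_poissonHat (h : ℝ) {z : ℂ} (hz : |z.im| < 1) (hz0 : z ≠ 0) :
    ContinuousAt (poissonHat h) z := by
  have : ContinuousAt (fun z : ℂ =>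
      Complex.sinh ((Real.pi - h : ℝ) * z) / Complex.sinh (Real.pi * z)) z :=
    ContinuousAt.div (by fun_prop) (by fun_prop) (sinh_pi_mul_ne_zero hz hz0)
  refine this.congr ?_
  filter_upwards [isOpen_ne.mem_nhds hz0] with w hw
  rw [poissonHat, if_neg hw]

/-- The dual strip is symmetric under conjugation, so the conjugate in the set can be dropped;
boundary points are limits of `r * z` as r increases to 1. -/
theorem sq_poissonHat_mem_closure (h : ℝ) {z : ℂ} (hz : |z.im| ≤ 1 / 2) :
    poissonHat h z ^ 2 ∈ closure ((fun z => conj (poissonHat h z ^ 2)) '' dualStrip) := by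
  have hsub : ∀ w : ℂ, |w.im| < 1 / 2 →
      poissonHat h w ^ 2 ∈ (fun z => conj (poissonHat h z ^ 2)) '' dualStrip := by
    intro w hw
    refine ⟨conj w, by simpa [dualStrip] using hw, ?_⟩
    simp [poissonHat_conj]
  rcases hz.lt_or_eq with hlt | heq
  · exact subset_closure (hsub z hlt)
  · have hz0 : z ≠ 0 := by
      rintro rfl
      norm_num at heq
    have hcont := ((continuousAt_poissonHat h (by rw [heq]; norm_num) hz0).pow 2)
    have h1 : Filter.Tendsto (fun r : ℝ => (r : ℂ) * z) (nhdsWithin 1 (Set.Iio 1)) (nhds z) := by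
      have : Continuous fun r : ℝ => (r : ℂ) * z := by fun_prop
      have := (this.tendsto 1).mono_left (nhdsWithin_le_nhds (s := Set.Iio 1))
      simpa using this
    refine mem_closure_of_tendsto (hcont.tendsto.comp h1) ?_
    have : Set.Ioo (0 : ℝ) 1 ∈ nhdsWithin (1 : ℝ) (Set.Iio 1) := Ioo_mem_nhdsLT one_pos
    filter_upwards [this] with r hr
    refine hsub _ ?_
    rw [Complex.im_ofReal_mul, abs_mul, heq, abs_of_pos hr.1]
    linarith [hr.2]

theorem zero_mem_closure_sq_poissonHat (hh : 0 < h) (hh' : h < Real.pi) :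
    (0 : ℂ) ∈ closure ((fun z => conj (poissonHat h z ^ 2)) '' dualStrip) := by
  have key : Filter.Tendsto (fun x : ℝ => poissonHat h x) Filter.atTop (nhds 0) := by
    have hb : Filter.Tendsto (fun x : ℝ => 2 * Real.exp (-(h * x))) Filter.atTop (nhds 0) := by
      have := (Real.tendsto_exp_neg_atTop_nhds_zero.comp
        (Filter.tendsto_id.const_mul_atTop hh)).const_mul 2
      simpa using this
    refine squeeze_zero_norm' ?_ hb
    filter_upwards [Filter.eventually_ge_atTop 1] with x hx
    have hpi := Real.pi_gt_three
    rw [poissonHat, if_neg (by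
      norm_cast
      linarith), ← Complex.ofReal_mul, ← Complex.ofReal_mul, ← Complex.ofReal_sinh,
      ← Complex.ofReal_sinh, ← Complex.ofReal_div, Complex.norm_real, Real.norm_eq_abs]
    have hx1 : 0 < (Real.pi - h) * x := mul_pos (by linarith) (by linarith)
    have hx2 : 3 ≤ Real.pi * x := by nlinarith
    have e1 : Real.exp (Real.pi * x) / 4 ≤ Real.sinh (Real.pi * x) := by
      rw [Real.sinh_eq]
      have : Real.exp (-(Real.pi * x)) ≤ 1 := Real.exp_le_one_iff.2 (by linarith)
      have : 3 + 1 ≤ Real.exp (Real.pi * x) := by linarith [Real.add_one_le_exp (Real.pi * x)]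
      linarith
    have e2 : Real.sinh ((Real.pi - h) * x) ≤ Real.exp ((Real.pi - h) * x) / 2 := by
      rw [Real.sinh_eq]
      linarith [Real.exp_pos (-((Real.pi - h) * x))]
    have e3 := Real.sinh_pos_iff.2 hx1
    rw [abs_of_nonneg (div_nonneg e3.le (by positivity [e1]))]
    calc _ ≤ (Real.exp ((Real.pi - h) * x) / 2) / (Real.exp (Real.pi * x) / 4) := by gcongr
      _ = 2 * (Real.exp ((Real.pi - h) * x) * (Real.exp (Real.pi * x))⁻¹) := by
        field_simp
        norm_num
      _ = _ := by
        rw [← Real.exp_neg, ← Real.exp_add]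
        congr 2
        ring
  have h2 := key.pow 2
  rw [zero_pow two_ne_zero] at h2
  refine isClosed_closure.mem_of_tendsto h2 (Filter.Eventually.of_forall fun x => ?_)
  exact sq_poissonHat_mem_closure h (by simp)

/-- At this boundary point the denominator is sin (π/2) = 1; its value will give the spectral
radius. -/
theorem poissonHat_half (h : ℝ) :
    poissonHat h ((1 / 2 : ℝ) * I) = (Real.sin ((Real.pi - h) / 2) : ℂ) := by
  rw [poissonHat, if_neg (by simp)]
  have e1 : ((Real.pi - h : ℝ) : ℂ) * ((1 / 2 : ℝ) * I) = (((Real.pi - h) / 2 : ℝ) : ℂ) * I := by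
    push_cast; ring
  have e2 : (Real.pi : ℂ) * ((1 / 2 : ℝ) * I) = ((Real.pi / 2 : ℝ) : ℂ) * I := by
    push_cast; ring
  rw [e1, e2, Complex.sinh_mul_I, Complex.sinh_mul_I, mul_div_mul_right _ _ I_ne_zero,
    ← Complex.ofReal_sin, ← Complex.ofReal_sin, Real.sin_pi_div_two, Complex.ofReal_one, div_one]

/-- Positivity of the kernel bounds the transform by its value at i Im z. By evenness that value is
the integral of the kernel against cosh (y t) with y = Im z, which increases with |y| up to y = 1/2.
-/
theorem norm_poissonHat_le (hh : 0 < h) (hh' : h < Real.pi) {z : ℂ} (hz : |z.im| ≤ 1 / 2) :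
    ‖poissonHat h z‖ ≤ Real.sin ((Real.pi - h) / 2) := by
  have hint : ∀ y : ℝ, |y| ≤ 1 / 2 → Integrable fun t => stripKernel h t * Real.exp (y * t) := by
    intro y hy
    have := (integrable_stripKernel_mul_exp hh hh' (c := y) (by
      rw [Complex.ofReal_re]; linarith)).re
    refine this.congr (Filter.Eventually.of_forall fun t => ?_)
    simp only [← Complex.ofReal_mul, ← Complex.ofReal_exp]
    exact Complex.ofReal_re _
  have heven : ∀ y : ℝ, ∫ t, stripKernel h t * Real.exp (-y * t) =
      ∫ t, stripKernel h t * Real.exp (y * t) := by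
    intro y
    rw [← integral_neg_eq_self]
    simp [stripKernel_neg]
  have hhalf : ∫ t, stripKernel h t * Real.exp (1 / 2 * t) = Real.sin ((Real.pi - h) / 2) := by
    -- The point -i/2 is chosen so that `I * z` is the real exponent 1/2.
    have h1 := poissonHat_eq_integral hh hh' (z := ((-(1 / 2) : ℝ) : ℂ) * I) (by
      simp [abs_of_pos]; norm_num)
    have h2 : poissonHat h (((-(1 / 2) : ℝ) : ℂ) * I) = (Real.sin ((Real.pi - h) / 2) : ℂ) := by
      have := poissonHat_conj h ((1 / 2 : ℝ) * I)
      rw [poissonHat_half, Complex.conj_ofReal, map_mul, Complex.conj_ofReal, Complex.conj_I] at this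
      rw [← this]
      congr 1
      push_cast
      ring
    rw [h2] at h1
    have h3 : ∀ t : ℝ, (stripKernel h t : ℂ) *
        Complex.exp (I * (((-(1 / 2) : ℝ) : ℂ) * I) * t) =
        ((stripKernel h t * Real.exp (1 / 2 * t) : ℝ) : ℂ) := by
      intro t
      push_cast
      congr 2
      linear_combination (-(1 / 2) * (t : ℂ)) * I_mul_I
    simp_rw [h3] at h1
    have h4 : ∫ t, ((stripKernel h t * Real.exp (1 / 2 * t) : ℝ) : ℂ) =
      ((∫ t, stripKernel h t * Real.exp (1 / 2 * t) : ℝ) : ℂ) := integral_ofReal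
    rw [h4] at h1
    exact_mod_cast h1.symm
  have hle1 : ‖poissonHat h z‖ ≤ ∫ t, stripKernel h t * Real.exp (-z.im * t) := by
    rw [poissonHat_eq_integral hh hh' (by linarith)]
    refine (norm_integral_le_integral_norm _).trans (le_of_eq ?_)
    congr 1
    funext t
    rw [norm_mul, Complex.norm_real, Complex.norm_exp, Real.norm_eq_abs,
      abs_of_pos (stripKernel_pos hh hh' t)]
    simp
  have hle2 : (∫ t, stripKernel h t * Real.exp (-z.im * t)) +
      (∫ t, stripKernel h t * Real.exp (z.im * t)) ≤
      (∫ t, stripKernel h t * Real.exp (-(1 / 2) * t)) +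
      (∫ t, stripKernel h t * Real.exp (1 / 2 * t)) := by
    have i1 := hint (-z.im) (by rwa [abs_neg])
    have i2 := hint z.im hz
    have i3 := hint (-(1 / 2)) (by norm_num [abs_of_pos])
    have i4 := hint (1 / 2) (by norm_num [abs_of_pos])
    rw [← integral_add i1 i2, ← integral_add i3 i4]
    refine integral_mono (i1.add i2) (i3.add i4) fun t => ?_
    simp only [← mul_add]
    refine mul_le_mul_of_nonneg_left ?_ (stripKernel_pos hh hh' t).le
    have hc := fun x : ℝ => Real.cosh_eq x
    have h1 : Real.cosh (z.im * t) ≤ Real.cosh (1 / 2 * t) := by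
      rw [Real.cosh_le_cosh, abs_mul, abs_mul, abs_of_pos (one_half_pos (α := ℝ))]
      gcongr
    rw [hc, hc] at h1
    simp only [neg_mul]
    linarith
  rw [heven, heven, hhalf] at hle2
  rw [heven] at hle1
  linarith

end PoissonHat

/-! ### Exponentials as eigenvectors and the spectrum of the squared convolution. -/

section Exponentials

/-- The function `exp (c * t)`, conjugated by the weight `exp (-|t| / 2)`. -/
noncomputable def weightedExp (c : ℂ) (t : ℝ) : ℂ :=
  (Real.exp (-|t| / 2) : ℂ) * Complex.exp (c * t)

theorem continuous_weightedExp (c : ℂ) : Continuous (weightedExp c) := by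
  unfold weightedExp
  fun_prop

theorem memLp_weightedExp {c : ℂ} (hc : |c.re| < 1 / 2) : MemLp (weightedExp c) 2 volume := by
  rw [memLp_two_iff_integrable_sq_norm (continuous_weightedExp c).aestronglyMeasurable]
  have := continuous_weightedExp c
  refine (integrable_exp_neg_abs_mul (b := 1 - 2 * |c.re|) (by linarith)).mono'
    (by fun_prop) (Filter.Eventually.of_forall fun t => ?_)
  rw [weightedExp, norm_mul, Complex.norm_real, Complex.norm_exp, Real.norm_of_nonneg (by positivity),
    Real.norm_of_nonneg (Real.exp_pos _).le, ← Real.exp_add, ← Real.exp_nat_mul]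
  gcongr
  have : c.re * t ≤ |c.re| * |t| := by
    rw [← abs_mul]
    exact le_abs_self _
  rw [Complex.re_mul_ofReal]
  push_cast
  linarith

theorem toLp_weightedExp_ne_zero {c : ℂ} (hc : |c.re| < 1 / 2) :
    (memLp_weightedExp hc).toLp (weightedExp c) ≠ 0 := by
  intro h0
  have h1 := (memLp_weightedExp hc).coeFn_toLp
  rw [h0] at h1
  have := (continuous_weightedExp c).ae_eq_iff_eq volume continuous_zero |>.1
    (h1.symm.trans (Lp.coeFn_zero ℂ 2 volume))
  have := congrFun this 0
  simp [weightedExp] at this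

/-- Weighted exponentials are eigenvectors of the convolution with the Poisson kernel. -/
theorem IsWeightedConv.apply_weightedExp {h : ℝ} (hh : 0 < h) (hh' : h < Real.pi)
    {C : LineL2 →L[ℂ] LineL2} (hC : IsWeightedConv (stripKernel h) C) {z : ℂ}
    (hc : |(I * z).re| < 1 / 2) :
    C ((memLp_weightedExp hc).toLp _) = poissonHat h z • (memLp_weightedExp hc).toLp _ := by
  apply Lp.ext
  filter_upwards [hC ((memLp_weightedExp hc).toLp _), Lp.coeFn_smul (poissonHat h z)
    ((memLp_weightedExp hc).toLp _), (memLp_weightedExp hc).coeFn_toLp] with t h1 h2 h3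
  rw [h1, h2, Pi.smul_apply, h3, smul_eq_mul]
  have e1 : ∫ s, ((Real.exp (-|t| / 2) * stripKernel h (t - s) * Real.exp (|s| / 2) : ℝ) : ℂ) *
      (memLp_weightedExp hc).toLp (weightedExp (I * z)) s =
      ∫ s, (Real.exp (-|t| / 2) : ℂ) *
        ((stripKernel h (t - s) : ℂ) * Complex.exp (I * z * s)) := by
    refine integral_congr_ae ?_
    filter_upwards [(memLp_weightedExp hc).coeFn_toLp] with s hs
    rw [hs, weightedExp]
    have : (Real.exp (|s| / 2) : ℂ) * (Real.exp (-|s| / 2) : ℂ) = 1 := by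
      rw [← Complex.ofReal_mul, ← Real.exp_add, neg_div, add_neg_cancel, Real.exp_zero,
        Complex.ofReal_one]
    rw [Complex.ofReal_mul, Complex.ofReal_mul]
    linear_combination ((Real.exp (-|t| / 2) : ℂ) * (stripKernel h (t - s) : ℂ) *
      Complex.exp (I * z * s)) * this
  rw [e1, integral_const_mul, ← integral_sub_left_eq_self _ volume t]
  simp only [sub_sub_cancel]
  have hz1 : |z.im| < 1 := by
    simp at hc
    norm_num at hc ⊢
    linarith
  have e2 : ∀ u : ℝ, (stripKernel h u : ℂ) * Complex.exp (I * z * (t - u : ℝ)) =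
      Complex.exp (I * z * t) * ((stripKernel h u : ℂ) * Complex.exp (-(I * z) * u)) := by
    intro u
    rw [mul_left_comm, ← Complex.exp_add]
    congr 2
    push_cast
    ring
  simp_rw [e2]
  -- The substitution reversed the sign of the exponent; evenness of the kernel restores it.
  rw [integral_const_mul, integral_stripKernel_neg, ← poissonHat_eq_integral hh hh' hz1,
    weightedExp]
  ring

/-- The spectrum of the square of the convolution with the Poisson kernel. -/
theorem IsWeightedConv.spectrum_sq_subset {h : ℝ} (hh : 0 < h) (hh' : h < Real.pi)
    {C : LineL2 →L[ℂ] LineL2} (hC : IsWeightedConv (stripKernel h) C) :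
    spectrum ℂ (C ^ 2) ⊆ closure ((fun z => conj (poissonHat h z ^ 2)) '' dualStrip) := by
  -- Spectral mapping: it suffices to locate the spectrum of `C` itself, whose nonzero points are
  -- values of the transform at z = -i c.
  rw [spectrum.map_pow_of_pos C two_pos]
  rintro _ ⟨w, hw, rfl⟩
  rcases hC.spectrum_subset (continuous_stripKernel hh hh') (abs_stripKernel_le hh hh') hw with
    rfl | ⟨c, hc, rfl⟩
  · simpa using zero_mem_closure_sq_poissonHat hh hh'
  · have him : |(-I * c).im| ≤ 1 / 2 := by simpa using hc
    have := poissonHat_eq_integral hh hh' (z := -I * c) (by linarith)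
    have e : I * (-I * c) = c := by linear_combination (-c) * I_mul_I
    rw [e] at this
    dsimp only
    rw [← this]
    exact sq_poissonHat_mem_closure h him

end Exponentials

/-! ### Length of curves in Hausdorff measure. -/

/-- The length of the image of a curve with almost constant speed on short intervals. -/
theorem hausdorffMeasure_image_eq_lintegral {c : ℝ → ℂ} {ρ : ℝ → ℝ} {L : ℝ} (hL : 0 ≤ L)
    (hρ : ∀ t, 0 < ρ t) (hρm : Measurable ρ)
    (hup : ∀ t s, ‖c t - c s‖ ≤ Real.exp (L * |t - s|) * ρ t * |t - s|)
    (hlow : ∀ t s, ρ t * |t - s| ≤ Real.exp (L * |t - s|) * ‖c t - c s‖)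
    (hosc : ∀ t s, ρ s ≤ Real.exp (L * |t - s|) * ρ t) (hcm : MeasurableEmbedding c)
    {S : Set ℝ} (hS : MeasurableSet S) :
    Measure.hausdorffMeasure 1 (c '' S) = ∫⁻ t in S, ENNReal.ofReal (ρ t) := by
  set κ : Measure ℝ := (Measure.hausdorffMeasure 1).comap c with hκ
  set ν : Measure ℝ := volume.withDensity fun t => ENNReal.ofReal (ρ t) with hν
  have hκS : ∀ S, κ S = Measure.hausdorffMeasure 1 (c '' S) := fun S =>
    hcm.comap_apply _ _
  have hνS : ∀ {S}, MeasurableSet S → ν S = ∫⁻ t in S, ENNReal.ofReal (ρ t) := fun hS =>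
    withDensity_apply _ hS
  rw [← hκS, ← hνS hS]
  have hinj := hcm.injective
  -- On an interval of length `δ` the curve is bi-Lipschitz with constants close to those of scaling
  -- by `ρ a`. With E = exp (L δ), the three factors of E come from the chord bound, from replacing
  -- `ρ t` by `ρ a`, and from replacing the integral of `ρ` by `ρ a` times the length.
  have hloc : ∀ δ : ℝ, 0 < δ → ∀ a : ℝ, ∀ S ⊆ Set.Ico a (a + δ), MeasurableSet S →
      κ S ≤ ENNReal.ofReal (Real.exp (3 * L * δ)) * ν S ∧
      ν S ≤ ENNReal.ofReal (Real.exp (3 * L * δ)) * κ S := by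
    intro δ hδ a S hSa hSm
    have hd : ∀ t ∈ S, ∀ s ∈ S, |t - s| ≤ δ := by
      intro t ht s hs
      have h1 := hSa ht
      have h2 := hSa hs
      rw [abs_le]
      constructor <;> linarith [h1.1, h1.2, h2.1, h2.2]
    have hda : ∀ t ∈ S, |t - a| ≤ δ ∧ |a - t| ≤ δ := by
      intro t ht
      have h1 := hSa ht
      rw [abs_sub_comm a t, abs_le]
      refine ⟨?_, ?_⟩ <;> constructor <;> linarith [h1.1, h1.2]
    have hmono : ∀ x, x ≤ δ → Real.exp (L * x) ≤ Real.exp (L * δ) := fun x hx => by gcongr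
    have hE := Real.exp_pos (L * δ)
    set E := Real.exp (L * δ) with hEdef
    have hE3 : Real.exp (3 * L * δ) = E * E * E := by
      rw [hEdef, ← Real.exp_add, ← Real.exp_add]; congr 1; ring
    have ha := hρ a
    have hu1 : ∀ t ∈ S, ρ t ≤ E * ρ a := fun t ht =>
      (hosc a t).trans (by gcongr; exact hmono _ (hda t ht).2)
    have hu2 : ∀ t ∈ S, ρ a ≤ E * ρ t := fun t ht =>
      (hosc t a).trans (mul_le_mul_of_nonneg_right (hmono _ (hda t ht).1) (hρ t).le)
    have hvol : ENNReal.ofReal (ρ a) * volume S ≤ ENNReal.ofReal E * ν S := by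
      rw [hνS hSm, ← lintegral_const_mul _ (by fun_prop), ← setLIntegral_const]
      refine setLIntegral_mono (by fun_prop) fun t ht => ?_
      rw [← ENNReal.ofReal_mul hE.le]
      exact ENNReal.ofReal_le_ofReal (hu2 t ht)
    have hvol2 : ν S ≤ ENNReal.ofReal (E * ρ a) * volume S := by
      rw [hνS hSm, ← setLIntegral_const]
      exact setLIntegral_mono (by fun_prop) fun t ht => ENNReal.ofReal_le_ofReal (hu1 t ht)
    have hlip : LipschitzOnWith (E * E * ρ a).toNNReal c S := by
      apply LipschitzOnWith.of_dist_le_mul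
      intro t ht s hs
      rw [Real.coe_toNNReal _ (by positivity), dist_eq_norm, Real.dist_eq]
      refine (hup t s).trans ?_
      have h1 : Real.exp (L * |t - s|) * ρ t ≤ E * (E * ρ a) :=
        mul_le_mul (hmono _ (hd t ht s hs)) (hu1 t ht) (hρ t).le hE.le
      have := mul_le_mul_of_nonneg_right h1 (abs_nonneg (t - s))
      linarith
    have hlip2 : LipschitzOnWith (E * E / ρ a).toNNReal (Function.invFun c) (c '' S) := by
      apply LipschitzOnWith.of_dist_le_mul
      rintro _ ⟨t, ht, rfl⟩ _ ⟨s, hs, rfl⟩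
      have hli := Function.leftInverse_invFun hinj
      rw [hli, hli, Real.coe_toNNReal _ (by positivity), dist_eq_norm (c t), Real.dist_eq,
        div_mul_eq_mul_div, le_div_iff₀ ha]
      have h1 : ρ t * |t - s| ≤ E * ‖c t - c s‖ :=
        (hlow t s).trans (mul_le_mul_of_nonneg_right (hmono _ (hd t ht s hs)) (norm_nonneg _))
      have h2 := mul_le_mul_of_nonneg_right (hu2 t ht) (abs_nonneg (t - s))
      have h3 := mul_le_mul_of_nonneg_left h1 hE.le
      linarith
    rw [hE3]
    constructor
    · have h1 := hlip.hausdorffMeasure_image_le (d := 1) zero_le_one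
      rw [ENNReal.rpow_one, hausdorffMeasure_real] at h1
      rw [hκS]
      refine h1.trans ?_
      change ENNReal.ofReal (E * E * ρ a) * _ ≤ _
      rw [ENNReal.ofReal_mul (p := E * E) (by positivity),
        ENNReal.ofReal_mul (p := E * E) (by positivity), mul_assoc, mul_assoc]
      exact mul_le_mul_right hvol _
    · have h1 := hlip2.hausdorffMeasure_image_le (d := 1) zero_le_one
      rw [ENNReal.rpow_one, hausdorffMeasure_real, ← Set.image_comp,
        Function.invFun_comp hinj, Set.image_id, ← hκS] at h1
      refine hvol2.trans ((mul_le_mul_right h1 _).trans (le_of_eq ?_))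
      change ENNReal.ofReal (E * ρ a) * (ENNReal.ofReal (E * E / ρ a) * κ S) = _
      rw [← mul_assoc, ← ENNReal.ofReal_mul (by positivity)]
      congr 2
      field_simp
  -- The local estimate is summed over a partition of the line into intervals of length `δ`; the
  -- constant tends to 1 as `δ` tends to 0.
  have hglob : ∀ δ : ℝ, 0 < δ → κ S ≤ ENNReal.ofReal (Real.exp (3 * L * δ)) * ν S ∧
      ν S ≤ ENNReal.ofReal (Real.exp (3 * L * δ)) * κ S := by
    intro δ hδ
    have hdisj : Pairwise (Function.onFun Disjoint fun n : ℤ =>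
        S ∩ Set.Ico (n • δ) ((n + 1) • δ)) := fun i j hij =>
      (Set.pairwise_disjoint_Ico_zsmul δ hij).mono Set.inter_subset_right Set.inter_subset_right
    have hU : S = ⋃ n : ℤ, S ∩ Set.Ico (n • δ) ((n + 1) • δ) := by
      rw [← Set.inter_iUnion, iUnion_Ico_zsmul hδ, Set.inter_univ]
    have hm : ∀ n : ℤ, MeasurableSet (S ∩ Set.Ico (n • δ) ((n + 1) • δ)) := fun n =>
      hS.inter measurableSet_Ico
    have hsub : ∀ n : ℤ, S ∩ Set.Ico (n • δ) ((n + 1) • δ) ⊆ Set.Ico (n • δ) (n • δ + δ) := by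
      intro n
      rw [add_smul, one_smul]
      exact Set.inter_subset_right
    rw [hU, measure_iUnion hdisj hm, measure_iUnion hdisj hm, ← ENNReal.tsum_mul_left,
      ← ENNReal.tsum_mul_left]
    exact ⟨ENNReal.tsum_le_tsum fun n => (hloc δ hδ _ _ (hsub n) (hm n)).1,
      ENNReal.tsum_le_tsum fun n => (hloc δ hδ _ _ (hsub n) (hm n)).2⟩
  have hlim : ∀ x : ENNReal, Filter.Tendsto
      (fun δ : ℝ => ENNReal.ofReal (Real.exp (3 * L * δ)) * x) (nhdsWithin 0 (Set.Ioi 0))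
      (nhds x) := by
    intro x
    have h1 : Continuous fun δ : ℝ => Real.exp (3 * L * δ) := by fun_prop
    have h2 := (ENNReal.tendsto_ofReal (h1.tendsto 0)).mono_left
      (nhdsWithin_le_nhds (s := Set.Ioi (0 : ℝ)))
    simp only [mul_zero, Real.exp_zero, ENNReal.ofReal_one] at h2
    simpa using ENNReal.Tendsto.mul_const (b := x) h2 (Or.inl one_ne_zero)
  apply le_antisymm
  · exact ge_of_tendsto (hlim _) (by
      filter_upwards [self_mem_nhdsWithin] with δ hδ using (hglob δ hδ).1)
  · exact ge_of_tendsto (hlim _) (by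
      filter_upwards [self_mem_nhdsWithin] with δ hδ using (hglob δ hδ).2)

/-! ### Bipolar coordinates: distances, speed and length of the arcs. -/

/-- The circular arc between `m - u * I` and `m + u * I` with angle `β`, parametrized by the
logarithm of the ratio of the distances to its end points. -/
noncomputable def bipolarArc (m u : ℂ) (β t : ℝ) : ℂ :=
  m + u * ((Real.sin β + Real.sinh t * I) / ((Real.cosh t - Real.cos β : ℝ) : ℂ))

/-- The speed of `bipolarArc`. -/
noncomputable def bipolarSpeed (u : ℂ) (β t : ℝ) : ℝ := ‖u‖ / (Real.cosh t - Real.cos β)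

/-- The logarithm of the ratio of the distances to `m - u * I` and to `m + u * I`. -/
noncomputable def bipolarCoord (m u p : ℂ) : ℝ :=
  Real.log (‖p - (m - u * I)‖ / ‖p - (m + u * I)‖)

section Bipolar

variable {m u : ℂ} {β β' : ℝ}

theorem bipolarArc_eq (m u : ℂ) (β t : ℝ) :
    bipolarArc m u β t = m + u * (((Real.sin β / (Real.cosh t - Real.cos β) : ℝ) : ℂ) +
      ((Real.sinh t / (Real.cosh t - Real.cos β) : ℝ) : ℂ) * I) := by
  rw [bipolarArc]
  push_cast
  ring

/-- This is the source of translation invariance: apart from one factor for each point, the squared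
distance depends only on t - s and β - β'. -/
theorem norm_bipolarArc_sub_sq (hβ : Real.sin β ≠ 0) (hβ' : Real.sin β' ≠ 0) (t s : ℝ) :
    ‖bipolarArc m u β t - bipolarArc m u β' s‖ ^ 2 =
      ‖u‖ ^ 2 * (2 * (Real.cosh (t - s) - Real.cos (β - β'))) /
        ((Real.cosh t - Real.cos β) * (Real.cosh s - Real.cos β')) := by
  have h1 := cosh_sub_cos_pos hβ t
  have h2 := cosh_sub_cos_pos hβ' s
  rw [bipolarArc_eq, bipolarArc_eq, add_sub_add_left_eq_sub, ← mul_sub, norm_mul, mul_pow,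
    ← Complex.normSq_eq_norm_sq, ← Complex.normSq_eq_norm_sq, mul_div_assoc]
  congr 1
  rw [Complex.normSq_apply]
  simp only [Complex.sub_re, Complex.add_re, Complex.ofReal_re, Complex.mul_re, Complex.ofReal_im,
    Complex.I_re, Complex.I_im, Complex.sub_im, Complex.add_im, Complex.mul_im]
  rw [Real.cosh_sub, Real.cos_sub]
  have e1 := Real.sin_sq_add_cos_sq β
  have e2 := Real.sin_sq_add_cos_sq β'
  have e3 := Real.cosh_sq t
  have e4 := Real.cosh_sq s
  generalize Real.cosh t = Ct at *
  generalize Real.cosh s = Cs at *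
  generalize Real.sinh t = St at *
  generalize Real.sinh s = Ss at *
  generalize Real.cos β = a at *
  generalize Real.cos β' = b at *
  generalize Real.sin β = x at *
  generalize Real.sin β' = y at *
  field_simp
  linear_combination (Cs - b) ^ 2 * (e1 - e3) + (Ct - a) ^ 2 * (e2 - e4)

theorem bipolarSpeed_pos (hu : u ≠ 0) (hβ : Real.sin β ≠ 0) (t : ℝ) : 0 < bipolarSpeed u β t :=
  div_pos (norm_pos_iff.2 hu) (cosh_sub_cos_pos hβ t)

theorem continuous_bipolarSpeed (u : ℂ) (hβ : Real.sin β ≠ 0) : Continuous (bipolarSpeed u β) := by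
  unfold bipolarSpeed
  exact continuous_const.div (by fun_prop) fun t => (cosh_sub_cos_pos hβ t).ne'

theorem continuous_bipolarArc (m u : ℂ) (hβ : Real.sin β ≠ 0) : Continuous (bipolarArc m u β) := by
  unfold bipolarArc
  refine continuous_const.add (continuous_const.mul (Continuous.div (by fun_prop) (by fun_prop) ?_))
  intro t
  exact_mod_cast (cosh_sub_cos_pos hβ t).ne'

theorem cosh_le_exp_abs_sub_mul_cosh (t s : ℝ) :
    Real.cosh t ≤ Real.exp |t - s| * Real.cosh s := by
  have h1 : Real.cosh t = Real.cosh (t - s) * Real.cosh s + Real.sinh (t - s) * Real.sinh s := by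
    rw [← Real.cosh_add]; congr 1; ring
  have h2 : Real.sinh (t - s) * Real.sinh s ≤ Real.sinh |t - s| * Real.cosh s := by
    calc _ ≤ |Real.sinh (t - s) * Real.sinh s| := le_abs_self _
      _ = Real.sinh |t - s| * |Real.sinh s| := by rw [abs_mul, Real.abs_sinh]
      _ ≤ _ := by
        have : 0 ≤ Real.sinh |t - s| := Real.sinh_nonneg_iff.2 (abs_nonneg _)
        gcongr
        rw [Real.abs_sinh, ← Real.cosh_abs s]
        exact (Real.sinh_lt_cosh _).le
  rw [h1, ← Real.cosh_add_sinh, Real.cosh_abs]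
  linarith

/-- The speed of `bipolarArc` varies at most exponentially. -/
theorem bipolarSpeed_le (u : ℂ) (hβ : Real.sin β ≠ 0) (t s : ℝ) :
    bipolarSpeed u β s ≤
      Real.exp ((1 + 1 / (1 - |Real.cos β|)) * |t - s|) * bipolarSpeed u β t := by
  have ht := cosh_sub_cos_pos hβ t
  have hs := cosh_sub_cos_pos hβ s
  have hk : 0 < 1 - |Real.cos β| := by linarith [abs_cos_lt_one_of_sin_ne_zero hβ]
  set K := 1 / (1 - |Real.cos β|) with hK
  have hK0 : 0 < K := by positivity
  set d := |t - s| with hd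
  have hd0 : 0 ≤ d := abs_nonneg _
  have h1 := cosh_le_exp_abs_sub_mul_cosh t s
  have h2 : Real.cos β ≤ K * (Real.cosh s - Real.cos β) := by
    rw [hK, one_div, ← div_eq_inv_mul, le_div_iff₀ hk]
    have := mul_cosh_le_cosh_sub_cos β s
    have := Real.one_le_cosh s
    nlinarith [Real.cos_le_one β]
  have he1 : 1 ≤ Real.exp d := Real.one_le_exp hd0
  have he2 : Real.exp d - 1 ≤ d * Real.exp d := by
    have h3 := Real.add_one_le_exp (-d)
    have h4 : Real.exp d * Real.exp (-d) = 1 := by rw [← Real.exp_add]; simp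
    nlinarith
  have he3 : 1 + K * d ≤ Real.exp (K * d) := by linarith [Real.add_one_le_exp (K * d)]
  -- With c = cos β, write `exp d * cosh s - c` as `exp d * (cosh s - c) + (exp d - 1) * c` and
  -- absorb the last c by `h2`.
  have key : Real.cosh t - Real.cos β ≤
      Real.exp ((1 + K) * d) * (Real.cosh s - Real.cos β) := by
    have e : Real.exp ((1 + K) * d) = Real.exp d * Real.exp (K * d) := by
      rw [← Real.exp_add]; congr 1; ring
    have h5 : Real.exp d + (Real.exp d - 1) * K ≤ Real.exp ((1 + K) * d) := by
      rw [e]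
      nlinarith
    have h6 := mul_le_mul_of_nonneg_left h2 (sub_nonneg.2 he1)
    nlinarith
  rw [bipolarSpeed, bipolarSpeed, ← mul_div_assoc, div_le_div_iff₀ hs ht]
  nlinarith [norm_nonneg u]

/-- For a single arc, cosh d - 1 = 2 sinh² (d/2) turns the chord into the geometric mean of the two
speeds times 2 sinh (d/2); injectivity and both chord bounds follow from it. -/
theorem norm_bipolarArc_sub_sq_eq_speed (hβ : Real.sin β ≠ 0) (t s : ℝ) :
    ‖bipolarArc m u β t - bipolarArc m u β s‖ ^ 2 =
      (2 * Real.sinh (|t - s| / 2)) ^ 2 * (bipolarSpeed u β t * bipolarSpeed u β s) := by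
  have ht := cosh_sub_cos_pos hβ t
  have hs := cosh_sub_cos_pos hβ s
  rw [norm_bipolarArc_sub_sq hβ hβ, sub_self, Real.cos_zero, bipolarSpeed, bipolarSpeed,
    ← Real.cosh_abs (t - s)]
  have : Real.cosh |t - s| = 2 * Real.sinh (|t - s| / 2) ^ 2 + 1 := by
    have h1 := Real.cosh_two_mul (|t - s| / 2)
    rw [Real.cosh_sq, mul_div_cancel₀ _ two_ne_zero] at h1
    linarith
  rw [this]
  field_simp
  ring

theorem injective_bipolarArc (hu : u ≠ 0) (hβ : Real.sin β ≠ 0) :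
    Function.Injective (bipolarArc m u β) := by
  intro t s hts
  have h := norm_bipolarArc_sub_sq_eq_speed (m := m) (u := u) hβ t s
  rw [hts, sub_self, norm_zero, zero_pow two_ne_zero] at h
  have hp := mul_pos (bipolarSpeed_pos hu hβ t) (bipolarSpeed_pos hu hβ s)
  have h1 := (mul_eq_zero.1 h.symm).resolve_right hp.ne'
  have h2 : Real.sinh (|t - s| / 2) = 0 := by
    have := pow_eq_zero_iff (two_ne_zero) |>.1 h1
    linarith
  rw [Real.sinh_eq_zero] at h2
  have : |t - s| = 0 := by linarith
  exact sub_eq_zero.1 (abs_eq_zero.1 this)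

theorem measurableEmbedding_bipolarArc (hu : u ≠ 0) (hβ : Real.sin β ≠ 0) :
    MeasurableEmbedding (bipolarArc m u β) :=
  (continuous_bipolarArc m u hβ).measurableEmbedding (injective_bipolarArc hu hβ)

theorem hausdorffMeasure_image_bipolarArc (hu : u ≠ 0) (hβ : Real.sin β ≠ 0) {S : Set ℝ}
    (hS : MeasurableSet S) :
    Measure.hausdorffMeasure 1 (bipolarArc m u β '' S) =
      ∫⁻ t in S, ENNReal.ofReal (bipolarSpeed u β t) := by
  have hk : 0 < 1 - |Real.cos β| := by linarith [abs_cos_lt_one_of_sin_ne_zero hβ]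
  set L := 1 + 1 / (1 - |Real.cos β|) with hL
  have hL1 : 1 ≤ L := by rw [hL]; linarith [div_pos one_pos hk]
  have hL0 : 0 ≤ L := by linarith
  refine hausdorffMeasure_image_eq_lintegral (L := L) hL0
    (bipolarSpeed_pos hu hβ) (continuous_bipolarSpeed u hβ).measurable ?_ ?_
    (bipolarSpeed_le u hβ) (measurableEmbedding_bipolarArc hu hβ) hS
  · intro t s
    have hd0 := abs_nonneg (t - s)
    have hsp := bipolarSpeed_pos hu hβ t
    refine abs_le_of_sq_le_sq' ?_ (by positivity) |>.2
    rw [norm_bipolarArc_sub_sq_eq_speed hβ]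
    have h1 : 2 * Real.sinh (|t - s| / 2) ≤ |t - s| * Real.exp (|t - s| / 2) := by
      rw [Real.sinh_eq]
      have h3 := Real.add_one_le_exp (-|t - s|)
      have h4 : Real.exp (|t - s| / 2) * Real.exp (-|t - s|) = Real.exp (-(|t - s| / 2)) := by
        rw [← Real.exp_add]; congr 1; ring
      nlinarith [Real.exp_pos (|t - s| / 2)]
    have h0 : 0 ≤ 2 * Real.sinh (|t - s| / 2) :=
      mul_nonneg zero_le_two (Real.sinh_nonneg_iff.2 (by positivity))
    calc (2 * Real.sinh (|t - s| / 2)) ^ 2 * (bipolarSpeed u β t * bipolarSpeed u β s)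
        ≤ (|t - s| * Real.exp (|t - s| / 2)) ^ 2 *
          (bipolarSpeed u β t * (Real.exp (L * |t - s|) * bipolarSpeed u β t)) := by
          have := bipolarSpeed_pos hu hβ s
          gcongr
          exact bipolarSpeed_le u hβ t s
      _ = Real.exp (|t - s| / 2 + |t - s| / 2) * Real.exp (L * |t - s|) *
          (bipolarSpeed u β t * |t - s|) ^ 2 := by rw [Real.exp_add]; ring
      _ ≤ Real.exp (L * |t - s|) * Real.exp (L * |t - s|) *
          (bipolarSpeed u β t * |t - s|) ^ 2 := by
          gcongr
          nlinarith
      _ = _ := by ring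
  · intro t s
    have hd0 := abs_nonneg (t - s)
    have hsp := bipolarSpeed_pos hu hβ t
    refine abs_le_of_sq_le_sq' ?_ (by positivity) |>.2
    rw [mul_pow, mul_pow _ ‖_‖, norm_bipolarArc_sub_sq_eq_speed hβ]
    have h1 : |t - s| ≤ 2 * Real.sinh (|t - s| / 2) := by
      have := Real.self_le_sinh_iff.2 (by positivity : 0 ≤ |t - s| / 2)
      linarith
    have h2 := bipolarSpeed_le u hβ s t
    rw [abs_sub_comm s t] at h2
    calc bipolarSpeed u β t ^ 2 * |t - s| ^ 2
        = |t - s| ^ 2 * (bipolarSpeed u β t * bipolarSpeed u β t) := by ring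
      _ ≤ (2 * Real.sinh (|t - s| / 2)) ^ 2 *
          (bipolarSpeed u β t * (Real.exp (L * |t - s|) * bipolarSpeed u β s)) := by gcongr
      _ = Real.exp (L * |t - s|) * ((2 * Real.sinh (|t - s| / 2)) ^ 2 *
          (bipolarSpeed u β t * bipolarSpeed u β s)) := by ring
      _ ≤ Real.exp (L * |t - s|) ^ 2 * ((2 * Real.sinh (|t - s| / 2)) ^ 2 *
          (bipolarSpeed u β t * bipolarSpeed u β s)) := by
          have : 1 ≤ Real.exp (L * |t - s|) := Real.one_le_exp (by positivity)
          have := bipolarSpeed_pos hu hβ s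
          gcongr
          nlinarith

theorem map_bipolarArc_eq (hu : u ≠ 0) (hβ : Real.sin β ≠ 0) :
    (volume.withDensity fun t => ENNReal.ofReal (bipolarSpeed u β t)).map (bipolarArc m u β) =
      (Measure.hausdorffMeasure 1).restrict (Set.range (bipolarArc m u β)) := by
  have hemb := measurableEmbedding_bipolarArc (m := m) hu hβ
  ext S hS
  rw [hemb.map_apply, withDensity_apply _ (hemb.measurable hS),
    ← hausdorffMeasure_image_bipolarArc (m := m) hu hβ (hemb.measurable hS),
    Measure.restrict_apply hS, Set.image_preimage_eq_inter_range]

theorem bipolarCoord_bipolarArc (m : ℂ) (hu : u ≠ 0) (hβ : Real.sin β ≠ 0) (t : ℝ) :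
    bipolarCoord m u (bipolarArc m u β t) = t := by
  have hD := cosh_sub_cos_pos hβ t
  have hu' : 0 < ‖u‖ := norm_pos_iff.2 hu
  -- The signs ε = ±1 treat both poles at once; the ratio of the two squared distances is `exp (2
  -- t)`.
  have key : ∀ ε : ℝ, ε ^ 2 = 1 → ‖bipolarArc m u β t - (m + u * (ε * I))‖ ^ 2 =
      ‖u‖ ^ 2 * (2 * (Real.cosh t - ε * Real.sinh t) / (Real.cosh t - Real.cos β)) := by
    intro ε hε
    rw [bipolarArc_eq, add_sub_add_left_eq_sub, ← mul_sub, norm_mul, mul_pow]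
    congr 1
    rw [← Complex.normSq_eq_norm_sq, Complex.normSq_apply]
    simp only [Complex.sub_re, Complex.add_re, Complex.ofReal_re, Complex.mul_re, Complex.ofReal_im,
      Complex.I_re, Complex.I_im, Complex.sub_im, Complex.add_im, Complex.mul_im]
    have e1 := Real.sin_sq_add_cos_sq β
    have e3 := Real.cosh_sq t
    field_simp
    linear_combination e1 - e3 + (Real.cosh t - Real.cos β) ^ 2 * hε
  have k1 := key 1 (by norm_num)
  have k2 := key (-1) (by norm_num)
  have a1 : m + u * (((1 : ℝ) : ℂ) * I) = m + u * I := by simp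
  have a2 : m + u * (((-1 : ℝ) : ℂ) * I) = m - u * I := by simp [sub_eq_add_neg]
  rw [a1, one_mul, Real.cosh_sub_sinh] at k1
  rw [a2, neg_one_mul, sub_neg_eq_add, Real.cosh_add_sinh] at k2
  have hsq : (‖bipolarArc m u β t - (m - u * I)‖ / ‖bipolarArc m u β t - (m + u * I)‖) ^ 2 =
      Real.exp t ^ 2 := by
    rw [div_pow, k1, k2, Real.exp_neg]
    have := Real.exp_pos t
    field_simp
  have h2 := (pow_left_inj₀ (div_nonneg (norm_nonneg _) (norm_nonneg _)) (Real.exp_pos t).le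
    two_ne_zero).1 hsq
  rw [bipolarCoord, h2, Real.log_exp]

theorem measurable_bipolarCoord (m u : ℂ) : Measurable (bipolarCoord m u) := by
  unfold bipolarCoord
  fun_prop

end Bipolar

/-! ### Circles as unions of two complementary arcs. -/

section CircleDecomposition

variable {m u : ℂ} {β β' : ℝ}

/-- The center of the circle that contains the arcs of angles `β` and `β + π`. -/
noncomputable def bipolarCenter (m u : ℂ) (β : ℝ) : ℂ :=
  m + u * ((Real.cos β / Real.sin β : ℝ) : ℂ)

theorem norm_sub_bipolarCenter_sq (m u : ℂ) (hβ : Real.sin β ≠ 0) (x y : ℝ) :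
    ‖m + u * (x + y * I) - bipolarCenter m u β‖ ^ 2 =
      (‖u‖ / Real.sin β) ^ 2 +
        ‖u‖ ^ 2 * (x ^ 2 + y ^ 2 - 1 - 2 * x * (Real.cos β / Real.sin β)) := by
  rw [bipolarCenter, add_sub_add_left_eq_sub, ← mul_sub, norm_mul, mul_pow, div_pow,
    ← Complex.normSq_eq_norm_sq (_ - _), Complex.normSq_apply]
  simp only [Complex.sub_re, Complex.add_re, Complex.ofReal_re, Complex.mul_re, Complex.ofReal_im,
      Complex.I_re, Complex.I_im, Complex.sub_im, Complex.add_im, Complex.mul_im]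
  have e1 := Real.sin_sq_add_cos_sq β
  field_simp
  linear_combination ‖u‖ ^ 2 * e1

theorem norm_bipolarArc_sub_bipolarCenter_sq (hβ : Real.sin β ≠ 0) (hβ' : Real.sin β' ≠ 0)
    (t : ℝ) :
    ‖bipolarArc m u β' t - bipolarCenter m u β‖ ^ 2 =
      (‖u‖ / Real.sin β) ^ 2 - ‖u‖ ^ 2 * (2 * Real.sin (β' - β)) /
        (Real.sin β * (Real.cosh t - Real.cos β')) := by
  have hD := cosh_sub_cos_pos hβ' t
  rw [bipolarArc_eq, norm_sub_bipolarCenter_sq m u hβ, Real.sin_sub]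
  have e1 := Real.sin_sq_add_cos_sq β'
  have e3 := Real.cosh_sq t
  field_simp
  linear_combination ‖u‖ ^ 2 * Real.sin β ^ 2 * (e1 - e3)

theorem eq_add_mul_re_im (m : ℂ) {u : ℂ} (hu : u ≠ 0) (p : ℂ) :
    p = m + u * ((((p - m) / u).re : ℂ) + (((p - m) / u).im : ℂ) * I) := by
  rw [Complex.re_add_im]
  field_simp
  ring

theorem mem_sphere_bipolarCenter_iff (hu : u ≠ 0) (hβ : 0 < Real.sin β) (p : ℂ) :
    p ∈ sphere (bipolarCenter m u β) (‖u‖ / Real.sin β) ↔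
      ((p - m) / u).re ^ 2 + ((p - m) / u).im ^ 2 =
        1 + 2 * ((p - m) / u).re * (Real.cos β / Real.sin β) := by
  have hu' : 0 < ‖u‖ := norm_pos_iff.2 hu
  rw [mem_sphere_iff_norm, ← pow_left_inj₀ (norm_nonneg _) (by positivity) two_ne_zero]
  conv_lhs => rw [eq_add_mul_re_im m hu p, norm_sub_bipolarCenter_sq m u hβ.ne']
  rw [add_eq_left, mul_eq_zero, or_iff_right (by positivity)]
  constructor <;> intro h <;> linarith

theorem mem_ball_bipolarCenter_iff (hu : u ≠ 0) (hβ : 0 < Real.sin β) (p : ℂ) :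
    p ∈ ball (bipolarCenter m u β) (‖u‖ / Real.sin β) ↔
      ((p - m) / u).re ^ 2 + ((p - m) / u).im ^ 2 <
        1 + 2 * ((p - m) / u).re * (Real.cos β / Real.sin β) := by
  have hu' : 0 < ‖u‖ := norm_pos_iff.2 hu
  rw [mem_ball_iff_norm, ← pow_lt_pow_iff_left₀ (norm_nonneg _) (by positivity) two_ne_zero]
  conv_lhs => rw [eq_add_mul_re_im m hu p, norm_sub_bipolarCenter_sq m u hβ.ne']
  rw [add_lt_iff_neg_left, mul_neg_iff, or_iff_left (fun h => by nlinarith [h.1, sq_nonneg ‖u‖]),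
    and_iff_right (by positivity)]
  constructor <;> intro h <;> linarith

theorem re_bipolarArc (hu : u ≠ 0) (m : ℂ) (β t : ℝ) :
    ((bipolarArc m u β t - m) / u).re = Real.sin β / (Real.cosh t - Real.cos β) := by
  rw [bipolarArc_eq, add_sub_cancel_left, mul_div_cancel_left₀ _ hu]
  simp only [Complex.add_re, Complex.ofReal_re, Complex.mul_re, Complex.ofReal_im,
      Complex.I_re, Complex.I_im]
  ring

theorem sin_add_pi_ne_zero (hβ : Real.sin β ≠ 0) : Real.sin (β + Real.pi) ≠ 0 := by
  rw [Real.sin_add_pi]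
  exact neg_ne_zero.2 hβ

theorem bipolarArc_mem_sphere (hβ : 0 < Real.sin β) (hβ' : Real.sin β' ≠ 0)
    (h : Real.sin (β' - β) = 0) (t : ℝ) :
    bipolarArc m u β' t ∈ sphere (bipolarCenter m u β) (‖u‖ / Real.sin β) := by
  rw [mem_sphere_iff_norm, ← pow_left_inj₀ (norm_nonneg _) (by positivity) two_ne_zero,
    norm_bipolarArc_sub_bipolarCenter_sq hβ.ne' hβ', h]
  simp

/-- The sign `ε` selects the arc, since adding π to β changes the signs of sine and cosine. Solving
for sinh t gives the witness, and the equation of the circle fixes the matching cosh t. -/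
theorem exists_bipolarArc_eq (hu : u ≠ 0) (hβ : 0 < Real.sin β) {p : ℂ}
    (hp : p ∈ sphere (bipolarCenter m u β) (‖u‖ / Real.sin β)) {ε : ℝ} (hε : ε ^ 2 = 1)
    (hx : 0 < ε * ((p - m) / u).re) :
    ∃ t : ℝ, p = m + u * (((ε * Real.sin β / (Real.cosh t - ε * Real.cos β) : ℝ) : ℂ) +
      ((Real.sinh t / (Real.cosh t - ε * Real.cos β) : ℝ) : ℂ) * I) := by
  rw [mem_sphere_bipolarCenter_iff hu hβ] at hp
  have hpe := eq_add_mul_re_im m hu p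
  generalize ((p - m) / u).re = x at *
  generalize ((p - m) / u).im = y at *
  have e1 := Real.sin_sq_add_cos_sq β
  refine ⟨Real.arsinh (y * Real.sin β / (ε * x)), ?_⟩
  have hx0 : x ≠ 0 := right_ne_zero_of_mul hx.ne'
  have hε0 : ε ≠ 0 := left_ne_zero_of_mul hx.ne'
  set A := 1 + x * (Real.cos β / Real.sin β) with hA
  have hA0 : 0 < A := by nlinarith
  have hcosh : Real.cosh (Real.arsinh (y * Real.sin β / (ε * x))) = A * Real.sin β / (ε * x) := by
    rw [← pow_left_inj₀ (Real.cosh_pos _).le (by positivity) two_ne_zero, Real.cosh_sq,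
      Real.sinh_arsinh, div_pow, div_pow, mul_pow ε, hε, one_mul]
    have : A ^ 2 = y ^ 2 + x ^ 2 / Real.sin β ^ 2 := by
      have hy : y ^ 2 = 1 + 2 * x * (Real.cos β / Real.sin β) - x ^ 2 := by linarith
      rw [hA, hy]
      field_simp
      linear_combination x ^ 2 * e1
    rw [mul_pow A, this]
    field_simp
  rw [Real.sinh_arsinh, hcosh]
  have hden : A * Real.sin β / (ε * x) - ε * Real.cos β = Real.sin β / (ε * x) := by
    rw [hA]
    field_simp
    linear_combination (-(x * Real.cos β)) * hε
  rw [hden]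
  have h1 : ε * Real.sin β / (Real.sin β / (ε * x)) = x := by
    field_simp
    exact hε
  have h2 : y * Real.sin β / (ε * x) / (Real.sin β / (ε * x)) = y := by
    field_simp
  rw [h1, h2]
  exact hpe

theorem range_bipolarArc (hu : u ≠ 0) (hβ : 0 < Real.sin β) :
    Set.range (bipolarArc m u β) =
      sphere (bipolarCenter m u β) (‖u‖ / Real.sin β) ∩ {p | 0 < ((p - m) / u).re} := by
  apply Set.Subset.antisymm
  · rintro _ ⟨t, rfl⟩
    refine ⟨bipolarArc_mem_sphere hβ hβ.ne' (by simp) t, ?_⟩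
    rw [Set.mem_ofPred_eq, re_bipolarArc hu]
    exact div_pos hβ (cosh_sub_cos_pos hβ.ne' t)
  · rintro p ⟨hp, hx⟩
    obtain ⟨t, ht⟩ := exists_bipolarArc_eq hu hβ hp (ε := 1) (by norm_num)
      (by rw [one_mul]; exact hx)
    rw [one_mul, one_mul] at ht
    exact ⟨t, by rw [bipolarArc_eq, ← ht]⟩

theorem range_bipolarArc_add_pi (hu : u ≠ 0) (hβ : 0 < Real.sin β) :
    Set.range (bipolarArc m u (β + Real.pi)) =
      sphere (bipolarCenter m u β) (‖u‖ / Real.sin β) ∩ {p | ((p - m) / u).re < 0} := by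
  have hβ' := sin_add_pi_ne_zero hβ.ne'
  apply Set.Subset.antisymm
  · rintro _ ⟨t, rfl⟩
    refine ⟨bipolarArc_mem_sphere hβ hβ' (by simp) t, ?_⟩
    rw [Set.mem_ofPred_eq, re_bipolarArc hu]
    exact div_neg_of_neg_of_pos (by rw [Real.sin_add_pi]; linarith) (cosh_sub_cos_pos hβ' t)
  · rintro p ⟨hp, hx⟩
    obtain ⟨t, ht⟩ := exists_bipolarArc_eq hu hβ hp (ε := -1) (by norm_num)
      (by rw [neg_one_mul]; exact neg_pos.2 hx)
    rw [neg_one_mul, neg_one_mul, ← Real.sin_add_pi, ← Real.cos_add_pi] at ht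
    exact ⟨t, by rw [bipolarArc_eq, ← ht]⟩

theorem disjoint_range_bipolarArc (hu : u ≠ 0) (hβ : 0 < Real.sin β) (hβ' : 0 < Real.sin β') :
    Disjoint (Set.range (bipolarArc m u β)) (Set.range (bipolarArc m u (β' + Real.pi))) := by
  rw [range_bipolarArc hu hβ, range_bipolarArc_add_pi hu hβ', Set.disjoint_left]
  rintro p ⟨_, h1⟩ ⟨_, h2⟩
  rw [Set.mem_ofPred_eq] at h1 h2
  exact lt_asymm h1 h2

/-- The Hausdorff measure of a circle in terms of two complementary arcs. -/
theorem circleMeasure_eq (hu : u ≠ 0) (hβ : 0 < Real.sin β) :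
    circleMeasure (bipolarCenter m u β) (‖u‖ / Real.sin β) =
      (Measure.hausdorffMeasure 1).restrict (Set.range (bipolarArc m u β)) +
      (Measure.hausdorffMeasure 1).restrict (Set.range (bipolarArc m u (β + Real.pi))) := by
  have hβ' := sin_add_pi_ne_zero hβ.ne'
  have hna := Measure.nullSingletonClass_hausdorff ℂ (d := 1) one_pos
  rw [circleMeasure, ← Measure.restrict_union (disjoint_range_bipolarArc hu hβ hβ)
    (measurableEmbedding_bipolarArc hu hβ').measurableSet_range]
  apply Measure.restrict_congr_set
  rw [range_bipolarArc hu hβ, range_bipolarArc_add_pi hu hβ, ← Set.inter_union_distrib_left]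
  refine Filter.EventuallyLE.antisymm ?_ (Set.inter_subset_left.eventuallyLE)
  -- The arcs miss exactly the two poles, which form a null set for the one-dimensional measure.
  have hnull : Measure.hausdorffMeasure 1 ({m + u * I, m - u * I} : Set ℂ) = 0 :=
    Set.Finite.measure_zero (by simp) _
  rw [← compl_mem_ae_iff] at hnull
  filter_upwards [hnull] with p hp hps
  refine ⟨hps, ?_⟩
  by_contra hcon
  apply hp
  have hx : ((p - m) / u).re = 0 := by
    simp only [Set.mem_union, Set.mem_ofPred_eq, not_or, not_lt] at hcon
    exact le_antisymm hcon.1 hcon.2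
  have hy := (mem_sphere_bipolarCenter_iff hu hβ p).1 hps
  have hpe := eq_add_mul_re_im m hu p
  rw [hx] at hy hpe
  have hy' : ((p - m) / u).im ^ 2 = 1 := by linarith
  rcases sq_eq_one_iff.1 hy' with h | h <;> rw [h] at hpe
  · left
    rw [hpe]
    simp
  · right
    rw [hpe]
    simp [sub_eq_add_neg]

theorem cot_lt_cot {β₁ β₂ : ℝ} (h1 : 0 < Real.sin β₁) (h2 : 0 < Real.sin β₂)
    (h : 0 < Real.sin (β₁ - β₂)) :
    Real.cos β₁ / Real.sin β₁ < Real.cos β₂ / Real.sin β₂ := by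
  rw [div_lt_div_iff₀ h1 h2]
  rw [Real.sin_sub] at h
  linarith

/-- With p = m + u (x + iy), the circle of angle β is x² + y² = 1 + 2 x cot β. A point of one circle
lies in the other disk according to the sign of x times the difference of the cotangents, hence
according to the sign of x. -/
theorem interiorArc_eq_range (hu : u ≠ 0) {β₁ β₂ : ℝ} (h1 : 0 < Real.sin β₁)
    (h2 : 0 < Real.sin β₂) (h : 0 < Real.sin (β₁ - β₂)) :
    interiorArc (bipolarCenter m u β₁) (‖u‖ / Real.sin β₁) (bipolarCenter m u β₂)
      (‖u‖ / Real.sin β₂) = Set.range (bipolarArc m u β₁) := by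
  have hc := cot_lt_cot h1 h2 h
  rw [interiorArc, range_bipolarArc hu h1]
  ext p
  refine and_congr_right fun hp => ?_
  rw [mem_ball_bipolarCenter_iff hu h2, (mem_sphere_bipolarCenter_iff hu h1 p).1 hp,
    Set.mem_ofPred_eq, add_lt_add_iff_left]
  constructor
  · intro h
    by_contra hn
    nlinarith
  · intro h
    nlinarith

theorem interiorArc_eq_range_add_pi (hu : u ≠ 0) {β₁ β₂ : ℝ} (h1 : 0 < Real.sin β₁)
    (h2 : 0 < Real.sin β₂) (h : 0 < Real.sin (β₁ - β₂)) :
    interiorArc (bipolarCenter m u β₂) (‖u‖ / Real.sin β₂) (bipolarCenter m u β₁)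
      (‖u‖ / Real.sin β₁) = Set.range (bipolarArc m u (β₂ + Real.pi)) := by
  have hc := cot_lt_cot h1 h2 h
  rw [interiorArc, range_bipolarArc_add_pi hu h2]
  ext p
  refine and_congr_right fun hp => ?_
  rw [mem_ball_bipolarCenter_iff hu h1, (mem_sphere_bipolarCenter_iff hu h2 p).1 hp,
    Set.mem_ofPred_eq, add_lt_add_iff_left]
  constructor
  · intro h
    by_contra hn
    nlinarith
  · intro h
    nlinarith

end CircleDecomposition

/-! ### Restriction to an arc and extension by zero as operators. -/

section ArcOperators

variable {m u x : ℂ} {r β β' : ℝ}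

/-- `V` is the restriction of functions on a circle to an arc, in the bipolar parametrization and
conjugated by the weight `exp (-|t| / 2)`. -/
def IsArcRestriction (m u : ℂ) (β : ℝ) {x : ℂ} {r : ℝ} (V : CircleL2 x r →L[ℂ] LineL2) : Prop :=
  ∀ g : CircleL2 x r, V g =ᵐ[volume] fun t =>
    (Real.exp (-|t| / 2) : ℂ) * g (bipolarArc m u β t)

/-- `E` is the extension by zero of functions on an arc to a circle, in the bipolar parametrization
and conjugated by the weight `exp (-|t| / 2)`. -/
def IsArcExtension (m u : ℂ) (β : ℝ) {x : ℂ} {r : ℝ} (E : LineL2 →L[ℂ] CircleL2 x r) : Prop :=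
  ∀ F : LineL2, E F =ᵐ[circleMeasure x r] fun p =>
    (((Set.range (bipolarArc m u β)).indicator
      (fun p => Real.exp (|bipolarCoord m u p| / 2)) p : ℝ) : ℂ) * F (bipolarCoord m u p)

theorem circleMeasure_restrict_range (hu : u ≠ 0) (hβ : Real.sin β ≠ 0)
    (hsub : Set.range (bipolarArc m u β) ⊆ sphere x r) :
    (circleMeasure x r).restrict (Set.range (bipolarArc m u β)) =
      (volume.withDensity fun t => ENNReal.ofReal (bipolarSpeed u β t)).map (bipolarArc m u β) := by
  rw [map_bipolarArc_eq hu hβ, circleMeasure, Measure.restrict_restrict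
    (measurableEmbedding_bipolarArc hu hβ).measurableSet_range, Set.inter_eq_left.2 hsub]

/-- The speed is positive everywhere, so arc length and Lebesgue measure in t have the same null
sets. -/
theorem ae_bipolarArc_iff (hu : u ≠ 0) (hβ : Real.sin β ≠ 0)
    (hsub : Set.range (bipolarArc m u β) ⊆ sphere x r) {P : ℂ → Prop} :
    (∀ᵐ p ∂circleMeasure x r, p ∈ Set.range (bipolarArc m u β) → P p) ↔
      ∀ᵐ t : ℝ, P (bipolarArc m u β t) := by
  have hemb := measurableEmbedding_bipolarArc (m := m) hu hβ
  have hm : Measurable fun t => ENNReal.ofReal (bipolarSpeed u β t) :=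
    (continuous_bipolarSpeed u hβ).measurable.ennreal_ofReal
  rw [← ae_restrict_iff' hemb.measurableSet_range, circleMeasure_restrict_range hu hβ hsub,
    hemb.ae_map_iff, ae_withDensity_iff hm]
  simp [bipolarSpeed_pos hu hβ]

theorem exists_isArcRestriction (hu : u ≠ 0) (hβ : Real.sin β ≠ 0)
    (hsub : Set.range (bipolarArc m u β) ⊆ sphere x r) :
    ∃ V : CircleL2 x r →L[ℂ] LineL2, IsArcRestriction m u β V := by
  have hemb := measurableEmbedding_bipolarArc (m := m) hu hβ
  have hm : Measurable fun t => ENNReal.ofReal (bipolarSpeed u β t) :=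
    (continuous_bipolarSpeed u hβ).measurable.ennreal_ofReal
  have hu' : 0 < ‖u‖ := norm_pos_iff.2 hu
  obtain ⟨V, hV, -⟩ := exists_weightedComp (μ := circleMeasure x r) (ν := volume)
    (φ := bipolarArc m u β) (w := fun t => Real.exp (-|t| / 2)) hemb.measurable (by fun_prop)
    -- The constant comes from `exp (-|t|) * (cosh t - cos β) ≤ 2`.
    (K := Real.sqrt (2 / ‖u‖)) (Real.sqrt_nonneg _) (by
      rw [← ENNReal.ofReal_pow (Real.sqrt_nonneg _), Real.sq_sqrt (by positivity)]
      have h1 : (volume.withDensity fun t => ‖Real.exp (-|t| / 2)‖ₑ ^ 2) ≤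
          ENNReal.ofReal (2 / ‖u‖) •
            volume.withDensity fun t => ENNReal.ofReal (bipolarSpeed u β t) := by
        rw [← withDensity_smul _ hm]
        refine withDensity_mono (Filter.Eventually.of_forall fun t => ?_)
        dsimp only
        rw [Pi.smul_apply, smul_eq_mul, Real.enorm_eq_ofReal (Real.exp_pos _).le,
          ← ENNReal.ofReal_pow (Real.exp_pos _).le, ← ENNReal.ofReal_mul (by positivity)]
        refine ENNReal.ofReal_le_ofReal ?_
        have hD := cosh_sub_cos_pos hβ t
        rw [← Real.exp_nat_mul, bipolarSpeed, div_mul_div_cancel₀ hu'.ne', le_div_iff₀ hD]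
        have e : ((2 : ℕ) : ℝ) * (-|t| / 2) = -|t| := by push_cast; ring
        have e2 : Real.exp (-|t|) * Real.exp |t| = 1 := by rw [← Real.exp_add]; simp
        rw [e]
        have h3 : Real.exp (-|t|) ≤ 1 := Real.exp_le_one_iff.2 (by simp)
        have h4 := cosh_le_exp_abs t
        have h5 := Real.neg_one_le_cos β
        nlinarith [Real.exp_pos (-|t|)]
      refine (Measure.map_mono h1 hemb.measurable).trans ?_
      rw [Measure.map_smul, ← circleMeasure_restrict_range hu hβ hsub]
      gcongr
      exact Measure.restrict_le_self)
  exact ⟨V, hV⟩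

theorem exists_isArcExtension (hu : u ≠ 0) (hβ : Real.sin β ≠ 0)
    (hsub : Set.range (bipolarArc m u β) ⊆ sphere x r) :
    ∃ E : LineL2 →L[ℂ] CircleL2 x r, IsArcExtension m u β E := by
  have hemb := measurableEmbedding_bipolarArc (m := m) hu hβ
  have hm : Measurable fun t => ENNReal.ofReal (bipolarSpeed u β t) :=
    (continuous_bipolarSpeed u hβ).measurable.ennreal_ofReal
  have hu' : 0 < ‖u‖ := norm_pos_iff.2 hu
  have hk : 0 < 1 - |Real.cos β| := by linarith [abs_cos_lt_one_of_sin_ne_zero hβ]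
  have hτ := measurable_bipolarCoord m u
  set w : ℂ → ℝ := (Set.range (bipolarArc m u β)).indicator
      (fun p => Real.exp (|bipolarCoord m u p| / 2)) with hw
  have hwm : Measurable w := Measurable.indicator (by fun_prop) hemb.measurableSet_range
  -- An upper bound for `exp |t|` times the speed, from `exp |t| ≤ 2 * cosh t`.
  set K : ℝ := 2 * ‖u‖ / (1 - |Real.cos β|) with hK
  obtain ⟨E, hE, -⟩ := exists_weightedComp (μ := volume) (ν := circleMeasure x r)
    (φ := bipolarCoord m u) (w := w) hτ hwm (K := Real.sqrt K) (Real.sqrt_nonneg _) (by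
      rw [← ENNReal.ofReal_pow (Real.sqrt_nonneg _), Real.sq_sqrt (by positivity)]
      refine Measure.le_iff.2 fun S hS => ?_
      rw [Measure.map_apply hτ hS, withDensity_apply _ (hτ hS), Measure.smul_apply, smul_eq_mul,
        ← lintegral_indicator (hτ hS)]
      have h1 : ∀ p, (bipolarCoord m u ⁻¹' S).indicator (fun p => ‖w p‖ₑ ^ 2) p =
          (Set.range (bipolarArc m u β)).indicator (fun p => S.indicator
            (fun t => ENNReal.ofReal (Real.exp |t|)) (bipolarCoord m u p)) p := by
        intro p
        by_cases hp : p ∈ Set.range (bipolarArc m u β)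
        · rw [Set.indicator_of_mem hp]
          by_cases hpS : bipolarCoord m u p ∈ S
          · rw [Set.indicator_of_mem (by exact hpS), Set.indicator_of_mem hpS, hw,
              Set.indicator_of_mem hp, Real.enorm_eq_ofReal (Real.exp_pos _).le,
              ← ENNReal.ofReal_pow (Real.exp_pos _).le, ← Real.exp_nat_mul]
            congr 2
            push_cast
            ring
          · rw [Set.indicator_of_notMem (by exact hpS), Set.indicator_of_notMem hpS]
        · rw [Set.indicator_of_notMem hp]
          by_cases hpS : p ∈ bipolarCoord m u ⁻¹' S
          · rw [Set.indicator_of_mem hpS, hw, Set.indicator_of_notMem hp]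
            simp
          · rw [Set.indicator_of_notMem hpS]
      have hSm : Measurable (S.indicator (fun t : ℝ => ENNReal.ofReal (Real.exp |t|))) :=
        Measurable.indicator (by fun_prop) hS
      simp_rw [h1]
      rw [lintegral_indicator hemb.measurableSet_range, circleMeasure_restrict_range hu hβ hsub,
        lintegral_map (by exact hSm.comp hτ) hemb.measurable]
      simp_rw [bipolarCoord_bipolarArc m hu hβ]
      rw [lintegral_withDensity_eq_lintegral_mul _ hm hSm, ← setLIntegral_const,
        ← lintegral_indicator hS]
      refine lintegral_mono fun t => ?_
      rw [Pi.mul_apply]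
      by_cases ht : t ∈ S
      · rw [Set.indicator_of_mem ht, Set.indicator_of_mem ht,
          ← ENNReal.ofReal_mul (bipolarSpeed_pos hu hβ t).le]
        refine ENNReal.ofReal_le_ofReal ?_
        have hD := cosh_sub_cos_pos hβ t
        rw [bipolarSpeed, hK, div_mul_eq_mul_div, div_le_div_iff₀ hD hk]
        have h2 := mul_cosh_le_cosh_sub_cos β t
        have h3 := exp_abs_le_two_mul_cosh t
        calc ‖u‖ * Real.exp |t| * (1 - |Real.cos β|)
            ≤ ‖u‖ * (2 * Real.cosh t) * (1 - |Real.cos β|) := by gcongr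
          _ = 2 * ‖u‖ * ((1 - |Real.cos β|) * Real.cosh t) := by ring
          _ ≤ _ := by gcongr
      · rw [Set.indicator_of_notMem ht, Set.indicator_of_notMem ht, mul_zero])
  exact ⟨E, hE⟩

theorem IsArcRestriction.comp_extension (hu : u ≠ 0) (hβ : Real.sin β ≠ 0)
    (hsub : Set.range (bipolarArc m u β) ⊆ sphere x r) {V : CircleL2 x r →L[ℂ] LineL2}
    {E : LineL2 →L[ℂ] CircleL2 x r} (hV : IsArcRestriction m u β V)
    (hE : IsArcExtension m u β E) (F : LineL2) : V (E F) = F := by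
  apply Lp.ext
  have h1 := (ae_bipolarArc_iff hu hβ hsub).1 ((hE F).mono fun p hp _ => hp)
  filter_upwards [hV (E F), h1] with t h2 h3
  rw [h2, h3, Set.indicator_of_mem (Set.mem_range_self t), bipolarCoord_bipolarArc m hu hβ, ← mul_assoc,
    ← Complex.ofReal_mul, ← Real.exp_add, neg_div, neg_add_cancel, Real.exp_zero,
    Complex.ofReal_one, one_mul]

theorem IsArcRestriction.comp_extension_of_disjoint (hu : u ≠ 0) (hβ' : Real.sin β' ≠ 0)
    (hsub : Set.range (bipolarArc m u β') ⊆ sphere x r)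
    (hdisj : Disjoint (Set.range (bipolarArc m u β)) (Set.range (bipolarArc m u β')))
    {V : CircleL2 x r →L[ℂ] LineL2} {E : LineL2 →L[ℂ] CircleL2 x r}
    (hV : IsArcRestriction m u β' V) (hE : IsArcExtension m u β E) (F : LineL2) :
    V (E F) = 0 := by
  apply Lp.ext
  have h1 := (ae_bipolarArc_iff hu hβ' hsub).1 ((hE F).mono fun p hp _ => hp)
  filter_upwards [hV (E F), h1, Lp.coeFn_zero ℂ 2 (volume : Measure ℝ)] with t h2 h3 h4
  rw [h2, h3, h4, Set.indicator_of_notMem (Set.disjoint_right.1 hdisj (Set.mem_range_self t))]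
  simp

end ArcOperators

/-! ### The Poisson integral of a disk as a sum of two convolutions. -/

section PoissonOnArcs

variable {m u : ℂ} {β β' : ℝ}

/-- The Poisson kernel of a disk in bipolar coordinates. -/
theorem poissonKernel_mul_bipolarSpeed (hu : u ≠ 0) (hβ : Real.sin β ≠ 0) (hβ' : Real.sin β' ≠ 0)
    {α : ℝ} (hα : Real.sin α ≠ 0) (hd : Real.sin (β' - α) ≠ 0) (t s : ℝ) :
    bipolarSpeed u α s * (((‖u‖ / Real.sin β) ^ 2 -
      ‖bipolarArc m u β' t - bipolarCenter m u β‖ ^ 2) /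
      (‖u‖ / Real.sin β * ‖bipolarArc m u β' t - bipolarArc m u α s‖ ^ 2)) =
      Real.sin (β' - β) / (Real.cosh (t - s) - Real.cos (β' - α)) := by
  have hu' : 0 < ‖u‖ := norm_pos_iff.2 hu
  have h1 := cosh_sub_cos_pos hβ' t
  have h2 := cosh_sub_cos_pos hα s
  have h3 := cosh_sub_cos_pos hd (t - s)
  -- The factor at t cancels between the numerator and the squared distance; the factor at s cancels
  -- against the speed.
  rw [norm_bipolarArc_sub_bipolarCenter_sq hβ hβ', norm_bipolarArc_sub_sq hβ' hα, bipolarSpeed,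
    sub_sub_cancel]
  field_simp

theorem integral_restrict_range_bipolarArc (hu : u ≠ 0) (hβ : Real.sin β ≠ 0) (G : ℂ → ℂ) :
    ∫ p, G p ∂(Measure.hausdorffMeasure 1).restrict (Set.range (bipolarArc m u β)) =
      ∫ t, (bipolarSpeed u β t : ℂ) * G (bipolarArc m u β t) := by
  have hm : Measurable fun t => ENNReal.ofReal (bipolarSpeed u β t) :=
    (continuous_bipolarSpeed u hβ).measurable.ennreal_ofReal
  rw [← map_bipolarArc_eq hu hβ, (measurableEmbedding_bipolarArc hu hβ).integral_map,
    integral_withDensity_eq_integral_toReal_smul hm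
      (Filter.Eventually.of_forall fun _ => ENNReal.ofReal_lt_top)]
  refine integral_congr_ae (Filter.Eventually.of_forall fun t => ?_)
  dsimp only
  rw [ENNReal.toReal_ofReal (bipolarSpeed_pos hu hβ t).le, Complex.real_smul]

theorem integrable_restrict_range_bipolarArc (hu : u ≠ 0) (hβ : Real.sin β ≠ 0) {G : ℂ → ℂ}
    (hG : Integrable fun t => (bipolarSpeed u β t : ℂ) * G (bipolarArc m u β t)) :
    Integrable G ((Measure.hausdorffMeasure 1).restrict (Set.range (bipolarArc m u β))) := by
  have hm : Measurable fun t => ENNReal.ofReal (bipolarSpeed u β t) :=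
    (continuous_bipolarSpeed u hβ).measurable.ennreal_ofReal
  rw [← map_bipolarArc_eq hu hβ, (measurableEmbedding_bipolarArc hu hβ).integrable_map_iff,
    integrable_withDensity_iff_integrable_smul' hm
      (Filter.Eventually.of_forall fun _ => ENNReal.ofReal_lt_top)]
  refine hG.congr (Filter.Eventually.of_forall fun t => ?_)
  dsimp only [Function.comp]
  rw [ENNReal.toReal_ofReal (bipolarSpeed_pos hu hβ t).le, Complex.real_smul]

/-- The Poisson integral in a disk in bipolar coordinates. -/
theorem poissonIntegral_bipolarArc (hu : u ≠ 0) (hβ : 0 < Real.sin β) (hβ' : Real.sin β' ≠ 0)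
    (hd : 0 < β' - β) (hd' : β' - β < Real.pi) {g : ℂ → ℂ} {t : ℝ}
    (h0 : Integrable fun s => (stripKernel (β' - β) (t - s) : ℂ) * g (bipolarArc m u β s))
    (h1 : Integrable fun s => (stripKernel (Real.pi - (β' - β)) (t - s) : ℂ) *
      g (bipolarArc m u (β + Real.pi) s)) :
    poissonIntegral (bipolarCenter m u β) (‖u‖ / Real.sin β) g (bipolarArc m u β' t) =
      (∫ s, (stripKernel (β' - β) (t - s) : ℂ) * g (bipolarArc m u β s)) +
      ∫ s, (stripKernel (Real.pi - (β' - β)) (t - s) : ℂ) *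
        g (bipolarArc m u (β + Real.pi) s) := by
  have hs := Real.sin_pos_of_pos_of_lt_pi hd hd'
  have hβp := sin_add_pi_ne_zero hβ.ne'
  have hpi : (2 * Real.pi : ℝ) ≠ 0 := by positivity
  set G : ℂ → ℂ := fun y => ((((‖u‖ / Real.sin β) ^ 2 -
      ‖bipolarArc m u β' t - bipolarCenter m u β‖ ^ 2) /
      (‖u‖ / Real.sin β * ‖bipolarArc m u β' t - y‖ ^ 2) : ℝ) : ℂ) * g y with hG
  have e0 : ∀ s, (bipolarSpeed u β s : ℂ) * G (bipolarArc m u β s) =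
      (2 * Real.pi : ℝ) *
        ((stripKernel (β' - β) (t - s) : ℂ) * g (bipolarArc m u β s)) := by
    intro s
    rw [hG]
    dsimp only
    rw [← mul_assoc, ← mul_assoc, ← Complex.ofReal_mul, ← Complex.ofReal_mul,
      poissonKernel_mul_bipolarSpeed hu hβ.ne' hβ' hβ.ne' hs.ne', stripKernel]
    congr 2
    field_simp
  have e1 : ∀ s, (bipolarSpeed u (β + Real.pi) s : ℂ) * G (bipolarArc m u (β + Real.pi) s) =
      (2 * Real.pi : ℝ) * ((stripKernel (Real.pi - (β' - β)) (t - s) : ℂ) *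
        g (bipolarArc m u (β + Real.pi) s)) := by
    intro s
    -- On the complementary boundary arc the angle is shifted by π, which turns the height h into π
    -- - h.
    have e : β' - (β + Real.pi) = β' - β - Real.pi := by ring
    rw [hG]
    dsimp only
    rw [← mul_assoc, ← mul_assoc, ← Complex.ofReal_mul, ← Complex.ofReal_mul,
      poissonKernel_mul_bipolarSpeed hu hβ.ne' hβ' hβp (by
        rw [e, Real.sin_sub_pi]; exact neg_ne_zero.2 hs.ne'), stripKernel, e, Real.cos_sub_pi,
      Real.sin_pi_sub, Real.cos_pi_sub]
    congr 2
    field_simp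
  have i0 : Integrable fun s => (bipolarSpeed u β s : ℂ) * G (bipolarArc m u β s) := by
    simp_rw [e0]
    exact h0.const_mul _
  have i1 : Integrable fun s => (bipolarSpeed u (β + Real.pi) s : ℂ) *
      G (bipolarArc m u (β + Real.pi) s) := by
    simp_rw [e1]
    exact h1.const_mul _
  have hpo : poissonIntegral (bipolarCenter m u β) (‖u‖ / Real.sin β) g (bipolarArc m u β' t) =
      ((1 / (2 * Real.pi) : ℝ) : ℂ) *
        ∫ y, G y ∂circleMeasure (bipolarCenter m u β) (‖u‖ / Real.sin β) := rfl
  rw [hpo, circleMeasure_eq hu hβ, integral_add_measure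
    (integrable_restrict_range_bipolarArc hu hβ.ne' i0)
    (integrable_restrict_range_bipolarArc hu hβp i1),
    integral_restrict_range_bipolarArc hu hβ.ne', integral_restrict_range_bipolarArc hu hβp]
  simp_rw [e0, e1]
  rw [integral_const_mul, integral_const_mul, ← mul_add, ← mul_assoc, ← Complex.ofReal_mul,
    one_div_mul_cancel hpi, Complex.ofReal_one, one_mul]

/-- Restrict the data to both boundary arcs, convolve, add, and extend from the arc inside the disk:
the exponential weights of these operators cancel and leave the Poisson integral. -/
theorem isDtD_of_bipolar {x : ℂ} {r : ℝ} (hu : u ≠ 0) (hβ : 0 < Real.sin β)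
    (hβ' : Real.sin β' ≠ 0) (hd : 0 < β' - β) (hd' : β' - β < Real.pi)
    (hsub : Set.range (bipolarArc m u β') ⊆ sphere x r)
    (harc : interiorArc x r (bipolarCenter m u β) (‖u‖ / Real.sin β) =
      Set.range (bipolarArc m u β'))
    {V₀ V₁ : CircleL2 (bipolarCenter m u β) (‖u‖ / Real.sin β) →L[ℂ] LineL2}
    {C₀ C₁ : LineL2 →L[ℂ] LineL2} {E : LineL2 →L[ℂ] CircleL2 x r}
    (hV₀ : IsArcRestriction m u β V₀) (hV₁ : IsArcRestriction m u (β + Real.pi) V₁)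
    (hC₀ : IsWeightedConv (stripKernel (β' - β)) C₀)
    (hC₁ : IsWeightedConv (stripKernel (Real.pi - (β' - β))) C₁)
    (hE : IsArcExtension m u β' E) :
    IsDtD x r (bipolarCenter m u β) (‖u‖ / Real.sin β) (E ∘L (C₀ ∘L V₀ + C₁ ∘L V₁)) := by
  intro g
  have hk : 0 < Real.pi - (β' - β) := by linarith
  have hk' : Real.pi - (β' - β) < Real.pi := by linarith
  rw [harc]
  have key : ∀ {h α : ℝ} (_ : 0 < h) (_ : h < Real.pi)
      {V : CircleL2 (bipolarCenter m u β) (‖u‖ / Real.sin β) →L[ℂ] LineL2}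
      {C : LineL2 →L[ℂ] LineL2} (_ : IsArcRestriction m u α V)
      (_ : IsWeightedConv (stripKernel h) C),
      ∀ᵐ t : ℝ, (Integrable fun s => (stripKernel h (t - s) : ℂ) * g (bipolarArc m u α s)) ∧
        (Real.exp (|t| / 2) : ℂ) * C (V g) t =
          ∫ s, (stripKernel h (t - s) : ℂ) * g (bipolarArc m u α s) := by
    intro h α h0 hπ V C hV hC
    have hcont := continuous_stripKernel h0 hπ
    filter_upwards [ae_integrable_weightedConv hcont
      (integrable_mul_of_le_exp_neg_abs hcont (abs_stripKernel_le h0 hπ)) (V g), hC (V g)]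
      with t hi ht
    have hae : (fun s => (Real.exp (|t| / 2) : ℂ) *
        (((Real.exp (-|t| / 2) * stripKernel h (t - s) * Real.exp (|s| / 2) : ℝ) : ℂ) * V g s))
        =ᵐ[volume] fun s => (stripKernel h (t - s) : ℂ) * g (bipolarArc m u α s) := by
      filter_upwards [hV g] with s hs
      rw [hs, ← mul_assoc, ← mul_assoc, ← Complex.ofReal_mul, ← Complex.ofReal_mul]
      congr 2
      have a1 : Real.exp (|t| / 2) * Real.exp (-|t| / 2) = 1 := by
        rw [← Real.exp_add, neg_div, add_neg_cancel, Real.exp_zero]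
      have a2 : Real.exp (|s| / 2) * Real.exp (-|s| / 2) = 1 := by
        rw [← Real.exp_add, neg_div, add_neg_cancel, Real.exp_zero]
      linear_combination (stripKernel h (t - s) * (Real.exp (|s| / 2) * Real.exp (-|s| / 2))) * a1
        + stripKernel h (t - s) * a2
    refine ⟨(hi.const_mul _).congr hae, ?_⟩
    rw [ht, ← integral_const_mul]
    exact integral_congr_ae hae
  have hmain : ∀ᵐ t : ℝ, (Real.exp (|t| / 2) : ℂ) * (C₀ (V₀ g) + C₁ (V₁ g) : LineL2) t =
      poissonIntegral (bipolarCenter m u β) (‖u‖ / Real.sin β) g (bipolarArc m u β' t) := by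
    filter_upwards [key hd hd' hV₀ hC₀, key hk hk' hV₁ hC₁,
      Lp.coeFn_add (C₀ (V₀ g)) (C₁ (V₁ g))] with t h0 h1 h2
    rw [poissonIntegral_bipolarArc hu hβ hβ' hd hd' h0.1 h1.1, h2, Pi.add_apply, mul_add, h0.2,
      h1.2]
  -- The parameter is rewritten as the bipolar coordinate of the point, so that the identity becomes
  -- one about points of the circle.
  have hmain' : ∀ᵐ t : ℝ, (Real.exp (|bipolarCoord m u (bipolarArc m u β' t)| / 2) : ℂ) *
      (C₀ (V₀ g) + C₁ (V₁ g) : LineL2) (bipolarCoord m u (bipolarArc m u β' t)) =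
      poissonIntegral (bipolarCenter m u β) (‖u‖ / Real.sin β) g (bipolarArc m u β' t) := by
    simp_rw [bipolarCoord_bipolarArc m hu hβ']
    exact hmain
  have h3 := (ae_bipolarArc_iff (x := x) (r := r) (P := fun p =>
    (Real.exp (|bipolarCoord m u p| / 2) : ℂ) *
      (C₀ (V₀ g) + C₁ (V₁ g) : LineL2) (bipolarCoord m u p) =
      poissonIntegral (bipolarCenter m u β) (‖u‖ / Real.sin β) g p) hu hβ' hsub).2 hmain'
  filter_upwards [hE (C₀ (V₀ g) + C₁ (V₁ g)), h3] with p hp1 hp2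
  refine hp1.trans ?_
  by_cases hp : p ∈ Set.range (bipolarArc m u β')
  · rw [Set.indicator_of_mem hp, Set.indicator_of_mem hp, hp2 hp]
  · rw [Set.indicator_of_notMem hp, Set.indicator_of_notMem hp, Complex.ofReal_zero, zero_mul]

end PoissonOnArcs

/-! ### Spectra of products and eigenvectors. -/

section Spectrum

/-- The nonzero spectrum of a product of operators between two Banach spaces is contained in the
spectrum of the product in the reverse order. -/
theorem spectrum_comp_subset {X H : Type*} [NormedAddCommGroup X] [NormedSpace ℂ X]
    [NormedAddCommGroup H] [NormedSpace ℂ H] (E : H →L[ℂ] X) (B : X →L[ℂ] H) :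
    spectrum ℂ (E ∘L B) ⊆ insert 0 (spectrum ℂ (B ∘L E)) := by
  intro l hl
  by_contra hcon
  rw [Set.mem_insert_iff, not_or, spectrum.notMem_iff] at hcon
  obtain ⟨hl0, R, hR⟩ := hcon
  refine hl ?_
  set Q : H →L[ℂ] H := Units.val R⁻¹ with hQ
  have h1 : ∀ v : H, l • E (Q v) - E (B (E (Q v))) = E v := by
    intro v
    have := DFunLike.congr_fun R.mul_inv v
    rw [hR, ← hQ] at this
    have := congrArg E this
    simpa [Algebra.algebraMap_eq_smul_one] using this
  have h2 : ∀ v : H, l • Q v - Q (B (E v)) = v := by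
    intro v
    have := DFunLike.congr_fun R.inv_mul v
    rw [hR, ← hQ] at this
    simpa [Algebra.algebraMap_eq_smul_one] using this
  -- With Q = (l - BE)⁻¹, the inverse of l - EB is l⁻¹ (1 + E Q B).
  refine ⟨⟨algebraMap ℂ _ l - E ∘L B, l⁻¹ • (1 + E ∘L (Q ∘L B)), ?_, ?_⟩, rfl⟩
  · ext v
    have h3 : E (B (E (Q (B v)))) = l • E (Q (B v)) - E (B v) := by
      rw [← h1 (B v), sub_sub_cancel]
    simp [Algebra.algebraMap_eq_smul_one, smul_sub, h3, smul_smul, hl0]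
  · ext v
    have h3 : Q (B (E (B v))) = l • Q (B v) - B v := by
      rw [← sub_sub_cancel (l • Q (B v)) (Q (B (E (B v)))), h2]
    simp [Algebra.algebraMap_eq_smul_one, smul_sub, h3, smul_smul, hl0]

theorem mem_spectrum_of_hasEigenvector {X : Type*} [NormedAddCommGroup X] [NormedSpace ℂ X]
    {T : X →L[ℂ] X} {l : ℂ} {v : X}
    (h : Module.End.HasEigenvector (T : X →ₗ[ℂ] X) l v) : l ∈ spectrum ℂ T := by
  rintro ⟨R, hR⟩
  apply h.2
  have h1 := DFunLike.congr_fun R.inv_val v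
  rw [hR] at h1
  have h2 : T v = l • v := h.apply_eq_smul
  simpa [Algebra.algebraMap_eq_smul_one, h2] using h1.symm

end Spectrum

/-! ### The result for two disks given in bipolar coordinates. -/

section Bipolar

variable {m u : ℂ} {β₁ β₂ : ℝ}

theorem bipolarCenter_sub (m u : ℂ) (β₁ β₂ : ℝ) :
    bipolarCenter m u β₂ - bipolarCenter m u β₁ =
      u * ((Real.cos β₂ / Real.sin β₂ - Real.cos β₁ / Real.sin β₁ : ℝ) : ℂ) := by
  rw [bipolarCenter, bipolarCenter]
  push_cast
  ring

/-- The angular coordinate of a point of the interior arc determines its bipolar coordinate. -/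
theorem arcAngle_ratio_eq_exp (hu : u ≠ 0) (h1 : 0 < Real.sin β₁) (h2 : 0 < Real.sin β₂)
    (h : 0 < Real.sin (β₁ - β₂)) (t : ℝ) :
    (1 - Real.cos (arcAngle (bipolarCenter m u β₁) (bipolarCenter m u β₂)
        (bipolarArc m u β₁ t) + (Real.pi - β₁))) /
      (Real.cos (arcAngle (bipolarCenter m u β₁) (bipolarCenter m u β₂) (bipolarArc m u β₁ t)) -
        Real.cos (Real.pi - β₁)) = Real.exp t := by
  have hc := cot_lt_cot h1 h2 h
  set k := Real.cos β₂ / Real.sin β₂ - Real.cos β₁ / Real.sin β₁ with hk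
  have hk0 : 0 < k := by rw [hk]; linarith
  have hD := cosh_sub_cos_pos h1.ne' t
  set D := Real.cosh t - Real.cos β₁ with hDdef
  set w := (bipolarArc m u β₁ t - bipolarCenter m u β₁) /
    (bipolarCenter m u β₂ - bipolarCenter m u β₁) with hw
  have hkc : (k : ℂ) ≠ 0 := by exact_mod_cast hk0.ne'
  have hsc : Complex.sin β₁ ≠ 0 := by
    rw [← Complex.ofReal_sin]
    exact_mod_cast h1.ne'
  have hDc : (D : ℂ) ≠ 0 := by exact_mod_cast hD.ne'
  have hwe : w = (((Real.sin β₁ / D - Real.cos β₁ / Real.sin β₁) / k : ℝ) : ℂ) +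
      ((Real.sinh t / D / k : ℝ) : ℂ) * I := by
    rw [hw, bipolarCenter_sub, bipolarArc_eq, bipolarCenter, ← hk, ← hDdef]
    push_cast
    field_simp
    ring
  have hnorm : ‖w‖ = 1 / (Real.sin β₁ * k) := by
    have hu' : 0 < ‖u‖ := norm_pos_iff.2 hu
    have hsph := mem_sphere_iff_norm.1 (bipolarArc_mem_sphere (m := m) (u := u) h1 h1.ne'
      (by simp) t)
    rw [hw, norm_div, hsph, bipolarCenter_sub, norm_mul, Complex.norm_real, Real.norm_eq_abs,
      ← hk, abs_of_pos hk0]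
    field_simp
  have hw0 : w ≠ 0 := by
    rw [← norm_pos_iff, hnorm]
    positivity
  have hre : w.re = (Real.sin β₁ / D - Real.cos β₁ / Real.sin β₁) / k := by
    rw [hwe]; simp [-Complex.ofReal_div, -Complex.ofReal_sub]
  have him : w.im = Real.sinh t / D / k := by
    rw [hwe]; simp [-Complex.ofReal_div, -Complex.ofReal_sub]
  -- Explicit cosine and sine of the angular coordinate; with them the numerator and the denominator
  -- of the ratio both contain sin² β₁ / D, leaving `exp t`.
  have hcos : Real.cos (Complex.arg w) = (1 - Real.cos β₁ * Real.cosh t) / D := by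
    rw [Complex.cos_arg hw0, hre, hnorm, hDdef]
    have e := Real.sin_sq_add_cos_sq β₁
    rw [hDdef] at hD
    field_simp
    linear_combination e
  have hsin : Real.sin (Complex.arg w) = Real.sin β₁ * Real.sinh t / D := by
    rw [Complex.sin_arg, him, hnorm]
    field_simp
  have ha : arcAngle (bipolarCenter m u β₁) (bipolarCenter m u β₂) (bipolarArc m u β₁ t) =
      Complex.arg w := rfl
  have e := Real.sin_sq_add_cos_sq β₁
  have hden : Real.cos (Complex.arg w) - Real.cos (Real.pi - β₁) = Real.sin β₁ ^ 2 / D := by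
    rw [hcos, Real.cos_pi_sub, hDdef]
    rw [hDdef] at hD
    field_simp
    linear_combination -e
  have hnum : 1 - Real.cos (Complex.arg w + (Real.pi - β₁)) =
      Real.sin β₁ ^ 2 * Real.exp t / D := by
    rw [Real.cos_add, hcos, hsin, Real.cos_pi_sub, Real.sin_pi_sub, ← Real.cosh_add_sinh, hDdef]
    rw [hDdef] at hD
    field_simp
    linear_combination (-(Real.cosh t)) * e
  rw [ha, hden, hnum]
  field_simp

/-- The bound on the transform passes to the closure and is attained at the boundary point i/2,
whose squared value belongs to the closure. -/
theorem spectralRadius_of_spectrum_eq {X : Type*} [NormedAddCommGroup X] [NormedSpace ℂ X]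
    {T : X →L[ℂ] X} {h : ℝ} (hh : 0 < h) (hh' : h < Real.pi)
    (hT : spectrum ℂ T = closure ((fun z => conj (poissonHat h z ^ 2)) '' dualStrip)) :
    spectralRadius ℂ T = ENNReal.ofReal (Real.sin ((Real.pi - h) / 2) ^ 2) := by
  have hs : 0 ≤ Real.sin ((Real.pi - h) / 2) :=
    Real.sin_nonneg_of_nonneg_of_le_pi (by linarith) (by linarith)
  have hle : ∀ k ∈ spectrum ℂ T, ‖k‖ ≤ Real.sin ((Real.pi - h) / 2) ^ 2 := by
    rw [hT]
    have hcl : IsClosed {k : ℂ | ‖k‖ ≤ Real.sin ((Real.pi - h) / 2) ^ 2} :=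
      isClosed_le continuous_norm continuous_const
    refine fun k hk => closure_minimal ?_ hcl hk
    rintro _ ⟨z, hz, rfl⟩
    change ‖conj (poissonHat h z ^ 2)‖ ≤ _
    rw [RCLike.norm_conj, norm_pow]
    have hz' : |z.im| ≤ 1 / 2 := le_of_lt hz
    gcongr
    exact norm_poissonHat_le hh hh' hz'
  rw [spectralRadius]
  apply le_antisymm
  · refine iSup₂_le fun k hk => ?_
    rw [← enorm_eq_nnnorm, ← ofReal_norm]
    exact ENNReal.ofReal_le_ofReal (hle k hk)
  · have hmem := sq_poissonHat_mem_closure h (z := (1 / 2 : ℝ) * I) (by simp [abs_of_pos])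
    rw [← hT] at hmem
    refine le_trans (le_of_eq ?_) (le_iSup₂ (f := fun k (_ : k ∈ spectrum ℂ T) =>
      (‖k‖₊ : ENNReal)) _ hmem)
    rw [← enorm_eq_nnnorm, ← ofReal_norm, poissonHat_half, norm_pow, Complex.norm_real,
      Real.norm_of_nonneg hs]

/-- The spectrum of the product of the two Dirichlet-to-Dirichlet maps of a pair of disks that is
given in bipolar coordinates. -/
theorem spectrum_dirichletToDirichlet_bipolar (hu : u ≠ 0) (h1 : 0 < Real.sin β₁)
    (h2 : 0 < Real.sin β₂) (hd : 0 < β₁ - β₂) (hd' : β₁ - β₂ < Real.pi) :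
    ∃ (γ₁ : CircleL2 (bipolarCenter m u β₂) (‖u‖ / Real.sin β₂) →L[ℂ]
        CircleL2 (bipolarCenter m u β₁) (‖u‖ / Real.sin β₁))
      (γ₂ : CircleL2 (bipolarCenter m u β₁) (‖u‖ / Real.sin β₁) →L[ℂ]
        CircleL2 (bipolarCenter m u β₂) (‖u‖ / Real.sin β₂)),
      IsDtD (bipolarCenter m u β₁) (‖u‖ / Real.sin β₁) (bipolarCenter m u β₂)
        (‖u‖ / Real.sin β₂) γ₁ ∧
      IsDtD (bipolarCenter m u β₂) (‖u‖ / Real.sin β₂) (bipolarCenter m u β₁)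
        (‖u‖ / Real.sin β₁) γ₂ ∧
      spectrum ℂ (γ₁ ∘L γ₂) =
        closure ((fun z => conj (poissonHat (Real.pi - (β₁ - β₂)) z ^ 2)) '' dualStrip) ∧
      spectralRadius ℂ (γ₁ ∘L γ₂) = ENNReal.ofReal ((1 - Real.cos (β₁ - β₂)) / 2) ∧
      ∀ z₀ ∈ dualStrip,
        ∃ hf : MemLp (arcEigenfunction (bipolarCenter m u β₁) (‖u‖ / Real.sin β₁)
            (bipolarCenter m u β₂) (‖u‖ / Real.sin β₂) (Real.pi - β₁) z₀) 2
            (circleMeasure (bipolarCenter m u β₁) (‖u‖ / Real.sin β₁)),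
          Module.End.HasEigenvector
            ((γ₁ ∘L γ₂ : CircleL2 (bipolarCenter m u β₁) (‖u‖ / Real.sin β₁) →L[ℂ]
              CircleL2 (bipolarCenter m u β₁) (‖u‖ / Real.sin β₁)) :
              CircleL2 (bipolarCenter m u β₁) (‖u‖ / Real.sin β₁) →ₗ[ℂ]
              CircleL2 (bipolarCenter m u β₁) (‖u‖ / Real.sin β₁))
            (conj (poissonHat (Real.pi - (β₁ - β₂)) z₀ ^ 2))
            (hf.toLp (arcEigenfunction (bipolarCenter m u β₁) (‖u‖ / Real.sin β₁)
              (bipolarCenter m u β₂) (‖u‖ / Real.sin β₂) (Real.pi - β₁) z₀)) := by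
  have hs := Real.sin_pos_of_pos_of_lt_pi hd hd'
  set θ := β₁ - β₂ with hθ
  have hk : 0 < Real.pi - θ := by linarith
  have hk' : Real.pi - θ < Real.pi := by linarith
  have h1p := sin_add_pi_ne_zero h1.ne'
  have h2p := sin_add_pi_ne_zero h2.ne'
  have sub1 : Set.range (bipolarArc m u β₁) ⊆
      sphere (bipolarCenter m u β₁) (‖u‖ / Real.sin β₁) :=
    Set.range_subset_iff.2 (bipolarArc_mem_sphere h1 h1.ne' (by simp))
  have sub1p : Set.range (bipolarArc m u (β₁ + Real.pi)) ⊆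
      sphere (bipolarCenter m u β₁) (‖u‖ / Real.sin β₁) :=
    Set.range_subset_iff.2 (bipolarArc_mem_sphere h1 h1p (by simp))
  have sub2 : Set.range (bipolarArc m u β₂) ⊆
      sphere (bipolarCenter m u β₂) (‖u‖ / Real.sin β₂) :=
    Set.range_subset_iff.2 (bipolarArc_mem_sphere h2 h2.ne' (by simp))
  have sub2p : Set.range (bipolarArc m u (β₂ + Real.pi)) ⊆
      sphere (bipolarCenter m u β₂) (‖u‖ / Real.sin β₂) :=
    Set.range_subset_iff.2 (bipolarArc_mem_sphere h2 h2p (by simp))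
  -- `V₁`, `V₂` restrict to the interior arcs, `W₁`, `W₂` to the exterior ones. `C` has height π - θ
  -- and acts between interior arcs; `D` has height θ and carries the exterior data.
  obtain ⟨V₁, hV₁⟩ := exists_isArcRestriction hu h1.ne' sub1
  obtain ⟨W₁, hW₁⟩ := exists_isArcRestriction hu h1p sub1p
  obtain ⟨V₂, hV₂⟩ := exists_isArcRestriction hu h2p sub2p
  obtain ⟨W₂, hW₂⟩ := exists_isArcRestriction hu h2.ne' sub2
  obtain ⟨E₁, hE₁⟩ := exists_isArcExtension hu h1.ne' sub1
  obtain ⟨E₂, hE₂⟩ := exists_isArcExtension hu h2p sub2p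
  obtain ⟨C, hC, -⟩ := exists_isWeightedConv_norm_le (continuous_stripKernel hk hk')
    (integrable_mul_of_le_exp_neg_abs (continuous_stripKernel hk hk') (abs_stripKernel_le hk hk'))
  obtain ⟨D, hD, -⟩ := exists_isWeightedConv_norm_le (continuous_stripKernel hd hd')
    (integrable_mul_of_le_exp_neg_abs (continuous_stripKernel hd hd') (abs_stripKernel_le hd hd'))
  have hT1 : IsDtD (bipolarCenter m u β₁) (‖u‖ / Real.sin β₁) (bipolarCenter m u β₂)
        (‖u‖ / Real.sin β₂) (E₁ ∘L (D ∘L W₂ + C ∘L V₂)) :=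
    isDtD_of_bipolar hu h2 h1.ne' hd hd' sub1 (interiorArc_eq_range hu h1 h2 hs) hW₂ hV₂ hD hC hE₁
  have hb : β₂ + Real.pi - β₁ = Real.pi - θ := by rw [hθ]; ring
  have hT2 : IsDtD (bipolarCenter m u β₂) (‖u‖ / Real.sin β₂) (bipolarCenter m u β₁)
        (‖u‖ / Real.sin β₁) (E₂ ∘L (C ∘L V₁ + D ∘L W₁)) :=
    isDtD_of_bipolar hu h1 h2p (by rw [hb]; exact hk) (by rw [hb]; exact hk') sub2p
      (interiorArc_eq_range_add_pi hu h1 h2 hs) hV₁ hW₁ (by rw [hb]; exact hC)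
      (by rw [hb, sub_sub_cancel]; exact hD) hE₂
  set B : CircleL2 (bipolarCenter m u β₁) (‖u‖ / Real.sin β₁) →L[ℂ] LineL2 :=
    (D ∘L W₂ + C ∘L V₂) ∘L (E₂ ∘L (C ∘L V₁ + D ∘L W₁)) with hB
  -- Each `E` is supported on an interior arc, where `V ∘ E` is the identity and `W ∘ E` vanishes;
  -- the exterior contributions drop out.
  have hBE : B ∘L E₁ = C ^ 2 := by
    ext1 F
    have a1 := hV₁.comp_extension hu h1.ne' sub1 hE₁ F
    have a2 := hW₁.comp_extension_of_disjoint hu h1p sub1p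
      (disjoint_range_bipolarArc hu h1 h1) hE₁ F
    have a3 := hV₂.comp_extension hu h2p sub2p hE₂ (C F)
    have a4 := hW₂.comp_extension_of_disjoint hu h2.ne' sub2
      (disjoint_range_bipolarArc hu h2 h2).symm hE₂ (C F)
    simp [hB, a1, a2, a3, a4, sq]
  have hcomp : (E₁ ∘L (D ∘L W₂ + C ∘L V₂)) ∘L (E₂ ∘L (C ∘L V₁ + D ∘L W₁)) = E₁ ∘L B := rfl
  have heig : ∀ z₀ ∈ dualStrip,
        ∃ hf : MemLp (arcEigenfunction (bipolarCenter m u β₁) (‖u‖ / Real.sin β₁)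
            (bipolarCenter m u β₂) (‖u‖ / Real.sin β₂) (Real.pi - β₁) z₀) 2
            (circleMeasure (bipolarCenter m u β₁) (‖u‖ / Real.sin β₁)),
          Module.End.HasEigenvector
            ((E₁ ∘L B : CircleL2 (bipolarCenter m u β₁) (‖u‖ / Real.sin β₁) →L[ℂ]
              CircleL2 (bipolarCenter m u β₁) (‖u‖ / Real.sin β₁)) :
              CircleL2 (bipolarCenter m u β₁) (‖u‖ / Real.sin β₁) →ₗ[ℂ]
              CircleL2 (bipolarCenter m u β₁) (‖u‖ / Real.sin β₁))
            (conj (poissonHat (Real.pi - θ) z₀ ^ 2))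
            (hf.toLp (arcEigenfunction (bipolarCenter m u β₁) (‖u‖ / Real.sin β₁)
              (bipolarCenter m u β₂) (‖u‖ / Real.sin β₂) (Real.pi - β₁) z₀)) := by
    intro z₀ hz₀
    have hc : |(I * conj z₀).re| < 1 / 2 := by
      have : |z₀.im| < 1 / 2 := hz₀
      simpa using this
    set e := (memLp_weightedExp hc).toLp (weightedExp (I * conj z₀)) with he
    -- The weight of the extension cancels that of the exponential, leaving exp (i conj(z₀) t), a
    -- power of the base `exp t`.
    have hfe : E₁ e =ᵐ[circleMeasure (bipolarCenter m u β₁) (‖u‖ / Real.sin β₁)]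
        arcEigenfunction (bipolarCenter m u β₁) (‖u‖ / Real.sin β₁)
            (bipolarCenter m u β₂) (‖u‖ / Real.sin β₂) (Real.pi - β₁) z₀ := by
      have hae : ∀ᵐ t : ℝ, e (bipolarCoord m u (bipolarArc m u β₁ t)) =
          weightedExp (I * conj z₀) (bipolarCoord m u (bipolarArc m u β₁ t)) := by
        simp_rw [bipolarCoord_bipolarArc m hu h1.ne']
        exact (memLp_weightedExp hc).coeFn_toLp
      have hae' := (ae_bipolarArc_iff (P := fun p => e (bipolarCoord m u p) =
          weightedExp (I * conj z₀) (bipolarCoord m u p)) hu h1.ne' sub1).2 hae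
      filter_upwards [hE₁ e, hae'] with p hp1 hp2
      rw [hp1, arcEigenfunction, interiorArc_eq_range hu h1 h2 hs]
      by_cases hp : p ∈ Set.range (bipolarArc m u β₁)
      · rw [hp2 hp, Set.indicator_of_mem hp, Set.indicator_of_mem hp]
        obtain ⟨t, rfl⟩ := hp
        rw [arcAngle_ratio_eq_exp hu h1 h2 hs, bipolarCoord_bipolarArc m hu h1.ne', weightedExp,
          ← mul_assoc, ← Complex.ofReal_mul, ← Real.exp_add, neg_div, add_neg_cancel,
          Real.exp_zero, Complex.ofReal_one, one_mul,
          Complex.cpow_def_of_ne_zero (by exact_mod_cast (Real.exp_pos t).ne'),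
          ← Complex.ofReal_log (Real.exp_pos t).le, Real.log_exp, mul_comm]
      · rw [Set.indicator_of_notMem hp, Set.indicator_of_notMem hp, Complex.ofReal_zero, zero_mul]
    have hf := (Lp.memLp (E₁ e)).ae_eq hfe
    have hfE : hf.toLp _ = E₁ e := by
      apply Lp.ext
      exact hf.coeFn_toLp.trans hfe.symm
    refine ⟨hf, ?_⟩
    rw [hfE, Module.End.hasEigenvector_iff, Module.End.mem_eigenspace_iff]
    constructor
    · have h3 : B (E₁ e) = (C ^ 2) e := by rw [← hBE]; rfl
      have h4 : C e = poissonHat (Real.pi - θ) (conj z₀) • e := hC.apply_weightedExp hk hk' hc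
      change E₁ (B (E₁ e)) = _
      rw [h3, sq, mul_apply_eq_comp, h4, map_smul, h4, smul_smul, map_smul, poissonHat_conj,
        map_pow, sq]
    -- The extension is injective, since restriction is its left inverse.
    · intro h0
      have h3 := hV₁.comp_extension hu h1.ne' sub1 hE₁ e
      rw [h0, map_zero] at h3
      exact toLp_weightedExp_ne_zero hc h3.symm
  have hspec : spectrum ℂ (E₁ ∘L B) =
      closure ((fun z => conj (poissonHat (Real.pi - θ) z ^ 2)) '' dualStrip) := by
    apply Set.Subset.antisymm
    · refine (spectrum_comp_subset E₁ B).trans (Set.insert_subset ?_ ?_)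
      · exact zero_mem_closure_sq_poissonHat hk hk'
      · rw [hBE]
        exact hC.spectrum_sq_subset hk hk'
    · refine closure_minimal ?_ (spectrum.isClosed _)
      rintro _ ⟨z, hz, rfl⟩
      obtain ⟨hf, hv⟩ := heig z hz
      exact mem_spectrum_of_hasEigenvector hv
  refine ⟨E₁ ∘L (D ∘L W₂ + C ∘L V₂), E₂ ∘L (C ∘L V₁ + D ∘L W₁), hT1, hT2, hspec, ?_, heig⟩
  rw [hcomp, spectralRadius_of_spectrum_eq hk hk' hspec, sub_sub_cancel, Real.sin_sq_eq_half_sub,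
    mul_div_cancel₀ _ two_ne_zero]
  congr 1
  ring

end Bipolar

/-! ### Reduction of a general pair of disks to bipolar coordinates. -/

section Triangle

/-- A triangle side strictly between the difference and the sum of the other two is opposite to a
nondegenerate angle. -/
theorem angle_mem_Ioo_of_law_cos {x y z φ : ℝ} (hx : 0 < x) (hy : 0 < y) (hz : 0 < z)
    (hφ : 0 ≤ φ) (hφ' : φ ≤ Real.pi) (hlaw : z * z = x * x + y * y - 2 * x * y * Real.cos φ)
    (hsum : z < x + y) (hxy : x < y + z) (hyx : y < x + z) : 0 < φ ∧ φ < Real.pi := by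
  constructor
  · refine lt_of_le_of_ne hφ fun h => ?_
    rw [← h, Real.cos_zero] at hlaw
    nlinarith
  · refine lt_of_le_of_ne hφ' fun h => ?_
    rw [h, Real.cos_pi] at hlaw
    nlinarith

end Triangle

theorem theorem5p5 (x₁ x₂ : ℂ) (r₁ r₂ : ℝ) (hr₁ : 0 < r₁) (hr₂ : 0 < r₂)
    (hne : (ball x₁ r₁ ∩ ball x₂ r₂).Nonempty)
    (h₁₂ : ¬ ball x₁ r₁ ⊆ ball x₂ r₂) (h₂₁ : ¬ ball x₂ r₂ ⊆ ball x₁ r₁)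
    (a : ℂ) (ha : a ∈ sphere x₁ r₁ ∩ sphere x₂ r₂)
    (θ σ : ℝ) (hθ : θ = EuclideanGeometry.angle x₁ a x₂)
    (hσ : σ = EuclideanGeometry.angle a x₁ x₂) :
    ∃ (γ₁ : CircleL2 x₂ r₂ →L[ℂ] CircleL2 x₁ r₁) (γ₂ : CircleL2 x₁ r₁ →L[ℂ] CircleL2 x₂ r₂),
      IsDtD x₁ r₁ x₂ r₂ γ₁ ∧ IsDtD x₂ r₂ x₁ r₁ γ₂ ∧
      spectrum ℂ (γ₁ ∘L γ₂) =
        closure ((fun z => conj (poissonHat (Real.pi - θ) z ^ 2)) '' dualStrip) ∧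
      spectralRadius ℂ (γ₁ ∘L γ₂) = ENNReal.ofReal ((1 - Real.cos θ) / 2) ∧
      ∀ z₀ ∈ dualStrip,
        ∃ hf : MemLp (arcEigenfunction x₁ r₁ x₂ r₂ σ z₀) 2 (circleMeasure x₁ r₁),
          Module.End.HasEigenvector
            ((γ₁ ∘L γ₂ : CircleL2 x₁ r₁ →L[ℂ] CircleL2 x₁ r₁) :
              CircleL2 x₁ r₁ →ₗ[ℂ] CircleL2 x₁ r₁)
            (conj (poissonHat (Real.pi - θ) z₀ ^ 2))
            (hf.toLp (arcEigenfunction x₁ r₁ x₂ r₂ σ z₀)) := by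
  obtain ⟨p, hp₁, hp₂⟩ := hne
  obtain ⟨ha₁, ha₂⟩ := ha
  -- The hypotheses on the disks are used as the strict triangle inequalities for the side lengths
  -- r₁, r₂ and the distance of the centers; hence all three angles are nondegenerate.
  have hD₁ : dist x₁ x₂ < r₁ + r₂ :=
    (dist_triangle_left x₁ x₂ p).trans_lt (add_lt_add hp₁ hp₂)
  have hD₂ : r₂ < r₁ + dist x₁ x₂ := by
    by_contra! h
    exact h₁₂ (ball_subset_ball' h)
  have hD₃ : r₁ < r₂ + dist x₁ x₂ := by
    by_contra! h
    exact h₂₁ (ball_subset_ball' (by rwa [dist_comm x₂ x₁]))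
  have hD : 0 < dist x₁ x₂ := by
    rcases le_total r₁ r₂ with h | h <;> linarith
  rw [mem_sphere] at ha₁ ha₂
  have hx : x₁ ≠ x₂ := dist_pos.1 hD
  have hax₁ : a ≠ x₁ := dist_pos.1 (ha₁ ▸ hr₁)
  obtain ⟨σ₂, hσ₂⟩ : ∃ s, s = EuclideanGeometry.angle a x₂ x₁ := ⟨_, rfl⟩
  have cθ := EuclideanGeometry.law_cos x₁ a x₂
  have cσ := EuclideanGeometry.law_cos a x₁ x₂
  have cσ₂ := EuclideanGeometry.law_cos a x₂ x₁
  have sσ := EuclideanGeometry.law_sin x₂ x₁ a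
  have hang := EuclideanGeometry.angle_add_angle_add_angle_eq_pi x₂ hax₁.symm
  rw [EuclideanGeometry.angle_comm x₂ x₁ a] at sσ
  rw [EuclideanGeometry.angle_comm x₂ a x₁] at hang
  rw [EuclideanGeometry.angle_comm x₁ x₂ a] at hang
  simp only [dist_comm x₂ x₁, dist_comm x₁ a, dist_comm x₂ a, ha₁, ha₂, ← hθ, ← hσ, ← hσ₂]
    at cθ cσ cσ₂ sσ hang
  have bθ := angle_mem_Ioo_of_law_cos hr₁ hr₂ hD (hθ ▸ EuclideanGeometry.angle_nonneg _ _ _)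
    (hθ ▸ EuclideanGeometry.angle_le_pi _ _ _) cθ (by linarith) (by linarith) (by linarith)
  have bσ := angle_mem_Ioo_of_law_cos hr₁ hD hr₂ (hσ ▸ EuclideanGeometry.angle_nonneg _ _ _)
    (hσ ▸ EuclideanGeometry.angle_le_pi _ _ _) cσ (by linarith) (by linarith) (by linarith)
  have bσ₂ := angle_mem_Ioo_of_law_cos hr₂ hD hr₁ (hσ₂ ▸ EuclideanGeometry.angle_nonneg _ _ _)
    (hσ₂ ▸ EuclideanGeometry.angle_le_pi _ _ _) cσ₂ (by linarith) (by linarith) (by linarith)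
  clear hθ hσ hσ₂
  have hs := Real.sin_pos_of_pos_of_lt_pi bσ.1 bσ.2
  have hs₂ := Real.sin_pos_of_pos_of_lt_pi bσ₂.1 bσ₂.2
  set D := dist x₁ x₂ with hDdef
  -- The sum of the laws of cosines at the two centers: the radii project onto the segment between
  -- them.
  have hDcos : D = r₁ * Real.cos σ + r₂ * Real.cos σ₂ := by
    apply mul_left_cancel₀ hD.ne'
    linarith
  have hnD : ‖x₂ - x₁‖ = D := by rw [hDdef, dist_comm, dist_eq_norm]
  have hDC : (D : ℂ) ≠ 0 := by exact_mod_cast hD.ne'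
  set e : ℂ := (x₂ - x₁) / D with he
  have hex : x₂ = x₁ + D * e := by rw [he]; field_simp; ring
  have hne' : ‖e‖ = 1 := by
    rw [he, norm_div, hnD, Complex.norm_real, Real.norm_of_nonneg hD.le, div_self hD.ne']
  -- `u` points along the line of centers and has the length of half the common chord. With m the
  -- foot of the altitude from `a`, the poles m ± u i are the two intersection points, and the
  -- angles are β₁ = π - σ and β₂ = σ₂.
  set u : ℂ := (r₁ * Real.sin σ : ℝ) * e with hu
  have hnu : ‖u‖ = r₁ * Real.sin σ := by
    rw [hu, norm_mul, hne', mul_one, Complex.norm_real, Real.norm_of_nonneg (by positivity)]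
  have hsum : r₁ * Real.sin σ = r₂ * Real.sin σ₂ := by linarith
  have e₁ : x₁ = bipolarCenter (x₁ + (r₁ * Real.cos σ : ℝ) * e) u (Real.pi - σ) := by
    rw [bipolarCenter, Real.cos_pi_sub, Real.sin_pi_sub, hu]
    have : (Real.sin σ : ℂ) ≠ 0 := by exact_mod_cast hs.ne'
    push_cast [-Complex.ofReal_sin, -Complex.ofReal_cos]
    field_simp
    ring
  have e₂ : x₂ = bipolarCenter (x₁ + (r₁ * Real.cos σ : ℝ) * e) u σ₂ := by
    rw [bipolarCenter, hu, hsum, hex, hDcos]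
    have : (Real.sin σ₂ : ℂ) ≠ 0 := by exact_mod_cast hs₂.ne'
    push_cast [-Complex.ofReal_sin, -Complex.ofReal_cos]
    field_simp
    ring
  have e₃ : r₁ = ‖u‖ / Real.sin (Real.pi - σ) := by
    rw [Real.sin_pi_sub, hnu, mul_div_cancel_right₀ _ hs.ne']
  have e₄ : r₂ = ‖u‖ / Real.sin σ₂ := by
    rw [hnu, hsum, mul_div_cancel_right₀ _ hs₂.ne']
  -- The angle sum of the triangle identifies θ with β₁ - β₂.
  have hθ : θ = Real.pi - σ - σ₂ := by linarith
  have main := spectrum_dirichletToDirichlet_bipolar (m := x₁ + (r₁ * Real.cos σ : ℝ) * e)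
    (u := u) (β₁ := Real.pi - σ) (β₂ := σ₂)
    (norm_pos_iff.1 (by rw [hnu]; positivity)) (by rwa [Real.sin_pi_sub]) hs₂
    (by linarith [bθ.1]) (by linarith [bθ.2])
  rw [← hθ, ← e₁, ← e₂, ← e₃, ← e₄, sub_sub_cancel] at main
  exact main
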